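/- **Analytic Stable Manifold Theorem.** Let $f:U\to\mathbb C^n$ be analytic on an open set $U\subset\mathbb C^n$, let $u_*\in U$ with $f(u_*)=0$, and let $A:=df(u_*)$. Let $\Sigma_s,\Sigma_c,\Sigma_u$ be the sums of the generalized eigenspaces of $A$ for eigenvalues with negative, zero and positive real part, and let $\Pi_s,\Pi_c,\Pi_u$ be the corresponding total eigenprojections. For $a\in\mathbb R$, $\nu>0$ put $W^+_{a,\nu}=\{\operatorname{Re}t\ge a,\ |\operatorname{Im}t|\le\nu|\operatorname{Re}t-a|\}$ and $W^-_{a,\nu}=\{\operatorname{Re}t\le a,\ |\operatorname{Im}t|\le\nu|\operatorname{Re}t-a|\}$. Let $\eta>0$ be strictly smaller than $|\operatorname{Re}\mu|$ for every stable or unstable eigenvalue $\mu$ of $A$, and let $\theta>0$. Consider, for $\nu>0$, the bounds, for some constant $C$, $$|e^{At}\Pi_s|\le Ce^{-\eta|\operatorname{Re}t|}\ (t\in W^+_{0,\nu}),\quad |e^{At}\Pi_c|\le Ce^{\theta|t|}\ (|\operatorname{Im}t|\le\nu|\operatorname{Re}t|),\quad |e^{At}\Pi_u|\le Ce^{-\eta|\operatorname{Re}t|}\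 (t\in W^-_{0,\nu}).\qquad(*)$$ 1. For all such $\eta,\theta$ there is $\nu>0$ such that $(*)$ holds. 2. There are $R>0$ and an analytic map $\Phi:\{\xi\in\Sigma_s:|\xi|<R\}\to\Sigma_c\oplus\Sigma_u$ with $\Phi(0)=0$, $d\Phi(0)=0$, such that $\mathcal M_\rho:=\{u_*+\xi+\Phi(\xi):\xi\in\Sigma_s,\ |\xi|<\rho\}$, $0<\rho\le R$, satisfies $\mathcal M_R\subset U$, and $\mathcal M_R$ is locally invariant: any solution of $u'=f(u)$ on a connected open set of complex times that stays in $\{u\in U:|\Pi_s(u-u_*)|<R\}$ and meets $\mathcal M_R$ lies in $\mathcal M_R$. Moreover, for all $\eta,\theta,\nu$ as in $(*)$: - (decay) there are $0<r\le R$ and constants $C(\tilde\eta)$, $0<\tilde\eta<\eta$, such that through each $q\in\mathcal M_r$ there is a solution $u$, $u(0)=q$, analytic on $W^+_{0,\nu}$, with values in $\mathcal M_R$, and $$|u(t)-u_*|\le C(\tilde\eta)e^{-\tilde\eta|\operatorname{Re}t|}|u(0)-u_*|,\qquad t\in W^+_{0,\nu},\ 0<\tilde\eta<\eta;$$ and for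 each $\tilde\eta\in(0,\eta)$ and $K\ge C(\tilde\eta)$, a point $q$ sufficiently near $u_*$ lies in $\mathcal M_R$ if and only if there is a solution on $W^+_{0,\nu}$ with $u(0)=q$ obeying this bound with $K$ in place of $C(\tilde\eta)$; - (uniqueness) there is $\delta>0$ such that every solution on $W^+_{0,\nu}$ that satisfies $|u(t)-u_*|<\delta$ there and decays exponentially to $u_*$ as $|u(t)-u_*|\le Ke^{-\beta|\operatorname{Re}t|}$, for some $K$ and some $\beta>0$, has $u(0)\in\mathcal M_R$. 3. (Profiles) Let $u$ be a solution of $u'=f(u)$ in $U$ on a real half-line $[x_0,+\infty)$ such that either $A$ has no eigenvalue with zero real part and $u(x)\to u_*$ as $x\to+\infty$, or $|u(x)-u_*|\le Ke^{-\beta x}$ for some $K$ and some $\beta>0$. Then for all $\eta,\theta,\nu$ as in $(*)$ there is $a\ge x_0$ such that $u|_{[a,\infty)}$ extends to a solution analytic on $W^+_{a,\nu}$ which satisfies, for every $\tilde\eta\in(0,\eta)$, $|u(z)-u_*|\le K(\tilde\eta)e^{-\tilde\eta|\operatorname{Re}z|}$ on $W^+_{a,\nu}$. Likewise, for solutions on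 $(-\infty,x_0]$ tending to $u_*$ as $x\to-\infty$ (with $A$ having no eigenvalue with zero real part, or with $|u(x)-u_*|\le Ke^{\beta x}$), the same holds on $W^-_{a,\nu}$ for some $a\le x_0$. -/

import Mathlib

noncomputable section

namespace AnalyticStable

/-- The phase space `ℂⁿ` with its Hermitian norm. -/
abbrev Cn (n : ℕ) : Type := EuclideanSpace ℂ (Fin n)

/-! ### Stable, center and unstable subspaces and the total eigenprojections -/

/-- The direct sum of the generalized eigenspaces of `A` for the eigenvalues in `S`. -/
def spectralSubspace {n : ℕ} (A : Cn n →L[ℂ] Cn n) (S : Set ℂ) : Submodule ℂ (Cn n) :=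
  ⨆ μ ∈ S, Module.End.maxGenEigenspace (A : Module.End ℂ (Cn n)) μ

theorem isCompl_spectralSubspace {n : ℕ} (A : Cn n →L[ℂ] Cn n) (S : Set ℂ) :
    IsCompl (spectralSubspace A S) (spectralSubspace A Sᶜ) := by
  constructor
  · exact (Module.End.independent_maxGenEigenspace
      (A : Module.End ℂ (Cn n))).disjoint_biSup_biSup disjoint_compl_right
  · rw [codisjoint_iff, eq_top_iff,
      ← Module.End.iSup_maxGenEigenspace_eq_top (A : Module.End ℂ (Cn n))]
    refine iSup_le fun μ => ?_
    by_cases h : μ ∈ S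
    · exact le_sup_of_le_left
        (le_iSup₂_of_le (f := fun μ (_ : μ ∈ S) =>
          Module.End.maxGenEigenspace (A : Module.End ℂ (Cn n)) μ) μ h le_rfl)
    · exact le_sup_of_le_right
        (le_iSup₂_of_le (f := fun μ (_ : μ ∈ Sᶜ) =>
          Module.End.maxGenEigenspace (A : Module.End ℂ (Cn n)) μ) μ h le_rfl)

/-- The total eigenprojection of `A` for the eigenvalues in `S`: the projection onto the sum of
the corresponding generalized eigenspaces along the sum of all the others. -/
def spectralProj {n : ℕ} (A : Cn n →L[ℂ] Cn n) (S : Set ℂ) : Cn n →ₗ[ℂ] Cn n :=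
  Submodule.projection (spectralSubspace A S) (spectralSubspace A Sᶜ)
    (isCompl_spectralSubspace A S)

/-- The stable subspace `Σ_s`. -/
def stableSubspace {n : ℕ} (A : Cn n →L[ℂ] Cn n) : Submodule ℂ (Cn n) :=
  spectralSubspace A {μ | μ.re < 0}

/-- The center subspace `Σ_c`. -/
def centerSubspace {n : ℕ} (A : Cn n →L[ℂ] Cn n) : Submodule ℂ (Cn n) :=
  spectralSubspace A {μ | μ.re = 0}

/-- The unstable subspace `Σ_u`. -/
def unstableSubspace {n : ℕ} (A : Cn n →L[ℂ] Cn n) : Submodule ℂ (Cn n) :=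
  spectralSubspace A {μ | 0 < μ.re}

/-- The center-unstable subspace `Σ_c ⊕ Σ_u`. -/
def centerUnstableSubspace {n : ℕ} (A : Cn n →L[ℂ] Cn n) : Submodule ℂ (Cn n) :=
  centerSubspace A ⊔ unstableSubspace A

/-- The projection `Π_s`. -/
def stableProj {n : ℕ} (A : Cn n →L[ℂ] Cn n) : Cn n →ₗ[ℂ] Cn n :=
  spectralProj A {μ | μ.re < 0}

/-- The projection `Π_c`. -/
def centerProj {n : ℕ} (A : Cn n →L[ℂ] Cn n) : Cn n →ₗ[ℂ] Cn n :=
  spectralProj A {μ | μ.re = 0}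

/-- The projection `Π_u`. -/
def unstableProj {n : ℕ} (A : Cn n →L[ℂ] Cn n) : Cn n →ₗ[ℂ] Cn n :=
  spectralProj A {μ | 0 < μ.re}

/-- `A` has no center subspace. -/
def IsHyperbolic {n : ℕ} (A : Cn n →L[ℂ] Cn n) : Prop :=
  ∀ μ : ℂ, Module.End.HasEigenvalue (A : Module.End ℂ (Cn n)) μ → μ.re ≠ 0

/-! ### Wedges and the linearized bounds -/

/-- The closed forward wedge `Re t ≥ a`, `|Im t| ≤ ν |Re t - a|` with real vertex `a`. -/
def forwardWedge (a ν : ℝ) : Set ℂ := {t | a ≤ t.re ∧ |t.im| ≤ ν * |t.re - a|}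

/-- The closed backward wedge `Re t ≤ a`, `|Im t| ≤ ν |Re t - a|` with real vertex `a`. -/
def backwardWedge (a ν : ℝ) : Set ℂ := {t | t.re ≤ a ∧ |t.im| ≤ ν * |t.re - a|}

/-- `η > 0` is strictly smaller than the absolute value of the real part of every stable and
every unstable eigenvalue of `A`. -/
def IsSpectralRate {n : ℕ} (A : Cn n →L[ℂ] Cn n) (η : ℝ) : Prop :=
  0 < η ∧ ∀ μ : ℂ, Module.End.HasEigenvalue (A : Module.End ℂ (Cn n)) μ →
    μ.re ≠ 0 → η < |μ.re|

/-- The bounds on the linearized propagators `e^{At}Π_s`, `e^{At}Π_c`, `e^{At}Π_u` in wedges of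
opening `ν`, with rate `η` on the stable and unstable parts and growth rate `θ` on the center
part. -/
structure WedgeBounds {n : ℕ} (A : Cn n →L[ℂ] Cn n) (η θ ν : ℝ) : Prop where
  stable : ∃ C : ℝ, ∀ t ∈ forwardWedge 0 ν, ∀ v : Cn n,
    ‖NormedSpace.exp (t • A) (stableProj A v)‖ ≤ C * Real.exp (-η * |t.re|) * ‖v‖
  center : ∃ C : ℝ, ∀ t : ℂ, |t.im| ≤ ν * |t.re| → ∀ v : Cn n,
    ‖NormedSpace.exp (t • A) (centerProj A v)‖ ≤ C * Real.exp (θ * ‖t‖) * ‖v‖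
  unstable : ∃ C : ℝ, ∀ t ∈ backwardWedge 0 ν, ∀ v : Cn n,
    ‖NormedSpace.exp (t • A) (unstableProj A v)‖ ≤ C * Real.exp (-η * |t.re|) * ‖v‖

/-! ### Solutions and invariance -/

/-- `u` solves `u' = f(u)` in complex time on `D`, with values in the domain `U` of `f`.  At
boundary points of `D` the derivative is taken within `D`. -/
def IsSolutionOn {n : ℕ} (f : Cn n → Cn n) (U : Set (Cn n)) (D : Set ℂ) (u : ℂ → Cn n) : Prop :=
  ∀ t ∈ D, u t ∈ U ∧ HasDerivWithinAt u (f (u t)) D t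

/-- `u` solves `u' = f(u)` in real time on `I`, with values in the domain `U` of `f`. -/
def IsRealSolutionOn {n : ℕ} (f : Cn n → Cn n) (U : Set (Cn n)) (I : Set ℝ) (u : ℝ → Cn n) :
    Prop :=
  ∀ x ∈ I, u x ∈ U ∧ HasDerivWithinAt u (f (u x)) I x

/-- `M` is invariant, relative to `N`, under the complex-time flow of `u' = f(u)`: a solution on
a connected open time domain that stays in `N` and meets `M` lies in `M` throughout. -/
def IsLocallyInvariant {n : ℕ} (f : Cn n → Cn n) (U N M : Set (Cn n)) : Prop :=
  ∀ (D : Set ℂ) (u : ℂ → Cn n), IsOpen D → IsPreconnected D → IsSolutionOn f U D u →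
    (∀ t ∈ D, u t ∈ N) → (∃ t ∈ D, u t ∈ M) → ∀ t ∈ D, u t ∈ M

/-- The part over the ball `|ξ| < R` of the graph `{p + ξ + Φ(ξ)}` of
`Φ : Σ_s → Σ_c ⊕ Σ_u`, based at `p`. -/
def localGraph {n : ℕ} {A : Cn n →L[ℂ] Cn n} (p : Cn n)
    (Φ : stableSubspace A → centerUnstableSubspace A) (R : ℝ) : Set (Cn n) :=
  {q | ∃ ξ : stableSubspace A, ‖ξ‖ < R ∧ q = p + (ξ : Cn n) + (Φ ξ : Cn n)}

/-- `u` solves the equation on the forward wedge with vertex `0` and opening `ν`, and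
`|u(t) - p| ≤ K e^{-β |Re t|} |u(0) - p|` there. -/
def DecaysOnWedge {n : ℕ} (f : Cn n → Cn n) (U : Set (Cn n)) (p : Cn n) (ν β K : ℝ)
    (u : ℂ → Cn n) : Prop :=
  IsSolutionOn f U (forwardWedge 0 ν) u ∧
    ∀ t ∈ forwardWedge 0 ν, ‖u t - p‖ ≤ K * Real.exp (-β * |t.re|) * ‖u 0 - p‖

/-- The graph of `Φ` over `|ξ| < R` is a local analytic stable manifold of `u' = f(u)` at the
equilibrium `p`: analytic, tangent to `Σ_s`, and locally invariant. -/
structure IsAnalyticInvariantGraph {n : ℕ} (f : Cn n → Cn n) (U : Set (Cn n)) (p : Cn n)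
    (A : Cn n →L[ℂ] Cn n) (Φ : stableSubspace A → centerUnstableSubspace A) (R : ℝ) : Prop where
  pos : 0 < R
  analytic : AnalyticOnNhd ℂ Φ (Metric.ball 0 R)
  map_zero : Φ 0 = 0
  tangent : HasFDerivAt Φ (0 : stableSubspace A →L[ℂ] centerUnstableSubspace A) 0
  subset_domain : localGraph p Φ R ⊆ U
  invariant : IsLocallyInvariant f U {q | ‖stableProj A (q - p)‖ < R} (localGraph p Φ R)

/-- The characterization of the graph of `Φ` by exponential decay in the forward wedge of
opening `ν`, at all rates smaller than `η`. -/
structure IsCharacterizedByDecay {n : ℕ} (f : Cn n → Cn n) (U : Set (Cn n)) (p : Cn n)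
    (A : Cn n →L[ℂ] Cn n) (Φ : stableSubspace A → centerUnstableSubspace A) (R η ν : ℝ) :
    Prop where
  /-- Points of the manifold near `p` have analytic solutions in the wedge, which remain in the
  manifold and decay at every rate `β < η`, with a constant depending on `β` only.  Near `p`
  these are the only points with such a solution. -/
  decay : ∃ (r : ℝ) (C : ℝ → ℝ), 0 < r ∧ r ≤ R ∧
    (∀ q ∈ localGraph p Φ r, ∃ u : ℂ → Cn n, u 0 = q ∧
      AnalyticOnNhd ℂ u (forwardWedge 0 ν) ∧
      (∀ t ∈ forwardWedge 0 ν, u t ∈ localGraph p Φ R) ∧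
      ∀ β : ℝ, 0 < β → β < η → DecaysOnWedge f U p ν β (C β) u) ∧
    ∀ β : ℝ, 0 < β → β < η → ∀ K : ℝ, C β ≤ K → ∀ᶠ q in nhds p,
      (q ∈ localGraph p Φ R ↔ ∃ u : ℂ → Cn n, u 0 = q ∧ DecaysOnWedge f U p ν β K u)
  /-- Every solution in the wedge that stays close to `p` and decays exponentially, at some rate
  and with some constant, starts on the manifold. -/
  unique : ∃ δ : ℝ, 0 < δ ∧ ∀ u : ℂ → Cn n, IsSolutionOn f U (forwardWedge 0 ν) u →
    (∀ t ∈ forwardWedge 0 ν, ‖u t - p‖ < δ) →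
    (∃ K β : ℝ, 0 < β ∧ ∀ t ∈ forwardWedge 0 ν, ‖u t - p‖ ≤ K * Real.exp (-β * |t.re|)) →
    u 0 ∈ localGraph p Φ R

end AnalyticStable

end

/-! With the equilibrium moved to `0` the equation reads v' = Av + N(v), where N vanishes to second
order. Decay at a rate β < η is built in by writing v = c w with c(t) = e^{-β(t+1)}: then w' = (A +
β)w + c⁻¹N(cw), and decay of v becomes boundedness of w. For β > 0 the shift moves the center
spectrum into the right half-plane and leaves the stable spectrum on the left, so A + β has an
exponential dichotomy with projection Π_s, whose stable part decays in complex time on a wedge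
(`IsStableCone.exists_isDichotomy`). Hence w' = (A + β)w + h, Π_s w(0) = 0, has exactly one bounded
holomorphic solution for each bounded holomorphic h (`exists_solution`): the stable part is
integrated from 0 along a segment, the unstable part from infinity along a horizontal ray.

On the Banach space `wedgeSpace` the operator w ↦ c⁻¹N(cw) is analytic near 0 with zero derivative
there (`exists_substitution`). The analytic inverse function theorem then yields decaying solutions
V ξ depending analytically on their initial stable component ξ (`exists_family`), and Φ(ξ) = (1 -
Π_s) V ξ(0). As N is quadratic, a solution of rate β ≥ η/2 has a forcing term of rate 2β ≥ η, so it
decays at every rate below η (`exists_sharp_decay`).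

The remaining claims rest on uniqueness on the real half-line (`exists_isUniquenessRadius`): small
solutions decaying at a given rate are determined by their initial stable component. Applied to time
translates, this shows that the orbits V ξ stay on the graph; with uniqueness for Lipschitz
equations along segments it gives local invariance. It identifies the families built for different
rates and openings, so one Φ serves all η and ν. A small decaying solution eventually lies on the
graph, and short backward steps bring its initial point there too. A profile eventually coincides
with some V ξ and thereby extends to a wedge; in the hyperbolic case uniqueness holds at rate 0, so
mere convergence suffices. Profiles at -∞ follow by reversing time.

The wedge bounds enter through an equivalent of their exponential content: the eigenvalues lie in a
cone (`WedgeBounds.isStableCone`). -/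

noncomputable section

namespace AnalyticStable

open Filter Topology Set

/-! ### The propagator of a linear equation in complex time -/

section Exponential

variable {E : Type*} [NormedAddCommGroup E] [NormedSpace ℂ E] [CompleteSpace E]

theorem exp_add_smul (A : E →L[ℂ] E) (s t : ℂ) :
    NormedSpace.exp ((s + t) • A) = NormedSpace.exp (s • A) * NormedSpace.exp (t • A) := by
  let _ : NormedAlgebra ℚ (E →L[ℂ] E) := .restrictScalars ℚ ℂ (E →L[ℂ] E)
  rw [add_smul]
  exact NormedSpace.exp_add_of_commute (((Commute.refl A).smul_left s).smul_right t)

theorem exp_smul_add_smul_one (A : E →L[ℂ] E) (c t : ℂ) :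
    NormedSpace.exp (t • (A + c • (1 : E →L[ℂ] E))) =
      Complex.exp (t * c) • NormedSpace.exp (t • A) := by
  let _ : NormedAlgebra ℚ (E →L[ℂ] E) := .restrictScalars ℚ ℂ (E →L[ℂ] E)
  have h1 : t • (A + c • (1 : E →L[ℂ] E)) = algebraMap ℂ (E →L[ℂ] E) (t * c) + t • A := by
    rw [Algebra.algebraMap_eq_smul_one, smul_add, smul_smul, add_comm]
  rw [h1, NormedSpace.exp_add_of_commute (Algebra.commutes _ _), ← NormedSpace.algebraMap_exp_comm,
    Algebra.algebraMap_eq_smul_one, smul_mul_assoc, one_mul, Complex.exp_eq_exp_ℂ]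

omit [CompleteSpace E] in
theorem exp_zero_smul_apply (A : E →L[ℂ] E) (v : E) :
    NormedSpace.exp ((0 : ℂ) • A) v = v := by
  rw [zero_smul, NormedSpace.exp_zero]; rfl

theorem exp_add_smul_apply (A : E →L[ℂ] E) (s t : ℂ) (v : E) :
    NormedSpace.exp ((s + t) • A) v = NormedSpace.exp (s • A) (NormedSpace.exp (t • A) v) := by
  rw [exp_add_smul]; rfl

theorem exp_smul_apply_exp_neg (A : E →L[ℂ] E) (t : ℂ) (v : E) :
    NormedSpace.exp (t • A) (NormedSpace.exp ((-t) • A) v) = v := by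
  rw [← exp_add_smul_apply, add_neg_cancel, exp_zero_smul_apply]

omit [CompleteSpace E] in
theorem commute_exp_smul {A P : E →L[ℂ] E} (h : Commute P A) (t : ℂ) :
    Commute P (NormedSpace.exp (t • A)) :=
  (h.smul_right t).exp_right

omit [CompleteSpace E] in
theorem commute_apply {A P : E →L[ℂ] E} (h : Commute P A) (v : E) : P (A v) = A (P v) :=
  DFunLike.congr_fun h.eq v

/-- On a generalized eigenvector of eigenvalue `μ` the propagator grows at most like
`exp (re (t μ) + ε |t|)`. -/
theorem exists_norm_exp_smul_apply_le (A : E →L[ℂ] E) (μ : ℂ) (v : E) (k : ℕ)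
    (hv : ((A - μ • (1 : E →L[ℂ] E)) ^ k) v = 0) {ε : ℝ} (hε : 0 < ε) :
    ∃ C : ℝ, 0 ≤ C ∧ ∀ t : ℂ,
      ‖NormedSpace.exp (t • A) v‖ ≤ C * Real.exp ((t * μ).re + ε * ‖t‖) := by
  set N := A - μ • (1 : E →L[ℂ] E) with hN
  have hA : A = N + μ • 1 := by rw [hN]; abel
  have hvan : ∀ j, k ≤ j → (N ^ j) v = 0 := by
    intro j hj
    obtain ⟨m, rfl⟩ := Nat.exists_eq_add_of_le' hj
    rw [pow_add, mul_apply_eq_comp, hv, map_zero]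
  refine ⟨∑ j ∈ Finset.range k, ε⁻¹ ^ j * ‖(N ^ j) v‖,
    Finset.sum_nonneg fun j _ => by positivity, fun t => ?_⟩
  -- `N` acts nilpotently on `v`, so the exponential series is a polynomial in `t`.
  have hsum : NormedSpace.exp (t • N) v =
      ∑ j ∈ Finset.range k, ((j.factorial : ℂ)⁻¹ * t ^ j) • (N ^ j) v := by
    have h1 := (NormedSpace.exp_series_hasSum_exp' (𝕂 := ℂ) (t • N)).mapL
      (ContinuousLinearMap.apply ℂ E v)
    refine h1.unique ?_
    have h2 : ∀ j, (ContinuousLinearMap.apply ℂ E v) ((j.factorial : ℂ)⁻¹ • (t • N) ^ j) =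
        ((j.factorial : ℂ)⁻¹ * t ^ j) • (N ^ j) v := by
      intro j
      simp [smul_pow, smul_smul]
    simp only [h2]
    refine hasSum_sum_of_ne_finset_zero fun j hj => ?_
    rw [hvan j (by simpa using hj), smul_zero]
  rw [hA, exp_smul_add_smul_one, smul_apply, norm_smul, Complex.norm_exp,
    hsum, Real.exp_add, mul_left_comm]
  refine mul_le_mul_of_nonneg_left ?_ (Real.exp_pos _).le
  rw [Finset.sum_mul]
  refine (norm_sum_le _ _).trans (Finset.sum_le_sum fun j _ => ?_)
  rw [norm_smul, mul_right_comm]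
  refine mul_le_mul_of_nonneg_right ?_ (norm_nonneg _)
  -- Each power of |t| is traded for e^{ε|t|} at the price of the factor ε^{-j}.
  have h3 := Real.pow_div_factorial_le_exp (ε * ‖t‖) (by positivity) j
  have h4 : ‖((j.factorial : ℂ)⁻¹ * t ^ j)‖ = ε⁻¹ ^ j * ((ε * ‖t‖) ^ j / j.factorial) := by
    rw [norm_mul, norm_inv, norm_pow, mul_pow, inv_pow]
    simp only [Complex.norm_natCast]
    field_simp
  rw [h4]
  exact mul_le_mul_of_nonneg_left h3 (by positivity)

end Exponential

/-! ### Spectral projections and propagator bounds -/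

section Spectral

variable {n : ℕ} (A : Cn n →L[ℂ] Cn n)

theorem hasEigenvalue_of_maxGenEigenspace_ne_bot {μ : ℂ}
    (h : Module.End.maxGenEigenspace (A : Module.End ℂ (Cn n)) μ ≠ ⊥) :
    Module.End.HasEigenvalue (A : Module.End ℂ (Cn n)) μ :=
  Module.End.hasUnifEigenvalue_iff_hasUnifEigenvalue_one (by simp) |>.1 h

theorem norm_le_of_hasEigenvalue {μ : ℂ}
    (h : Module.End.HasEigenvalue (A : Module.End ℂ (Cn n)) μ) : ‖μ‖ ≤ ‖A‖ := by
  obtain ⟨v, hv⟩ := h.exists_hasEigenvector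
  have h1 : A v = μ • v := hv.apply_eq_smul
  have h2 := A.le_opNorm v
  rw [h1, norm_smul] at h2
  exact le_of_mul_le_mul_right h2 (norm_pos_iff.2 hv.2)

/-- The total eigenprojection as a continuous linear map. -/
def spectralProjL (S : Set ℂ) : Cn n →L[ℂ] Cn n :=
  LinearMap.toContinuousLinearMap (spectralProj A S)

theorem spectralProjL_mem (S : Set ℂ) (v : Cn n) : spectralProjL A S v ∈ spectralSubspace A S :=
  Submodule.projection_apply_mem _ _

theorem spectralProjL_of_mem {S : Set ℂ} {v : Cn n} (hv : v ∈ spectralSubspace A S) :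
    spectralProjL A S v = v :=
  Submodule.projection_apply_of_mem_left _ hv

theorem spectralProjL_eq_zero_iff {S : Set ℂ} {v : Cn n} :
    spectralProjL A S v = 0 ↔ v ∈ spectralSubspace A Sᶜ :=
  Submodule.projection_apply_eq_zero_iff _

theorem sub_spectralProjL_mem (S : Set ℂ) (v : Cn n) :
    v - spectralProjL A S v ∈ spectralSubspace A Sᶜ :=
  Submodule.sub_projection_mem _ _

theorem map_mem_spectralSubspace (S : Set ℂ) {v : Cn n} (hv : v ∈ spectralSubspace A S) :
    A v ∈ spectralSubspace A S := by
  have h : spectralSubspace A S ≤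
      (spectralSubspace A S).comap (A : Module.End ℂ (Cn n)) := by
    refine iSup₂_le fun μ hμ v hv => ?_
    have h1 := Module.End.mapsTo_maxGenEigenspace_of_comm
      (Commute.refl (A : Module.End ℂ (Cn n))) μ hv
    exact (le_iSup₂_of_le (f := fun μ (_ : μ ∈ S) =>
      Module.End.maxGenEigenspace (A : Module.End ℂ (Cn n)) μ) μ hμ le_rfl) h1
  exact h hv

/-- Both summands of the spectral decomposition are invariant under `A`. -/
theorem commute_spectralProjL (S : Set ℂ) : Commute (spectralProjL A S) A := by
  ext1 v
  change spectralProjL A S (A v) = A (spectralProjL A S v)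
  have h1 : spectralProjL A S (A (v - spectralProjL A S v)) = 0 :=
    (spectralProjL_eq_zero_iff A).2 (map_mem_spectralSubspace A _ (sub_spectralProjL_mem A S v))
  have h2 : spectralProjL A S (A (spectralProjL A S v)) = A (spectralProjL A S v) :=
    spectralProjL_of_mem A (map_mem_spectralSubspace A _ (spectralProjL_mem A S v))
  rw [map_sub, map_sub, sub_eq_zero, h2] at h1
  exact h1

theorem spectralProjL_idem (S : Set ℂ) (v : Cn n) :
    spectralProjL A S (spectralProjL A S v) = spectralProjL A S v :=
  spectralProjL_of_mem A (spectralProjL_mem A S v)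

/-- Exponential bounds on the propagator restricted to a spectral subspace, from bounds on the
exponents of the eigenvalues. -/
theorem exists_norm_exp_spectralProjL_le (S : Set ℂ) (W : Set ℂ) (g : ℂ → ℝ)
    (h : ∀ μ ∈ S, Module.End.HasEigenvalue (A : Module.End ℂ (Cn n)) μ →
      ∃ ε > 0, ∃ c : ℝ, ∀ t ∈ W, (t * μ).re + ε * ‖t‖ ≤ g t + c) :
    ∃ C : ℝ, 0 ≤ C ∧ ∀ t ∈ W, ∀ v : Cn n,
      ‖NormedSpace.exp (t • A) (spectralProjL A S v)‖ ≤ C * Real.exp (g t) * ‖v‖ := by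
  -- The vectors satisfying the bound with some constant form a subspace, so it is enough to treat
  -- generalized eigenvectors.
  let Z : Submodule ℂ (Cn n) :=
    { carrier := {v | ∃ C : ℝ, 0 ≤ C ∧ ∀ t ∈ W,
        ‖NormedSpace.exp (t • A) v‖ ≤ C * Real.exp (g t)}
      zero_mem' := ⟨0, le_rfl, fun t _ => by simp⟩
      add_mem' := by
        rintro v w ⟨C, hC, h1⟩ ⟨D, hD, h2⟩
        refine ⟨C + D, add_nonneg hC hD, fun t ht => ?_⟩
        rw [map_add, add_mul]
        exact (norm_add_le _ _).trans (add_le_add (h1 t ht) (h2 t ht))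
      smul_mem' := by
        rintro c v ⟨C, hC, h1⟩
        refine ⟨‖c‖ * C, by positivity, fun t ht => ?_⟩
        rw [map_smul, norm_smul, mul_assoc]
        exact mul_le_mul_of_nonneg_left (h1 t ht) (norm_nonneg _) }
  have hZ : spectralSubspace A S ≤ Z := by
    refine iSup₂_le fun μ hμ v hv => ?_
    by_cases hv0 : v = 0
    · rw [hv0]; exact Z.zero_mem
    have hev := hasEigenvalue_of_maxGenEigenspace_ne_bot A
      (fun hb => hv0 ((Submodule.mem_bot ℂ).1 (hb ▸ hv)))
    obtain ⟨ε, hε, c, hc⟩ := h μ hμ hev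
    obtain ⟨k, hk⟩ := (Module.End.mem_maxGenEigenspace _ _ _).1 hv
    have hk' : ((A - μ • (1 : Cn n →L[ℂ] Cn n)) ^ k) v = 0 := by
      rw [← hk, ← ContinuousLinearMap.coe_coe, ContinuousLinearMap.toLinearMap_pow]
      rfl
    obtain ⟨C, hC, h1⟩ := exists_norm_exp_smul_apply_le A μ v k hk' hε
    refine ⟨C * Real.exp c, by positivity, fun t ht => (h1 t).trans ?_⟩
    rw [mul_assoc, ← Real.exp_add]
    exact mul_le_mul_of_nonneg_left (Real.exp_le_exp.2 (by linarith [hc t ht])) hC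
  -- Finite dimension makes the constant uniform in the vector: the constants for the standard basis
  -- are added up.
  have hb : ∀ i : Fin n, ∃ C : ℝ, 0 ≤ C ∧ ∀ t ∈ W,
      ‖NormedSpace.exp (t • A) (spectralProjL A S (EuclideanSpace.single i 1))‖
        ≤ C * Real.exp (g t) := fun i => hZ (spectralProjL_mem A S _)
  choose C hC h1 using hb
  refine ⟨∑ i, C i, Finset.sum_nonneg fun i _ => hC i, fun t ht v => ?_⟩
  have hv : v = ∑ i, v i • EuclideanSpace.single i (1 : ℂ) := by
    ext j
    simp [Finset.sum_apply, Pi.single_apply]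
  conv_lhs => rw [hv]
  rw [map_sum, map_sum, mul_assoc, Finset.sum_mul]
  refine (norm_sum_le _ _).trans (Finset.sum_le_sum fun i _ => ?_)
  rw [map_smul, map_smul, norm_smul]
  calc ‖v i‖ * _ ≤ ‖v‖ * (C i * Real.exp (g t)) :=
        mul_le_mul (PiLp.norm_apply_le v i) (h1 i t ht) (norm_nonneg _) (norm_nonneg _)
    _ = _ := by ring

/-- A lower bound for a positive quantity on the eigenvalues. -/
theorem exists_pos_le_of_hasEigenvalue (φ : ℂ → ℝ) :
    ∃ δ > 0, ∀ μ : ℂ, Module.End.HasEigenvalue (A : Module.End ℂ (Cn n)) μ →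
      0 < φ μ → δ ≤ φ μ := by
  have hfin := Module.End.finite_hasEigenvalue (A : Module.End ℂ (Cn n))
  have hev : ∀ᶠ δ : ℝ in 𝓝[>] 0, ∀ μ ∈ {μ | Module.End.HasEigenvalue
      (A : Module.End ℂ (Cn n)) μ}, 0 < φ μ → δ ≤ φ μ := by
    rw [hfin.eventually_all]
    intro μ _
    by_cases h : 0 < φ μ
    · filter_upwards [Ioo_mem_nhdsGT h] with δ hδ _ using hδ.2.le
    · exact Eventually.of_forall fun δ h' => absurd h' h
  obtain ⟨δ, h1, h2⟩ := (hev.and self_mem_nhdsWithin).exists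
  exact ⟨δ, h2, h1⟩

end Spectral

/-! ### Variation of constants and exponential dichotomies -/

section LinearEstimates

variable {E : Type*} [NormedAddCommGroup E] [NormedSpace ℂ E] [CompleteSpace E]

/-- Differentiating jointly in time and vector makes the product rule along complex curves, and
after restriction of scalars along real ones, a case of the chain rule. -/
theorem hasFDerivAt_exp_smul_apply (A : E →L[ℂ] E) (p : ℂ × E) :
    HasFDerivAt (fun p : ℂ × E => NormedSpace.exp (p.1 • A) p.2)
      ((NormedSpace.exp (p.1 • A)).comp
        ((ContinuousLinearMap.fst ℂ ℂ E).smulRight (A p.2) + ContinuousLinearMap.snd ℂ ℂ E)) p := by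
  have h1 : HasFDerivAt (fun p : ℂ × E => NormedSpace.exp (p.1 • A))
      ((ContinuousLinearMap.fst ℂ ℂ E).smulRight (NormedSpace.exp (p.1 • A) * A)) p := by
    have := (hasDerivAt_exp_smul_const A p.1).hasFDerivAt.comp p
      (hasFDerivAt_fst (𝕜 := ℂ) (E := ℂ) (F := E) (p := p))
    refine this.congr_fderiv ?_
    ext q <;> simp
  refine (h1.clm_apply (hasFDerivAt_snd (p := p))).congr_fderiv ?_
  ext q <;> simp

theorem hasDerivAt_exp_smul_apply (A : E →L[ℂ] E) {τ : ℂ → ℂ} {y : ℂ → E} {τ' : ℂ} {y' : E}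
    {s : ℂ} (hτ : HasDerivAt τ τ' s) (hy : HasDerivAt y y' s) :
    HasDerivAt (fun s => NormedSpace.exp (τ s • A) (y s))
      (NormedSpace.exp (τ s • A) (τ' • A (y s) + y')) s := by
  have h := (hasFDerivAt_exp_smul_apply A (τ s, y s)).comp_hasDerivAt s (hτ.prodMk hy)
  refine HasDerivAt.congr_deriv h ?_
  simp

theorem hasDerivWithinAt_exp_smul_apply (A : E →L[ℂ] E) {τ : ℝ → ℂ} {y : ℝ → E} {τ' : ℂ} {y' : E}
    {S : Set ℝ} {s : ℝ} (hτ : HasDerivWithinAt τ τ' S s) (hy : HasDerivWithinAt y y' S s) :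
    HasDerivWithinAt (fun s => NormedSpace.exp (τ s • A) (y s))
      (NormedSpace.exp (τ s • A) (τ' • A (y s) + y')) S s := by
  have h := ((hasFDerivAt_exp_smul_apply A (τ s, y s)).restrictScalars ℝ).comp_hasDerivWithinAt s
    (hτ.prodMk hy)
  refine HasDerivWithinAt.congr_deriv h ?_
  simp

omit [CompleteSpace E] in
theorem hasDerivWithinAt_clm_apply (P : E →L[ℂ] E) {y : ℝ → E} {y' : E}
    {S : Set ℝ} {s : ℝ} (hy : HasDerivWithinAt y y' S s) :
    HasDerivWithinAt (fun s => P (y s)) (P y') S s :=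
  (P.hasFDerivAt.restrictScalars ℝ).comp_hasDerivWithinAt s hy

/-- Variation of constants along a segment, as an inequality. -/
theorem norm_apply_one_le {A P : E →L[ℂ] E} (hc : Commute P A) {c : ℂ} {y h : ℝ → E}
    {b b' : ℝ → ℝ}
    (hy : ∀ s ∈ Icc (0 : ℝ) 1, HasDerivWithinAt y (c • (A (y s) + h s)) (Icc 0 1) s)
    (hb : ∀ s, HasDerivAt b (b' s) s)
    (hh : ∀ s ∈ Icc (0 : ℝ) 1,
      ‖c‖ * ‖NormedSpace.exp (((1 - s : ℝ) * c) • A) (P (h s))‖ ≤ b' s) :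
    ‖P (y 1)‖ ≤ ‖NormedSpace.exp (c • A) (P (y 0))‖ + (b 1 - b 0) := by
  -- Transporting y(s) to the endpoint of the segment cancels the linear term, so only the forcing
  -- is left in the derivative. The mean value inequality with majorant `b` then replaces
  -- integration.
  have hd : ∀ s ∈ Icc (0 : ℝ) 1,
      HasDerivWithinAt (fun s : ℝ => NormedSpace.exp (((1 - s : ℝ) * c) • A) (P (y s)))
        (c • NormedSpace.exp (((1 - s : ℝ) * c) • A) (P (h s))) (Icc 0 1) s := by
    intro s hs
    have hτ : HasDerivWithinAt (fun s : ℝ => ((1 - s : ℝ) : ℂ) * c) (-c) (Icc 0 1) s := by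
      have h1 : HasDerivAt (fun s : ℝ => ((1 - s : ℝ) : ℂ)) ((-1 : ℝ) : ℂ) s :=
        ((hasDerivAt_id s).const_sub 1).ofReal_comp
      simpa using (h1.mul_const c).hasDerivWithinAt
    refine (hasDerivWithinAt_exp_smul_apply A hτ
      (hasDerivWithinAt_clm_apply P (hy s hs))).congr_deriv ?_
    rw [map_smul P, map_add P, commute_apply hc, smul_add, neg_smul,
      neg_add_cancel_left, map_smul]
  have key := image_norm_le_of_norm_deriv_right_le_deriv_boundary
    (B := fun s => ‖NormedSpace.exp (c • A) (P (y 0))‖ + (b s - b 0)) (B' := b')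
    (fun s hs => (hd s hs).continuousWithinAt)
    (fun s hs => ((hd s ⟨hs.1, hs.2.le⟩).mono_of_mem_nhdsWithin
      (Icc_mem_nhdsGE_of_mem hs))) (by simp)
    (fun s => ((hb s).sub_const (b 0)).const_add _)
    (fun s hs => by rw [norm_smul]; exact hh s ⟨hs.1, hs.2.le⟩) (right_mem_Icc.2 zero_le_one)
  simpa using key

/-- Backward variation of constants on a half-line, as an inequality. -/
theorem norm_apply_zero_le {A Q : E →L[ℂ] E} (hc : Commute Q A) {y h : ℝ → E} {H a : ℝ}
    (ha : 0 < a)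
    (hy : ∀ x ∈ Ici (0 : ℝ), HasDerivWithinAt y (A (y x) + h x) (Ici 0) x)
    (hh : ∀ x ∈ Ici (0 : ℝ),
      ‖NormedSpace.exp ((-x : ℂ) • A) (Q (h x))‖ ≤ H * Real.exp (-a * x))
    (hlim : Tendsto (fun x : ℝ => NormedSpace.exp ((-x : ℂ) • A) (Q (y x))) atTop (𝓝 0)) :
    ‖Q (y 0)‖ ≤ H / a := by
  set ψ : ℝ → E := fun x => NormedSpace.exp ((-x : ℂ) • A) (Q (y x)) with hψ
  have h0 : ψ 0 = Q (y 0) := by simp [hψ, NormedSpace.exp_zero]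
  have hd : ∀ x ∈ Ici (0 : ℝ), HasDerivWithinAt ψ
      (NormedSpace.exp ((-x : ℂ) • A) (Q (h x))) (Ici 0) x := by
    intro x hx
    have hτ : HasDerivWithinAt (fun x : ℝ => (-x : ℂ)) (-1) (Ici 0) x := by
      have h1 : HasDerivAt (fun x : ℝ => (x : ℂ)) 1 x := by
        simpa using (hasDerivAt_id x).ofReal_comp
      exact h1.neg.hasDerivWithinAt
    refine (hasDerivWithinAt_exp_smul_apply A hτ
      (hasDerivWithinAt_clm_apply Q (hy x hx))).congr_deriv ?_
    rw [map_add Q, commute_apply hc, neg_one_smul, neg_add_cancel_left]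
  have hH : 0 ≤ H := by
    have := (norm_nonneg _).trans (hh 0 self_mem_Ici)
    simpa using this
  -- The total variation of `ψ` is at most ∫₀^∞ H e^{-as} ds = H/a, and `ψ` tends to 0 at infinity.
  have hbd : ∀ x ∈ Ici (0 : ℝ), ‖Q (y 0)‖ ≤ ‖ψ x‖ + H / a := by
    intro x hx
    have key := image_norm_le_of_norm_deriv_right_le_deriv_boundary
      (f := fun s => ψ s - ψ 0) (a := 0) (b := x)
      (B := fun s => H / a * (1 - Real.exp (-a * s))) (B' := fun s => H * Real.exp (-a * s))
      (fun s hs => ((hd s hs.1).continuousWithinAt.mono Icc_subset_Ici_self).sub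
        continuousWithinAt_const)
      (fun s hs => ((hd s hs.1).mono (Ici_subset_Ici.2 hs.1)).sub_const _) (by simp)
      (fun s => by
        have h1 : HasDerivAt (fun s => -a * s) (-a) s := by
          simpa using (hasDerivAt_id s).const_mul (-a)
        refine ((h1.exp.const_sub 1).const_mul (H / a)).congr_deriv ?_
        field_simp)
      (fun s hs => hh s hs.1) (right_mem_Icc.2 hx)
    have h2 : H / a * (1 - Real.exp (-a * x)) ≤ H / a :=
      mul_le_of_le_one_right (by positivity) (by linarith [Real.exp_pos (-a * x)])
    have h3 : ‖ψ 0‖ ≤ ‖ψ x‖ + ‖ψ x - ψ 0‖ := by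
      exact norm_le_norm_add_norm_sub _ _
    rw [← h0]
    linarith
  have hl : Tendsto (fun x => ‖ψ x‖ + H / a) atTop (𝓝 (0 + H / a)) := by
    simpa using hlim.norm.add_const (H / a)
  rw [zero_add] at hl
  exact ge_of_tendsto hl (eventually_atTop.2 ⟨0, hbd⟩)

/-- An open neighbourhood of the closed forward wedges with vertex `0` and smaller opening. -/
def wedgeNhd (ν : ℝ) : Set ℂ := {t | |t.im| < ν * (t.re + 1)}

theorem isOpen_wedgeNhd (ν : ℝ) : IsOpen (wedgeNhd ν) :=
  isOpen_lt (by fun_prop) (by fun_prop)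

theorem convex_wedgeNhd (ν : ℝ) : Convex ℝ (wedgeNhd ν) := by
  intro s hs t ht a b ha hb hab
  simp only [wedgeNhd, mem_ofPred_eq] at *
  have h1 : (a • s + b • t).im = a * s.im + b * t.im := by simp
  have h2 : (a • s + b • t).re = a * s.re + b * t.re := by simp
  rw [h1, h2]
  have h3 : |a * s.im + b * t.im| ≤ a * |s.im| + b * |t.im| := by
    refine (abs_add_le _ _).trans ?_
    rw [abs_mul, abs_mul, abs_of_nonneg ha, abs_of_nonneg hb]
  have h4 : ν * (a * s.re + b * t.re + 1) =
      a * (ν * (s.re + 1)) + b * (ν * (t.re + 1)) := by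
    linear_combination ν * (-hab)
  rw [h4]
  refine h3.trans_lt ?_
  rcases ha.eq_or_lt with rfl | ha
  · have : b = 1 := by linarith
    subst this; linarith
  · nlinarith [mul_lt_mul_of_pos_left hs ha, mul_le_mul_of_nonneg_left ht.le hb]

theorem zero_mem_wedgeNhd {ν : ℝ} (hν : 0 < ν) : (0 : ℂ) ∈ wedgeNhd ν := by
  simpa [wedgeNhd] using hν

theorem neg_one_lt_re_of_mem_wedgeNhd {ν : ℝ} (hν : 0 < ν) {t : ℂ} (ht : t ∈ wedgeNhd ν) :
    -1 < t.re := by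
  have : 0 < ν * (t.re + 1) := (abs_nonneg _).trans_lt ht
  linarith [(pos_iff_pos_of_mul_pos this).1 hν]

theorem norm_le_of_mem_wedgeNhd {ν : ℝ} (hν : 0 < ν) {t : ℂ} (ht : t ∈ wedgeNhd ν) :
    ‖t‖ ≤ (1 + ν) * (t.re + 2) := by
  have h1 := neg_one_lt_re_of_mem_wedgeNhd hν ht
  have h2 := Complex.norm_le_abs_re_add_abs_im t
  have h3 : |t.re| ≤ t.re + 2 := abs_le.2 ⟨by linarith, by linarith⟩
  have h4 : |t.im| < ν * (t.re + 1) := ht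
  nlinarith

/-- Allows the unstable part at `t` to be integrated from infinity along the ray t + [0, ∞). -/
theorem add_mem_wedgeNhd {ν : ℝ} (hν : 0 < ν) {t : ℂ} (ht : t ∈ wedgeNhd ν) {x : ℝ}
    (hx : 0 ≤ x) : t + x ∈ wedgeNhd ν := by
  have h4 : |t.im| < ν * (t.re + 1) := ht
  simp only [wedgeNhd, mem_ofPred_eq, Complex.add_im, Complex.ofReal_im, add_zero, Complex.add_re,
    Complex.ofReal_re]
  nlinarith

/-- Because the vertex of the domain is -1 and not 0, short backward real times are available too;
`onGraph_zero` steps back by 1/2. -/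
theorem ofReal_mem_wedgeNhd {ν : ℝ} (hν : 0 < ν) {x : ℝ} (hx : -1 < x) :
    (x : ℂ) ∈ wedgeNhd ν := by
  simp only [wedgeNhd, mem_ofPred_eq, Complex.ofReal_im, abs_zero, Complex.ofReal_re]
  exact mul_pos hν (by linarith)

/-- Allows the stable part at `t` to be integrated from 0 along a segment. -/
theorem mul_mem_wedgeNhd {ν : ℝ} (hν : 0 < ν) {t : ℂ} (ht : t ∈ wedgeNhd ν) {s : ℝ}
    (hs : s ∈ Icc (0 : ℝ) 1) : (s : ℂ) * t ∈ wedgeNhd ν := by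
  have := (convex_wedgeNhd ν) (zero_mem_wedgeNhd hν) ht (sub_nonneg.2 hs.2) hs.1 (by ring)
  simpa using this

theorem forwardWedge_subset_wedgeNhd {ν ν' : ℝ} (hν : 0 < ν) (h : ν ≤ ν') :
    forwardWedge 0 ν ⊆ wedgeNhd ν' := by
  rintro t ⟨h1, h2⟩
  rw [sub_zero, abs_of_nonneg h1] at h2
  simp only [wedgeNhd, mem_ofPred_eq]
  nlinarith

/-- The linear equation `y' = B y` has an exponential dichotomy with projection `P`, the decay of
the stable part being uniform on `wedgeNhd ν`. -/
structure IsDichotomy (B P : E →L[ℂ] E) (ν C a : ℝ) : Prop where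
  opening_pos : 0 < ν
  rate_pos : 0 < a
  const_nonneg : 0 ≤ C
  comm : Commute P B
  idem : ∀ v, P (P v) = P v
  stable : ∀ t ∈ wedgeNhd ν, ∀ v,
    ‖NormedSpace.exp (t • B) (P v)‖ ≤ C * Real.exp (-a * t.re) * ‖v‖
  unstable : ∀ x : ℝ, 0 ≤ x → ∀ v,
    ‖NormedSpace.exp ((-x : ℂ) • B) (v - P v)‖ ≤ C * Real.exp (-a * x) * ‖v‖

namespace IsDichotomy

variable {B P : E →L[ℂ] E} {ν C a : ℝ}

omit [CompleteSpace E] in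
theorem comm_compl (hB : IsDichotomy B P ν C a) : Commute (1 - P) B :=
  (Commute.one_left B).sub_left hB.comm

/-- The norm of the solution operator of the inhomogeneous equation. -/
def bound (ν C a : ℝ) : ℝ := (1 + ν) * C * Real.exp (2 * a) / a + C / a

omit [CompleteSpace E] in
theorem bound_nonneg (hB : IsDichotomy B P ν C a) : 0 ≤ bound ν C a := by
  have := hB.opening_pos; have := hB.rate_pos; have := hB.const_nonneg
  unfold bound; positivity

/-- The decay of the propagator along the segment from 0 to `c` compensates its length: |c| ≤ (1 +
ν)(Re c + 2) by the shape of the domain, and the integral of the kernel gains the reciprocal of a(Re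
c + 2). The bound is therefore independent of `c`. -/
theorem norm_stable_le (hB : IsDichotomy B P ν C a) {c : ℂ} (hcD : c ∈ wedgeNhd ν)
    {y h : ℝ → E} {H : ℝ}
    (hy : ∀ s ∈ Icc (0 : ℝ) 1, HasDerivWithinAt y (c • (B (y s) + h s)) (Icc 0 1) s)
    (hh : ∀ s ∈ Icc (0 : ℝ) 1, ‖h s‖ ≤ H) (h0 : P (y 0) = 0) :
    ‖P (y 1)‖ ≤ (1 + ν) * C * Real.exp (2 * a) / a * H := by
  have ha := hB.rate_pos; have hν := hB.opening_pos; have hC := hB.const_nonneg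
  have hH : 0 ≤ H := (norm_nonneg _).trans (hh 0 (left_mem_Icc.2 zero_le_one))
  have hre := neg_one_lt_re_of_mem_wedgeNhd hν hcD
  -- `c.re` may be negative, but exceeds -1. Replacing it by the positive `Y` in the exponent costs
  -- at most the factor e^{2a}.
  set Y := c.re + 2 with hY
  have hY0 : 0 < Y := by linarith
  set M := (1 + ν) * C * Real.exp (2 * a) / a * H with hM
  have hM0 : 0 ≤ M := by positivity
  have key := norm_apply_one_le hB.comm hy
    (b := fun s => M * Real.exp (-a * ((1 - s) * Y)))
    (b' := fun s => M * (Real.exp (-a * ((1 - s) * Y)) * (a * Y)))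
    (fun s => by
      have h1 : HasDerivAt (fun s : ℝ => -a * ((1 - s) * Y)) (a * Y) s := by
        have := (((hasDerivAt_id s).const_sub 1).mul_const Y).const_mul (-a)
        simpa using this
      exact (h1.exp).const_mul M)
    (fun s hs => by
      have hs' : 1 - s ∈ Icc (0 : ℝ) 1 := ⟨by linarith [hs.2], by linarith [hs.1]⟩
      have h1 := hB.stable _ (mul_mem_wedgeNhd hν hcD hs') (h s)
      rw [Complex.re_ofReal_mul] at h1
      have h2 : Real.exp (-a * ((1 - s) * c.re)) ≤
          Real.exp (2 * a) * Real.exp (-a * ((1 - s) * Y)) := by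
        rw [← Real.exp_add]
        refine Real.exp_le_exp.2 ?_
        have h3 : a * (1 - s) ≤ a := mul_le_of_le_one_right ha.le hs'.2
        rw [hY]
        nlinarith
      calc ‖c‖ * ‖NormedSpace.exp (((1 - s : ℝ) * c) • B) (P (h s))‖
          ≤ ((1 + ν) * Y) * (C * (Real.exp (2 * a) * Real.exp (-a * ((1 - s) * Y))) * H) := by
            refine mul_le_mul (norm_le_of_mem_wedgeNhd hν hcD) (h1.trans ?_) (norm_nonneg _)
              (by positivity)
            exact mul_le_mul (mul_le_mul_of_nonneg_left h2 hC) (hh s hs) (norm_nonneg _)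
              (by positivity)
        _ = _ := by rw [hM]; field_simp)
  rw [h0, map_zero, norm_zero, zero_add] at key
  have : 0 ≤ M * Real.exp (-a * ((1 - 0) * Y)) := by positivity
  simp only [sub_self, zero_mul, mul_zero, Real.exp_zero, mul_one] at key
  linarith

omit [CompleteSpace E] in
theorem tendsto_unstable (hB : IsDichotomy B P ν C a) {y : ℝ → E} {K : ℝ}
    (hy : ∀ x : ℝ, 0 ≤ x → ‖y x‖ ≤ K) :
    Tendsto (fun x : ℝ => NormedSpace.exp ((-x : ℂ) • B) ((1 - P) (y x))) atTop (𝓝 0) := by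
  have ha := hB.rate_pos; have hC := hB.const_nonneg
  have h1 : Tendsto (fun x : ℝ => C * Real.exp (-a * x) * K) atTop (𝓝 0) := by
    have h2 : Tendsto (fun x : ℝ => Real.exp (-a * x)) atTop (𝓝 0) :=
      Real.tendsto_exp_atBot.comp ((tendsto_const_mul_atBot_of_neg (by linarith)).2 tendsto_id)
    simpa using (h2.const_mul C).mul_const K
  refine squeeze_zero_norm' (eventually_atTop.2 ⟨0, fun x hx => ?_⟩) h1
  exact (hB.unstable x hx (y x)).trans (mul_le_mul_of_nonneg_left (hy x hx) (by positivity))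

theorem norm_unstable_le (hB : IsDichotomy B P ν C a) {y h : ℝ → E} {H : ℝ}
    (hy : ∀ x ∈ Ici (0 : ℝ), HasDerivWithinAt y (B (y x) + h x) (Ici 0) x)
    (hh : ∀ x ∈ Ici (0 : ℝ), ‖h x‖ ≤ H)
    (hlim : Tendsto (fun x : ℝ => NormedSpace.exp ((-x : ℂ) • B) ((1 - P) (y x))) atTop (𝓝 0)) :
    ‖y 0 - P (y 0)‖ ≤ C / a * H := by
  have ha := hB.rate_pos; have hC := hB.const_nonneg
  have := norm_apply_zero_le (H := C * H) hB.comm_compl ha hy (fun x hx => by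
    refine (hB.unstable x hx (h x)).trans ?_
    calc C * Real.exp (-a * x) * ‖h x‖ ≤ C * Real.exp (-a * x) * H :=
          mul_le_mul_of_nonneg_left (hh x hx) (by positivity)
      _ = _ := by ring) hlim
  rw [mul_div_right_comm] at this
  exact this

/-- A solution of `d' = A d + h` with `|h| ≤ κ |d|` and vanishing stable component at `0` which
does not grow faster than the dichotomy of `A + β` allows vanishes, if `κ` is small. -/
theorem eq_zero_of_deriv {A : E →L[ℂ] E} {β : ℝ}
    (hB : IsDichotomy (A + (β : ℂ) • (1 : E →L[ℂ] E)) P ν C a) {d h : ℝ → E} {κ K : ℝ}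
    (hκ : bound ν C a * κ ≤ 1 / 2)
    (hd : ∀ x ∈ Ici (0 : ℝ), HasDerivWithinAt d (A (d x) + h x) (Ici 0) x)
    (hh : ∀ x ∈ Ici (0 : ℝ), ‖h x‖ ≤ κ * ‖d x‖)
    (hK : ∀ x ∈ Ici (0 : ℝ), ‖d x‖ ≤ K * Real.exp (-β * x)) (h0 : P (d 0) = 0) :
    ∀ x ∈ Ici (0 : ℝ), d x = 0 := by
  set B := A + (β : ℂ) • (1 : E →L[ℂ] E) with hBdef
  have hν := hB.opening_pos
  -- A negative `κ` forces `d` to vanish at once.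
  by_cases hκ0 : κ < 0
  · intro x hx
    by_contra hne
    have := (norm_nonneg _).trans (hh x hx)
    exact absurd this (not_le.2 (mul_neg_of_neg_of_pos hκ0 (norm_pos_iff.2 hne)))
  rw [not_lt] at hκ0
  -- The weight turns `A` into A + β and the decay hypothesis into boundedness by `K`.
  set w : ℝ → E := fun x => Real.exp (β * x) • d x with hw
  set g : ℝ → E := fun x => Real.exp (β * x) • h x with hg
  have hgw : ∀ x ∈ Ici (0 : ℝ), ‖g x‖ ≤ κ * ‖w x‖ := by
    intro x hx
    simp only [hg, hw, norm_smul, Real.norm_eq_abs, Real.abs_exp]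
    calc _ ≤ Real.exp (β * x) * (κ * ‖d x‖) :=
          mul_le_mul_of_nonneg_left (hh x hx) (Real.exp_pos _).le
      _ = _ := by ring
  have hwd : ∀ x ∈ Ici (0 : ℝ), HasDerivWithinAt w (B (w x) + g x) (Ici 0) x := by
    intro x hx
    have h1 : HasDerivWithinAt (fun x : ℝ => Real.exp (β * x)) (Real.exp (β * x) * β)
        (Ici 0) x := by
      have : HasDerivAt (fun x => β * x) β x := by simpa using (hasDerivAt_id x).const_mul β
      exact this.exp.hasDerivWithinAt
    refine (h1.smul (hd x hx)).congr_deriv ?_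
    have h2 : A (Real.exp (β * x) • d x) = Real.exp (β * x) • A (d x) :=
      (A.restrictScalars ℝ).map_smul _ _
    have h3 : ((β : ℂ) • (1 : E →L[ℂ] E)) (Real.exp (β * x) • d x)
        = (Real.exp (β * x) * β) • d x := by
      change (β : ℂ) • (Real.exp (β * x) • d x) = _
      rw [Complex.coe_smul, smul_smul, mul_comm]
    change _ = A (Real.exp (β * x) • d x) + ((β : ℂ) • (1 : E →L[ℂ] E)) (Real.exp (β * x) • d x)
      + Real.exp (β * x) • h x
    rw [h2, h3, smul_add]
    abel
  have hw0 : P (w 0) = 0 := by simp [hw, h0]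
  -- A bound m on `w` gives the forcing bound κm, and the dichotomy returns at most m/2; iteration
  -- drives the bound to 0.
  have step : ∀ m : ℝ, (∀ x ∈ Ici (0 : ℝ), ‖w x‖ ≤ m) → ∀ x ∈ Ici (0 : ℝ), ‖w x‖ ≤ m / 2 := by
    intro m hm x hx
    have hm0 : 0 ≤ m := (norm_nonneg _).trans (hm x hx)
    have hgm : ∀ x ∈ Ici (0 : ℝ), ‖g x‖ ≤ κ * m := fun x hx =>
      (hgw x hx).trans (mul_le_mul_of_nonneg_left (hm x hx) hκ0)
    have h1 : ‖P (w x)‖ ≤ (1 + ν) * C * Real.exp (2 * a) / a * (κ * m) := by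
      have hmaps : MapsTo (fun s : ℝ => s * x) (Icc 0 1) (Ici 0) :=
        fun s hs => mul_nonneg hs.1 hx
      have := hB.norm_stable_le (c := x) (ofReal_mem_wedgeNhd hν (by linarith [mem_Ici.1 hx]))
        (y := fun s => w (s * x)) (h := fun s => g (s * x)) (H := κ * m)
        (fun s hs => by
          have h2 : HasDerivWithinAt (fun s : ℝ => s * x) x (Icc 0 1) s := by
            simpa using ((hasDerivAt_id s).mul_const x).hasDerivWithinAt
          have := (hwd (s * x) (hmaps hs)).scomp s h2 hmaps
          exact this.congr_deriv (Complex.coe_smul x _).symm)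
        (fun s hs => hgm _ (hmaps hs)) (by simpa using hw0)
      simpa using this
    have h2 : ‖w x - P (w x)‖ ≤ C / a * (κ * m) := by
      have hmaps : MapsTo (fun s : ℝ => x + s) (Ici 0) (Ici 0) :=
        fun s hs => add_nonneg (mem_Ici.1 hx) hs
      have := hB.norm_unstable_le (y := fun s => w (x + s)) (h := fun s => g (x + s)) (H := κ * m)
        (fun s hs => by
          have h2 : HasDerivWithinAt (fun s : ℝ => x + s) 1 (Ici 0) s :=
            ((hasDerivAt_id s).const_add x).hasDerivWithinAt
          have := (hwd (x + s) (hmaps hs)).scomp s h2 hmaps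
          exact this.congr_deriv (one_smul _ _))
        (fun s hs => hgm _ (hmaps hs))
        (hB.tendsto_unstable (K := m) fun s hs => hm _ (hmaps hs))
      simpa using this
    calc ‖w x‖ ≤ ‖P (w x)‖ + ‖w x - P (w x)‖ := norm_le_norm_add_norm_sub' _ _
      _ ≤ bound ν C a * κ * m := by unfold bound; linarith
      _ ≤ 1 / 2 * m := mul_le_mul_of_nonneg_right hκ hm0
      _ = m / 2 := by ring
  have hall : ∀ k : ℕ, ∀ x ∈ Ici (0 : ℝ), ‖w x‖ ≤ K / 2 ^ k := by
    intro k
    induction k with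
    | zero =>
      intro x hx
      simp only [hw, norm_smul, Real.norm_eq_abs, Real.abs_exp, pow_zero, div_one]
      calc _ ≤ Real.exp (β * x) * (K * Real.exp (-β * x)) :=
            mul_le_mul_of_nonneg_left (hK x hx) (Real.exp_pos _).le
        _ = K * Real.exp (β * x + -β * x) := by rw [Real.exp_add]; ring
        _ = K := by simp
    | succ k ih =>
      intro x hx
      refine (step _ ih x hx).trans (le_of_eq ?_)
      rw [pow_succ]; field_simp
  intro x hx
  have hlim : Tendsto (fun k : ℕ => K / 2 ^ k) atTop (𝓝 0) := by
    have := (tendsto_pow_atTop_nhds_zero_of_lt_one (r := (1 / 2 : ℝ)) (by norm_num)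
      (by norm_num)).const_mul K
    simpa [div_eq_mul_inv] using this
  have h1 : ‖w x‖ ≤ 0 := ge_of_tendsto hlim (Eventually.of_forall fun k => hall k x hx)
  have h2 : w x = 0 := norm_le_zero_iff.1 h1
  exact (smul_eq_zero.1 h2).resolve_left (Real.exp_pos _).ne'

end IsDichotomy

end LinearEstimates

/-! ### Bounded holomorphic solutions of the inhomogeneous equation -/

section SolutionOperator

variable {E : Type*} [NormedAddCommGroup E] [NormedSpace ℂ E] [CompleteSpace E]

namespace IsDichotomy

variable {B P : E →L[ℂ] E} {ν C a : ℝ}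

/-- The stable and unstable estimates are added. The absence of an unstable mode is expressed by a
limit along rays and not by boundedness, since `exists_solution` has to apply this before its
solution is known to be bounded. -/
theorem norm_le_of_hasDerivAt (hB : IsDichotomy B P ν C a) {v h : ℂ → E} {H : ℝ}
    (hv : ∀ t ∈ wedgeNhd ν, HasDerivAt v (B (v t) + h t) t)
    (hh : ∀ t ∈ wedgeNhd ν, ‖h t‖ ≤ H) (h0 : P (v 0) = 0)
    (hlim : ∀ t ∈ wedgeNhd ν, Tendsto
      (fun x : ℝ => NormedSpace.exp ((-x : ℂ) • B) ((1 - P) (v (t + x)))) atTop (𝓝 0)) :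
    ∀ t ∈ wedgeNhd ν, ‖v t‖ ≤ bound ν C a * H := by
  intro t ht
  have hν := hB.opening_pos
  have h1 := hB.norm_stable_le ht (y := fun s : ℝ => v (s * t)) (h := fun s : ℝ => h (s * t))
    (fun s hs => by
      have h2 : HasDerivAt (fun s : ℝ => (s : ℂ) * t) t s := by
        simpa using (hasDerivAt_id s).ofReal_comp.mul_const t
      exact ((hv _ (mul_mem_wedgeNhd hν ht hs)).scomp s h2).hasDerivWithinAt)
    (fun s hs => hh _ (mul_mem_wedgeNhd hν ht hs)) (by simpa using h0)
  have h2 := hB.norm_unstable_le (y := fun s : ℝ => v (t + s)) (h := fun s : ℝ => h (t + s))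
    (fun s hs => by
      have h2 : HasDerivAt (fun s : ℝ => t + (s : ℂ)) 1 s := by
        simpa using (hasDerivAt_id s).ofReal_comp.const_add t
      have h3 := (hv _ (add_mem_wedgeNhd hν ht hs)).scomp s h2
      rw [one_smul] at h3
      exact h3.hasDerivWithinAt)
    (fun s hs => hh _ (add_mem_wedgeNhd hν ht hs)) (hlim t ht)
  simp only [Complex.ofReal_one, one_mul, Complex.ofReal_zero, add_zero] at h1 h2
  calc ‖v t‖ ≤ ‖P (v t)‖ + ‖v t - P (v t)‖ := norm_le_norm_add_norm_sub' _ _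
    _ ≤ bound ν C a * H := by unfold bound; linarith

theorem eq_of_hasDerivAt (hB : IsDichotomy B P ν C a) {v w h : ℂ → E} {K : ℝ}
    (hv : ∀ t ∈ wedgeNhd ν, HasDerivAt v (B (v t) + h t) t)
    (hw : ∀ t ∈ wedgeNhd ν, HasDerivAt w (B (w t) + h t) t)
    (hvK : ∀ t ∈ wedgeNhd ν, ‖v t‖ ≤ K) (hwK : ∀ t ∈ wedgeNhd ν, ‖w t‖ ≤ K)
    (h0 : P (v 0) = P (w 0)) : ∀ t ∈ wedgeNhd ν, v t = w t := by
  intro t ht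
  have := hB.norm_le_of_hasDerivAt (v := fun t => v t - w t) (h := fun _ => 0) (H := 0)
    (fun t ht => ((hv t ht).sub (hw t ht)).congr_deriv (by rw [map_sub]; abel))
    (fun t _ => by simp) (by rw [map_sub, h0, sub_self])
    (fun t ht => hB.tendsto_unstable (K := K + K) fun x hx =>
      (norm_sub_le _ _).trans (add_le_add (hvK _ (add_mem_wedgeNhd hB.opening_pos ht hx))
        (hwK _ (add_mem_wedgeNhd hB.opening_pos ht hx)))) t ht
  rw [mul_zero] at this
  exact sub_eq_zero.1 (norm_le_zero_iff.1 this)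

theorem differentiableOn_exp_neg_smul {h : ℂ → E} {D : Set ℂ} (B : E →L[ℂ] E) (hD : IsOpen D)
    (hh : DifferentiableOn ℂ h D) :
    DifferentiableOn ℂ (fun s => NormedSpace.exp ((-s) • B) (h s)) D := fun s hs =>
  (hasDerivAt_exp_smul_apply B (hasDerivAt_id s).neg
    (hh.differentiableAt (hD.mem_nhds hs)).hasDerivAt).differentiableAt.differentiableWithinAt

/-- Existence of bounded holomorphic solutions of the inhomogeneous linear equation. -/
theorem exists_solution (hB : IsDichotomy B P ν C a) {h : ℂ → E} {H : ℝ}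
    (hh : DifferentiableOn ℂ h (wedgeNhd ν)) (hH : ∀ t ∈ wedgeNhd ν, ‖h t‖ ≤ H) :
    ∃ v : ℂ → E, (∀ t ∈ wedgeNhd ν, HasDerivAt v (B (v t) + h t) t) ∧ P (v 0) = 0 ∧
      ∀ t ∈ wedgeNhd ν, ‖v t‖ ≤ bound ν C a * H := by
  have hν := hB.opening_pos; have ha := hB.rate_pos; have hC := hB.const_nonneg
  have hopen := isOpen_wedgeNhd ν
  have hH0 : 0 ≤ H := (norm_nonneg _).trans (hH 0 (zero_mem_wedgeNhd hν))
  -- A holomorphic primitive of the transported forcing exists on the convex domain. The solution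
  -- will be e^{tB} applied to `K` minus a constant.
  obtain ⟨K, hK⟩ := (convex_wedgeNhd ν).exists_forall_hasDerivWithinAt
    (differentiableOn_exp_neg_smul B hopen hh)
  replace hK : ∀ s ∈ wedgeNhd ν, HasDerivAt K (NormedSpace.exp ((-s) • B) (h s)) s :=
    fun s hs => (hK s hs).hasDerivAt (hopen.mem_nhds hs)
  set Q : E →L[ℂ] E := 1 - P with hQ
  have hQexp : ∀ (t : ℂ) (w : E), Q (NormedSpace.exp (t • B) w) =
      NormedSpace.exp (t • B) (Q w) := fun t w =>
    DFunLike.congr_fun (commute_exp_smul hB.comm_compl t).eq w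
  have hQK : ∀ s ∈ wedgeNhd ν, HasDerivAt (fun s => Q (K s))
      (NormedSpace.exp ((-s) • B) (Q (h s))) s := fun s hs => by
    rw [← hQexp]
    exact Q.hasFDerivAt.comp_hasDerivAt s (hK s hs)
  have hQbound : ∀ x : ℝ, 0 ≤ x → ∀ w : E, ‖w‖ ≤ H →
      ‖NormedSpace.exp ((-x : ℂ) • B) (Q w)‖ ≤ C * H * Real.exp (-a * x) := fun x hx w hw => by
    refine (hB.unstable x hx w).trans ?_
    calc C * Real.exp (-a * x) * ‖w‖ ≤ C * Real.exp (-a * x) * H :=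
          mul_le_mul_of_nonneg_left hw (by positivity)
      _ = _ := by ring
  have hexp0 : Tendsto (fun x : ℝ => Real.exp (-a * x)) atTop (𝓝 0) :=
    Real.tendsto_exp_atBot.comp ((tendsto_const_mul_atBot_of_neg (by linarith)).2 tendsto_id)
  -- The unstable component of the primitive has an integrable derivative on the positive axis,
  -- hence a limit at infinity.
  obtain ⟨L, hL⟩ : ∃ L, Tendsto (fun x : ℝ => Q (K x)) atTop (𝓝 L) := by
    have hd : ∀ x ∈ Ioi (0 : ℝ), HasDerivAt (fun x : ℝ => Q (K x))
        (NormedSpace.exp ((-x : ℂ) • B) (Q (h x))) x := fun x hx => by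
      have h1 : HasDerivAt (fun x : ℝ => (x : ℂ)) 1 x := by
        simpa using (hasDerivAt_id x).ofReal_comp
      have h2 := (hQK x (ofReal_mem_wedgeNhd hν (by linarith [mem_Ioi.1 hx]))).scomp x h1
      rwa [one_smul] at h2
    refine ⟨_, MeasureTheory.tendsto_limUnder_of_hasDerivAt_of_integrableOn_Ioi hd ?_⟩
    have hint : MeasureTheory.IntegrableOn (fun x : ℝ => C * H * Real.exp (-a * x)) (Ioi 0) :=
      (exp_neg_integrableOn_Ioi 0 ha).const_mul _
    refine MeasureTheory.Integrable.mono' hint ?_ ?_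
    · refine ContinuousOn.aestronglyMeasurable (fun x hx => ?_) measurableSet_Ioi
      have hx' : (x : ℂ) ∈ wedgeNhd ν := ofReal_mem_wedgeNhd hν (by linarith [mem_Ioi.1 hx])
      have h1 := (hopen.mem_nhds hx')
      have h2 : DifferentiableOn ℂ (fun s => Q (h s)) (wedgeNhd ν) :=
        Q.differentiable.comp_differentiableOn hh
      have h3 := ((differentiableOn_exp_neg_smul B hopen h2).differentiableAt h1).continuousAt
      exact (ContinuousAt.comp (f := fun x : ℝ => (x : ℂ)) h3
        Complex.continuous_ofReal.continuousAt).continuousWithinAt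
    · refine (MeasureTheory.ae_restrict_iff' measurableSet_Ioi).2 (Eventually.of_forall ?_)
      intro x hx
      exact hQbound x (mem_Ioi.1 hx).le _
        (hH _ (ofReal_mem_wedgeNhd hν (by linarith [mem_Ioi.1 hx])))
  -- The limit is the same on every horizontal ray: the segment joining two rays at abscissa x
  -- contributes O(e^{-ax}).
  have hLt : ∀ t ∈ wedgeNhd ν, Tendsto (fun x : ℝ => Q (K (t + x))) atTop (𝓝 L) := by
    intro t ht
    obtain ⟨M, hM⟩ := (show IsCompact (segment ℝ (0 : ℂ) t) by
        rw [segment_eq_image_lineMap]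
        exact isCompact_Icc.image (by fun_prop)).exists_bound_of_continuousOn
      (f := fun s => NormedSpace.exp ((-s) • B)) (by
        have : Continuous fun s : ℂ => NormedSpace.exp (s • B) :=
          continuous_iff_continuousAt.2 fun s => (hasDerivAt_exp_smul_const B s).continuousAt
        exact (this.comp continuous_neg).continuousOn)
    have hdiff : Tendsto (fun x : ℝ => Q (K (t + x)) - Q (K x)) atTop (𝓝 0) := by
      have hz : Tendsto (fun x : ℝ => M * (C * H * Real.exp (-a * x)) * ‖t‖) atTop (𝓝 0) := by
        simpa using ((hexp0.const_mul (C * H)).const_mul M).mul_const ‖t‖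
      refine squeeze_zero_norm' (eventually_atTop.2 ⟨0, fun x hx => ?_⟩) hz
      have hsub : ∀ s ∈ segment ℝ (0 : ℂ) t, s + x ∈ wedgeNhd ν := fun s hs =>
        add_mem_wedgeNhd hν ((convex_wedgeNhd ν).segment_subset (zero_mem_wedgeNhd hν) ht hs) hx
      have := (convex_segment (𝕜 := ℝ) (0 : ℂ) t).norm_image_sub_le_of_norm_hasDerivWithin_le
        (f := fun s => Q (K (s + x))) (C := M * (C * H * Real.exp (-a * x)))
        (fun s hs => ((hQK _ (hsub s hs)).comp_add_const s (x : ℂ)).hasDerivWithinAt)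
        (fun s hs => by
          rw [neg_add, exp_add_smul_apply]
          exact ((NormedSpace.exp ((-s) • B)).le_opNorm _).trans
            (mul_le_mul (hM s hs) (hQbound x hx _ (hH _ (hsub s hs))) (norm_nonneg _)
              ((norm_nonneg _).trans (hM s hs))))
        (left_mem_segment ℝ _ _) (right_mem_segment ℝ _ _)
      simpa using this
    simpa using hdiff.add hL
  have hQQ : ∀ w, Q (Q w) = Q w := fun w => by
    simp only [hQ, sub_apply, one_apply_eq_self, map_sub, hB.idem]
    simp
  have hQL : Q L = L := by
    have h1 := (Q.continuous.tendsto L).comp hL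
    refine tendsto_nhds_unique h1 (hL.congr fun x => ?_)
    exact (hQQ _).symm
  have hPL : P L = 0 := by
    have : L - P L = L := hQL
    simpa using this
  have hQP : ∀ w, Q (P w) = 0 := fun w => by
    change P w - P (P w) = 0
    rw [hB.idem, sub_self]
  -- Subtracting P(K 0) gives zero stable component at 0, and subtracting `L` removes the growing
  -- unstable mode.
  set v : ℂ → E := fun t => NormedSpace.exp (t • B) (K t - P (K 0) - L) with hvdef
  have hv : ∀ t ∈ wedgeNhd ν, HasDerivAt v (B (v t) + h t) t := by
    intro t ht
    have := hasDerivAt_exp_smul_apply B (hasDerivAt_id t)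
      (((hK t ht).sub_const (P (K 0))).sub_const L)
    refine this.congr_deriv ?_
    rw [one_smul, map_add, id, exp_smul_apply_exp_neg]
    congr 1
    exact (DFunLike.congr_fun (commute_exp_smul (Commute.refl B) t).eq _).symm
  have hv0 : P (v 0) = 0 := by
    simp only [hvdef, exp_zero_smul_apply, map_sub, hB.idem, hPL]
    simp
  refine ⟨v, hv, hv0, hB.norm_le_of_hasDerivAt hv hH hv0 fun t ht => ?_⟩
  have h1 : Tendsto (fun x : ℝ => NormedSpace.exp (t • B) (Q (K (t + x)) - L)) atTop (𝓝 0) := by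
    have := ((NormedSpace.exp (t • B)).continuous.tendsto (L - L)).comp
      ((hLt t ht).sub_const L)
    rwa [sub_self, map_zero] at this
  refine h1.congr fun x => ?_
  rw [hvdef]
  simp only
  rw [hQexp, ← exp_add_smul_apply, map_sub Q, map_sub Q, hQP, hQL, sub_zero]
  congr 3
  ring

end IsDichotomy

/-- The Banach space of bounded holomorphic functions on `wedgeNhd ν`, extended by zero. -/
def wedgeSpace (ν : ℝ) (E : Type*) [NormedAddCommGroup E] [NormedSpace ℂ E] :
    Submodule ℂ (lp (fun _ : ℂ => E) ⊤) where
  carrier := {w | DifferentiableOn ℂ w (wedgeNhd ν) ∧ ∀ t ∉ wedgeNhd ν, w t = 0}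
  zero_mem' := ⟨differentiableOn_const (𝕜 := ℂ) (0 : E), fun t _ => rfl⟩
  add_mem' := fun h1 h2 => ⟨h1.1.add h2.1, fun t ht => by
    rw [lp.coeFn_add, Pi.add_apply, h1.2 t ht, h2.2 t ht, add_zero]⟩
  smul_mem' := fun c w h => ⟨h.1.const_smul c, fun t ht => by
    rw [lp.coeFn_smul, Pi.smul_apply, h.2 t ht, smul_zero]⟩

namespace wedgeSpace

variable {ν : ℝ}

/-- Evaluation at a point. -/
def eval (ν : ℝ) (E : Type*) [NormedAddCommGroup E] [NormedSpace ℂ E] (t : ℂ) :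
    wedgeSpace ν E →L[ℂ] E :=
  LinearMap.mkContinuous
    { toFun := fun w => (w : lp (fun _ : ℂ => E) ⊤) t
      map_add' := fun _ _ => rfl
      map_smul' := fun _ _ => rfl } 1
    (fun w => by
      rw [one_mul]
      exact lp.norm_apply_le_norm (by simp) (w : lp (fun _ : ℂ => E) ⊤) t)

omit [CompleteSpace E] in
theorem norm_eval_le (w : wedgeSpace ν E) (t : ℂ) : ‖eval ν E t w‖ ≤ ‖w‖ :=
  lp.norm_apply_le_norm (by simp) (w : lp (fun _ : ℂ => E) ⊤) t

omit [CompleteSpace E] in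
theorem differentiableOn_eval (w : wedgeSpace ν E) :
    DifferentiableOn ℂ (fun t => eval ν E t w) (wedgeNhd ν) := w.2.1

omit [CompleteSpace E] in
theorem ext_eval {w w' : wedgeSpace ν E}
    (h : ∀ t ∈ wedgeNhd ν, eval ν E t w = eval ν E t w') : w = w' := by
  refine Subtype.ext (lp.ext (funext fun t => ?_))
  by_cases ht : t ∈ wedgeNhd ν
  · exact h t ht
  · rw [w.2.2 t ht, w'.2.2 t ht]

omit [CompleteSpace E] in
theorem norm_le {w : wedgeSpace ν E} {K : ℝ} (hK : 0 ≤ K)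
    (h : ∀ t ∈ wedgeNhd ν, ‖eval ν E t w‖ ≤ K) : ‖w‖ ≤ K := by
  refine lp.norm_le_of_forall_le (f := (w : lp (fun _ : ℂ => E) ⊤)) hK fun t => ?_
  by_cases ht : t ∈ wedgeNhd ν
  · exact h t ht
  · rw [w.2.2 t ht, norm_zero]; exact hK

omit [CompleteSpace E] in
theorem exists_eval_eq {g : ℂ → E} {K : ℝ} (hg : DifferentiableOn ℂ g (wedgeNhd ν))
    (hK : ∀ t ∈ wedgeNhd ν, ‖g t‖ ≤ K) :
    ∃ w : wedgeSpace ν E, ∀ t ∈ wedgeNhd ν, eval ν E t w = g t := by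
  classical
  have hmem : Memℓp (fun t : ℂ => (wedgeNhd ν).indicator g t) ⊤ := by
    refine memℓp_infty ⟨max K 0, ?_⟩
    rintro _ ⟨t, rfl⟩
    by_cases ht : t ∈ wedgeNhd ν
    · simpa [ht] using Or.inl (hK t ht)
    · simp [ht]
  exact ⟨⟨⟨_, hmem⟩, hg.congr fun t ht => indicator_of_mem ht g,
    fun t ht => indicator_of_notMem ht g⟩, fun t ht => indicator_of_mem ht g⟩

/-- Uniform limits of holomorphic functions are holomorphic, so the subspace is closed in the space
of bounded functions. -/
instance : CompleteSpace (wedgeSpace ν E) := by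
  refine IsClosed.completeSpace_coe (hs := ?_)
  refine isClosed_of_closure_subset fun w hw => ?_
  obtain ⟨u, hu, hlim⟩ := mem_closure_iff_seq_limit.1 hw
  have hunif : TendstoUniformly (fun k (t : ℂ) => u k t) w atTop := by
    rw [Metric.tendstoUniformly_iff]
    intro ε hε
    filter_upwards [Metric.tendsto_nhds.1 hlim ε hε] with k hk t
    refine lt_of_le_of_lt ?_ hk
    rw [dist_comm, dist_eq_norm, dist_eq_norm]
    exact lp.norm_apply_le_norm (by simp) (u k - w) t
  refine ⟨hunif.tendstoUniformlyOn.tendstoLocallyUniformlyOn.differentiableOn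
    (Eventually.of_forall fun k => (hu k).1) (isOpen_wedgeNhd ν), fun t ht => ?_⟩
  refine tendsto_nhds_unique (hunif.tendsto_at t) ?_
  simp only [(hu _).2 t ht]
  exact tendsto_const_nhds

end wedgeSpace

namespace IsDichotomy

variable {B P : E →L[ℂ] E} {ν C a : ℝ}

theorem exists_wedgeSpace_solution (hB : IsDichotomy B P ν C a) (h : wedgeSpace ν E) :
    ∃ v : wedgeSpace ν E,
      (∀ t ∈ wedgeNhd ν, HasDerivAt (fun t => wedgeSpace.eval ν E t v)
        (B (wedgeSpace.eval ν E t v) + wedgeSpace.eval ν E t h) t) ∧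
      P (wedgeSpace.eval ν E 0 v) = 0 ∧ ‖v‖ ≤ bound ν C a * ‖h‖ := by
  obtain ⟨v, h1, h2, h3⟩ := hB.exists_solution (wedgeSpace.differentiableOn_eval h)
    (fun t _ => wedgeSpace.norm_eval_le h t)
  obtain ⟨w, hw⟩ := wedgeSpace.exists_eval_eq (g := v)
    (fun t ht => (h1 t ht).differentiableAt.differentiableWithinAt) h3
  refine ⟨w, fun t ht => ?_, by rw [hw 0 (zero_mem_wedgeNhd hB.opening_pos), h2],
    wedgeSpace.norm_le (mul_nonneg hB.bound_nonneg (norm_nonneg _)) fun t ht => by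
      rw [hw t ht]; exact h3 t ht⟩
  rw [hw t ht]
  refine (h1 t ht).congr_of_eventuallyEq ?_
  filter_upwards [(isOpen_wedgeNhd ν).mem_nhds ht] with s hs using hw s hs

theorem wedgeSpace_solution_unique (hB : IsDichotomy B P ν C a) {h v w : wedgeSpace ν E}
    (hv : ∀ t ∈ wedgeNhd ν, HasDerivAt (fun t => wedgeSpace.eval ν E t v)
      (B (wedgeSpace.eval ν E t v) + wedgeSpace.eval ν E t h) t)
    (hw : ∀ t ∈ wedgeNhd ν, HasDerivAt (fun t => wedgeSpace.eval ν E t w)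
      (B (wedgeSpace.eval ν E t w) + wedgeSpace.eval ν E t h) t)
    (h0 : P (wedgeSpace.eval ν E 0 v) = P (wedgeSpace.eval ν E 0 w)) : v = w :=
  wedgeSpace.ext_eval (hB.eq_of_hasDerivAt hv hw (K := max ‖v‖ ‖w‖)
    (fun t _ => (wedgeSpace.norm_eval_le v t).trans (le_max_left _ _))
    (fun t _ => (wedgeSpace.norm_eval_le w t).trans (le_max_right _ _)) h0)

/-- The solution operator `h ↦ v`, `v' = B v + h`, `P v(0) = 0`, on bounded holomorphic
functions. -/
def solve (hB : IsDichotomy B P ν C a) : wedgeSpace ν E →L[ℂ] wedgeSpace ν E :=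
  LinearMap.mkContinuous
    { toFun := fun h => (hB.exists_wedgeSpace_solution h).choose
      -- Linearity of the chosen solutions comes from uniqueness of bounded solutions.
      map_add' := fun g h => by
        have h1 := (hB.exists_wedgeSpace_solution g).choose_spec
        have h2 := (hB.exists_wedgeSpace_solution h).choose_spec
        have h3 := (hB.exists_wedgeSpace_solution (g + h)).choose_spec
        refine hB.wedgeSpace_solution_unique (h := g + h) h3.1 (fun t ht => ?_) ?_
        · simp only [map_add]
          exact ((h1.1 t ht).add (h2.1 t ht)).congr_deriv (by abel)
        · rw [h3.2.1, map_add, map_add, h1.2.1, h2.2.1, add_zero]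
      map_smul' := fun c h => by
        have h2 := (hB.exists_wedgeSpace_solution h).choose_spec
        have h3 := (hB.exists_wedgeSpace_solution (c • h)).choose_spec
        refine hB.wedgeSpace_solution_unique (h := c • h) h3.1 (fun t ht => ?_) ?_
        · simp only [map_smul, RingHom.id_apply, ← smul_add]
          exact (h2.1 t ht).const_smul c
        · rw [h3.2.1, RingHom.id_apply, map_smul, map_smul, h2.2.1, smul_zero] }
    (bound ν C a) (fun h => (hB.exists_wedgeSpace_solution h).choose_spec.2.2)

theorem hasDerivAt_solve (hB : IsDichotomy B P ν C a) (h : wedgeSpace ν E) {t : ℂ}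
    (ht : t ∈ wedgeNhd ν) : HasDerivAt (fun t => wedgeSpace.eval ν E t (hB.solve h))
      (B (wedgeSpace.eval ν E t (hB.solve h)) + wedgeSpace.eval ν E t h) t :=
  (hB.exists_wedgeSpace_solution h).choose_spec.1 t ht

theorem apply_eval_zero_solve (hB : IsDichotomy B P ν C a) (h : wedgeSpace ν E) :
    P (wedgeSpace.eval ν E 0 (hB.solve h)) = 0 :=
  (hB.exists_wedgeSpace_solution h).choose_spec.2.1

/-- The solutions `t ↦ exp (t B) (P ξ)` of the homogeneous equation. -/
theorem exists_homogeneous (hB : IsDichotomy B P ν C a) :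
    ∃ T : E →L[ℂ] wedgeSpace ν E, ∀ ξ, ∀ t ∈ wedgeNhd ν,
      wedgeSpace.eval ν E t (T ξ) = NormedSpace.exp (t • B) (P ξ) := by
  have hν := hB.opening_pos; have ha := hB.rate_pos; have hC := hB.const_nonneg
  have hbd : ∀ ξ, ∀ t ∈ wedgeNhd ν,
      ‖NormedSpace.exp (t • B) (P ξ)‖ ≤ C * Real.exp a * ‖ξ‖ := by
    intro ξ t ht
    refine (hB.stable t ht ξ).trans ?_
    gcongr
    nlinarith [neg_one_lt_re_of_mem_wedgeNhd hν ht]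
  have hex : ∀ ξ, ∃ w : wedgeSpace ν E, ∀ t ∈ wedgeNhd ν,
      wedgeSpace.eval ν E t w = NormedSpace.exp (t • B) (P ξ) := fun ξ =>
    wedgeSpace.exists_eval_eq (fun t _ => (hasDerivAt_exp_smul_apply B (hasDerivAt_id t)
      (hasDerivAt_const t (P ξ))).differentiableAt.differentiableWithinAt) (hbd ξ)
  choose T hT using hex
  refine ⟨LinearMap.mkContinuous
    { toFun := T
      map_add' := fun ξ ζ => wedgeSpace.ext_eval fun t ht => by
        rw [map_add, hT _ t ht, hT _ t ht, hT _ t ht, map_add, map_add]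
      map_smul' := fun c ξ => wedgeSpace.ext_eval fun t ht => by
        rw [RingHom.id_apply, map_smul, hT _ t ht, hT _ t ht, map_smul, map_smul] }
    (C * Real.exp a) (fun ξ => wedgeSpace.norm_le (by positivity) fun t ht => by
      change ‖wedgeSpace.eval ν E t (T ξ)‖ ≤ _
      rw [hT ξ t ht]; exact hbd ξ t ht), hT⟩

end IsDichotomy

end SolutionOperator

/-! ### The analytic substitution operator and the family of decaying solutions -/

section Nonlinear

variable {E : Type*} [NormedAddCommGroup E] [NormedSpace ℂ E] [CompleteSpace E]

namespace wedgeSpace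

variable {ν : ℝ}

omit [CompleteSpace E] in
-- The degree `k` term of c⁻¹N(cw) is c^{k-1} p(w, …, w). Since |c| ≤ 1 its norm does not exceed
-- that of `p`, so the lifted power series keeps a positive radius. For `k = 0` the exponent
-- truncates to 0; that term will vanish in the application.
theorem exists_multilinear (k : ℕ) (p : ContinuousMultilinearMap ℂ (fun _ : Fin k => E) E)
    {c : ℂ → ℂ} (hc : DifferentiableOn ℂ c (wedgeNhd ν)) (hc1 : ∀ t ∈ wedgeNhd ν, ‖c t‖ ≤ 1) :
    ∃ q : ContinuousMultilinearMap ℂ (fun _ : Fin k => wedgeSpace ν E) (wedgeSpace ν E),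
      ‖q‖ ≤ ‖p‖ ∧ ∀ m, ∀ t ∈ wedgeNhd ν,
        eval ν E t (q m) = c t ^ (k - 1) • p fun i => eval ν E t (m i) := by
  have hbd : ∀ m : Fin k → wedgeSpace ν E, ∀ t ∈ wedgeNhd ν,
      ‖c t ^ (k - 1) • p fun i => eval ν E t (m i)‖ ≤ ‖p‖ * ∏ i, ‖m i‖ := by
    intro m t ht
    rw [norm_smul, norm_pow]
    refine (mul_le_of_le_one_left (norm_nonneg _)
      (pow_le_one₀ (norm_nonneg _) (hc1 t ht))).trans ((p.le_opNorm _).trans ?_)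
    exact mul_le_mul_of_nonneg_left
      (Finset.prod_le_prod (fun i _ => norm_nonneg _) fun i _ => norm_eval_le (m i) t)
      (norm_nonneg _)
  have hex : ∀ m : Fin k → wedgeSpace ν E, ∃ w : wedgeSpace ν E, ∀ t ∈ wedgeNhd ν,
      eval ν E t w = c t ^ (k - 1) • p fun i => eval ν E t (m i) := fun m =>
    exists_eval_eq ((hc.pow (k - 1)).smul
      ((p.contDiff.differentiable (n := 1) one_ne_zero).comp_differentiableOn
        (differentiableOn_pi.2 fun i => differentiableOn_eval (m i)))) (hbd m)
  choose T hT using hex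
  have hup : ∀ [DecidableEq (Fin k)] (m : Fin k → wedgeSpace ν E) (i : Fin k)
      (x : wedgeSpace ν E) (t : ℂ),
      (fun j => eval ν E t (Function.update m i x j)) =
        Function.update (fun j => eval ν E t (m j)) i (eval ν E t x) := by
    intro _ m i x t
    ext1 j
    exact Function.apply_update (fun _ => eval ν E t) m i x j
  let q : MultilinearMap ℂ (fun _ : Fin k => wedgeSpace ν E) (wedgeSpace ν E) :=
    { toFun := T
      map_update_add' := fun m i x y => ext_eval fun t ht => by
        rw [map_add, hT _ t ht, hT _ t ht, hT _ t ht, hup, hup, hup, map_add, p.map_update_add,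
          smul_add]
      map_update_smul' := fun m i z x => ext_eval fun t ht => by
        rw [map_smul, hT _ t ht, hT _ t ht, hup, hup, map_smul, p.map_update_smul, smul_comm] }
  have hq : ∀ m, ‖q m‖ ≤ ‖p‖ * ∏ i, ‖m i‖ := fun m =>
    norm_le (by positivity) fun t ht => by
      change ‖eval ν E t (T m)‖ ≤ _
      rw [hT m t ht]; exact hbd m t ht
  exact ⟨q.mkContinuous ‖p‖ hq, q.mkContinuous_norm_le (norm_nonneg _) hq, hT⟩

/-- The substitution operator `w ↦ c⁻¹ N(c w)` on bounded holomorphic functions is analytic. -/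
theorem exists_substitution {N : E → E} (hN : AnalyticAt ℂ N 0) (hN0 : N 0 = 0)
    (hN1 : HasFDerivAt N (0 : E →L[ℂ] E) 0)
    {c : ℂ → ℂ} (hc : DifferentiableOn ℂ c (wedgeNhd ν)) (hc1 : ∀ t ∈ wedgeNhd ν, ‖c t‖ ≤ 1) :
    ∃ F : wedgeSpace ν E → wedgeSpace ν E, AnalyticAt ℂ F 0 ∧
      HasFDerivAt F (0 : wedgeSpace ν E →L[ℂ] wedgeSpace ν E) 0 ∧ F 0 = 0 ∧
      ∀ᶠ w in 𝓝 0, ∀ t ∈ wedgeNhd ν, c t • eval ν E t (F w) = N (c t • eval ν E t w) := by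
  obtain ⟨p, r, hp⟩ := hN
  choose q hq1 hq2 using fun k => exists_multilinear k (p k) hc hc1
  let Q : FormalMultilinearSeries ℂ (wedgeSpace ν E) (wedgeSpace ν E) := q
  have hrad : 0 < Q.radius := (hp.r_pos.trans_le hp.r_le).trans_le
    (FormalMultilinearSeries.radius_le_of_le hq1)
  have hQ := Q.hasFPowerSeriesOnBall hrad
  -- The terms of degree 0 and 1 vanish; hence so do the value and the derivative at 0 of the lifted
  -- series.
  have hp0 : ∀ v, p 0 v = 0 := fun v => by rw [hp.coeff_zero v, hN0]
  have hp1 : ∀ v, p 1 v = 0 := fun v => by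
    have h1 := hp.hasFPowerSeriesAt.hasFDerivAt.unique hN1
    have h2 := DFunLike.congr_fun h1 (v 0)
    simp only [continuousMultilinearCurryFin1_apply, zero_apply] at h2
    rw [← h2]
    congr 1
    ext1 i
    rw [Subsingleton.elim i 0]
    rfl
  refine ⟨Q.sum, hQ.analyticAt, ?_, ?_, ?_⟩
  · refine hQ.hasFPowerSeriesAt.hasFDerivAt.congr_fderiv ?_
    ext1 w
    rw [continuousMultilinearCurryFin1_apply]
    refine ext_eval fun t ht => ?_
    refine (hq2 1 _ t ht).trans ?_
    rw [hp1, smul_zero]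
    simp
  · rw [← hQ.coeff_zero (fun _ => 0)]
    refine ext_eval fun t ht => (hq2 0 _ t ht).trans ?_
    rw [hp0, smul_zero, map_zero]
  · have h1 : ∀ᶠ w : wedgeSpace ν E in 𝓝 0, w ∈ Metric.eball (0 : wedgeSpace ν E) Q.radius :=
      Metric.eball_mem_nhds _ hrad
    have h2 : ∀ᶠ w : wedgeSpace ν E in 𝓝 0, w ∈ Metric.eball (0 : wedgeSpace ν E) r :=
      Metric.eball_mem_nhds _ hp.r_pos
    filter_upwards [h1, h2] with w hw1 hw2 t ht
    have hs1 := ((hQ.hasSum hw1).mapL (eval ν E t)).const_smul (c t)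
    rw [zero_add] at hs1
    have hmem : c t • eval ν E t w ∈ Metric.eball (0 : E) r := by
      rw [Metric.mem_eball, edist_zero_right] at hw2 ⊢
      refine lt_of_le_of_lt ?_ hw2
      rw [enorm_le_iff_norm_le, norm_smul]
      exact (mul_le_of_le_one_left (norm_nonneg _) (hc1 t ht)).trans (norm_eval_le w t)
    have hs2 := hp.hasSum hmem
    rw [zero_add] at hs2
    refine hs1.unique (hs2.congr_fun ?_)
    intro k
    change c t • eval ν E t (q k fun _ => w) = _
    rw [hq2 k _ t ht]
    have h3 : (p k fun _ => c t • eval ν E t w) = c t ^ k • p k fun _ => eval ν E t w := by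
      rw [(p k).map_smul_univ (fun _ => c t)]
      simp
    rw [h3]
    -- c · c^{k-1} = c^k needs k ≥ 1, because of the truncated exponent; the term k = 0 is zero on
    -- both sides.
    cases k with
    | zero => rw [hp0, smul_zero, smul_zero]
    | succ k => rw [smul_smul, Nat.add_sub_cancel, pow_succ']

end wedgeSpace

namespace IsDichotomy

variable {A P : E →L[ℂ] E} {ν C a : ℝ}

/-- The analytic family of decaying solutions of `v' = A v + N(v)` on `wedgeNhd ν`, parametrized
by the stable component of the value at `0`. -/
theorem exists_family {β : ℝ} (hβ : 0 ≤ β)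
    (hB : IsDichotomy (A + (β : ℂ) • (1 : E →L[ℂ] E)) P ν C a) {N : E → E}
    (hN : AnalyticAt ℂ N 0) (hN0 : N 0 = 0) (hN1 : HasFDerivAt N (0 : E →L[ℂ] E) 0) :
    ∃ (V : E → ℂ → E) (ρ K : ℝ), 0 < ρ ∧ 0 ≤ K ∧
      (∀ ξ, ‖ξ‖ < ρ → ∀ t ∈ wedgeNhd ν, HasDerivAt (V ξ) (A (V ξ t) + N (V ξ t)) t) ∧
      (∀ ξ, ‖ξ‖ < ρ → P (V ξ 0) = P ξ) ∧
      (∀ ξ, ‖ξ‖ < ρ → ∀ t ∈ wedgeNhd ν, ‖V ξ t‖ ≤ K * Real.exp (-β * t.re) * ‖ξ‖) ∧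
      AnalyticOnNhd ℂ (fun ξ => V ξ 0) (Metric.ball 0 ρ) ∧
      HasFDerivAt (fun ξ => V ξ 0) P 0 := by
  have hν := hB.opening_pos
  set B := A + (β : ℂ) • (1 : E →L[ℂ] E) with hBdef
  -- The shift by 1 ensures |c| ≤ 1 on the whole domain, where Re t > -1. It is undone by the factor
  -- e^β in the definition of `S`.
  set c : ℂ → ℂ := fun t => Complex.exp (-β * (t + 1)) with hcdef
  have hcd : ∀ t, HasDerivAt c (-β * c t) t := by
    intro t
    have h1 : HasDerivAt (fun t : ℂ => -β * (t + 1)) (-β) t := by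
      simpa using ((hasDerivAt_id t).add_const 1).const_mul (-β : ℂ)
    refine h1.cexp.congr_deriv ?_
    rw [hcdef]; ring
  have hcn : ∀ t, ‖c t‖ = Real.exp (-β * (t.re + 1)) := by
    intro t
    rw [hcdef, Complex.norm_exp]
    simp
  have hc1 : ∀ t ∈ wedgeNhd ν, ‖c t‖ ≤ 1 := by
    intro t ht
    rw [hcn, Real.exp_le_one_iff]
    nlinarith [neg_one_lt_re_of_mem_wedgeNhd hν ht]
  obtain ⟨F, hF1, hF2, hF0, hF3⟩ := wedgeSpace.exists_substitution (ν := ν) hN hN0 hN1 (c := c)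
    (fun t _ => (hcd t).differentiableAt.differentiableWithinAt) hc1
  obtain ⟨T, hT⟩ := hB.exists_homogeneous
  -- The weighted equation with stable datum ξ is G(w) = e^β T ξ, and G has derivative the identity
  -- at 0 because F has derivative 0.
  set G : wedgeSpace ν E → wedgeSpace ν E := fun w => w - hB.solve (F w) with hG
  have hG0 : G 0 = 0 := by rw [hG]; simp [hF0]
  have hGa : AnalyticAt ℂ G 0 :=
    analyticAt_id.sub (hB.solve.analyticAt _ |>.comp hF1)
  have hG1 : HasFDerivAt G
      ((ContinuousLinearEquiv.refl ℂ (wedgeSpace ν E) : wedgeSpace ν E →L[ℂ] wedgeSpace ν E)) 0 := by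
    refine ((hasFDerivAt_id (0 : wedgeSpace ν E)).sub
      (hB.solve.hasFDerivAt.comp 0 hF2)).congr_fderiv ?_
    ext1 w
    simp
  -- The exponent `⊤` stands for analyticity, so the inverse function theorem returns an analytic
  -- local inverse.
  have hGc : ContDiffAt ℂ ⊤ G 0 := hGa.contDiffAt
  have hGs := hGc.hasStrictFDerivAt' hG1 (by simp)
  set ψ := hGs.localInverse with hψ
  have hψ0 : ψ 0 = 0 := by
    have := hGs.localInverse_apply_image
    rwa [hG0] at this
  have hψa : AnalyticAt ℂ ψ 0 := by
    have := hGc.to_localInverse hG1 (by simp)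
    rw [hG0] at this
    exact this.analyticAt
  have hψ1 : HasFDerivAt ψ (ContinuousLinearMap.id ℂ (wedgeSpace ν E)) 0 := by
    have := hGs.to_localInverse.hasFDerivAt
    rwa [hG0] at this
  have hψG : ∀ᶠ y in 𝓝 0, G (ψ y) = y := by
    have := hGs.eventually_right_inverse
    rwa [hG0] at this
  set S : E → wedgeSpace ν E := fun ξ => ψ (Complex.exp β • T ξ) with hS
  have hS0 : S 0 = 0 := by simp [hS, hψ0]
  have hin : Tendsto (fun ξ => Complex.exp β • T ξ) (𝓝 0) (𝓝 0) := by
    have : Continuous fun ξ => Complex.exp β • T ξ := (Complex.exp β • T).continuous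
    simpa using this.tendsto 0
  have hTa : ∀ ξ, AnalyticAt ℂ (fun ξ => Complex.exp β • T ξ) ξ := fun ξ =>
    (Complex.exp β • T).analyticAt ξ
  have hSa : AnalyticAt ℂ S 0 := by
    refine AnalyticAt.comp (g := ψ) ?_ (hTa 0)
    simpa using hψa
  have hS1 : HasFDerivAt S (Complex.exp β • T) 0 := by
    have h1 : HasFDerivAt (fun ξ => Complex.exp β • T ξ) (Complex.exp β • T) 0 :=
      (Complex.exp β • T).hasFDerivAt
    refine (HasFDerivAt.comp (g := ψ) (g' := ContinuousLinearMap.id ℂ _) 0 ?_ h1).congr_fderiv ?_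
    · simpa using hψ1
    · ext1 w; simp
  -- Differentiability at 0 gives |S ξ| ≤ K|ξ|, the source of the factor |ξ| in the decay estimate.
  obtain ⟨K, hK0, hK⟩ := hS1.isBigO_sub.exists_nonneg
  have hKev := hK.bound
  simp only [hS0, sub_zero] at hKev
  have hSt : Tendsto S (𝓝 0) (𝓝 0) := by
    have := hS1.continuousAt.tendsto
    rwa [hS0] at this
  obtain ⟨ρ, hρ, hall⟩ := Metric.eventually_nhds_iff.1 (hKev.and ((hin.eventually hψG).and
    ((hSt.eventually hF3).and hSa.eventually_analyticAt)))
  set V : E → ℂ → E := fun ξ t => c t • wedgeSpace.eval ν E t (S ξ) with hV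
  have hc0 : c 0 * Complex.exp β = 1 := by
    rw [hcdef, ← Complex.exp_add]; simp
  have h0mem := zero_mem_wedgeNhd hν
  have hdecomp : ∀ ξ, ‖ξ‖ < ρ → S ξ = Complex.exp β • T ξ + hB.solve (F (S ξ)) := by
    intro ξ hξ
    have h1 := (hall (y := ξ) (by simpa using hξ)).2.1
    exact sub_eq_iff_eq_add.1 h1
  refine ⟨V, ρ, K, hρ, hK0, ?_, ?_, ?_, ?_, ?_⟩
  · intro ξ hξ t ht
    have h3 := (hall (y := ξ) (by simpa using hξ)).2.2.1 t ht
    have hd : HasDerivAt (fun t => wedgeSpace.eval ν E t (S ξ))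
        (B (wedgeSpace.eval ν E t (S ξ)) + wedgeSpace.eval ν E t (F (S ξ))) t := by
      have h4 : HasDerivAt (fun t => NormedSpace.exp (t • B) (Complex.exp β • P ξ))
          (B (NormedSpace.exp (t • B) (Complex.exp β • P ξ))) t := by
        have := hasDerivAt_exp_smul_apply B (hasDerivAt_id t)
          (hasDerivAt_const t (Complex.exp β • P ξ))
        refine this.congr_deriv ?_
        rw [one_smul, add_zero]
        exact (DFunLike.congr_fun (commute_exp_smul (Commute.refl B) t).eq _).symm
      have h5 := h4.add (hB.hasDerivAt_solve (F (S ξ)) ht)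
      have h6 : ∀ s ∈ wedgeNhd ν, wedgeSpace.eval ν E s (S ξ) =
          NormedSpace.exp (s • B) (Complex.exp β • P ξ) +
            wedgeSpace.eval ν E s (hB.solve (F (S ξ))) := by
        intro s hs
        conv_lhs => rw [hdecomp ξ hξ]
        rw [map_add, map_smul, hT ξ s hs, map_smul]
      refine (h5.congr_of_eventuallyEq ?_).congr_deriv ?_
      · filter_upwards [(isOpen_wedgeNhd ν).mem_nhds ht] with s hs using h6 s hs
      · rw [h6 t ht, map_add, add_assoc]
    refine ((hcd t).smul hd).congr_deriv ?_
    rw [hV]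
    simp only
    rw [← h3, hBdef, map_smul]
    simp only [add_apply, smul_apply, one_apply_eq_self, smul_add, smul_smul, neg_mul, neg_smul]
    rw [mul_comm (c t) (β : ℂ)]
    abel
  · intro ξ hξ
    rw [hV]
    simp only
    rw [hdecomp ξ hξ, map_add, map_smul (wedgeSpace.eval ν E 0), hT ξ 0 h0mem, map_smul P,
      map_add P, hB.apply_eval_zero_solve, add_zero, exp_zero_smul_apply, map_smul P, hB.idem,
      smul_smul, hc0, one_smul]
  · intro ξ hξ t ht
    have h1 := (hall (y := ξ) (by simpa using hξ)).1
    rw [hV]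
    simp only
    rw [norm_smul, hcn]
    have h2 : Real.exp (-β * (t.re + 1)) ≤ Real.exp (-β * t.re) :=
      Real.exp_le_exp.2 (by nlinarith)
    calc _ ≤ Real.exp (-β * t.re) * (K * ‖ξ‖) :=
          mul_le_mul h2 ((wedgeSpace.norm_eval_le _ t).trans h1) (norm_nonneg _)
            (Real.exp_pos _).le
      _ = _ := by ring
  · intro ξ hξ
    have h1 := (hall (y := ξ) hξ).2.2.2
    exact (((wedgeSpace.eval ν E 0).analyticAt _).comp h1).const_smul
  · have h1 := ((wedgeSpace.eval ν E 0).hasFDerivAt.comp 0 hS1).const_smul (c 0)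
    refine HasFDerivAt.congr_fderiv h1 ?_
    ext1 ξ
    simp only [smul_apply, ContinuousLinearMap.comp_apply, map_smul]
    rw [hT ξ 0 h0mem, exp_zero_smul_apply, smul_smul, hc0, one_smul]

end IsDichotomy

end Nonlinear

/-! ### Wedge bounds, the eigenvalue cone and the resulting dichotomies -/

section SpectralCone

variable {n : ℕ} (A : Cn n →L[ℂ] Cn n)

/-- The projection `Π_s` as a continuous linear map. -/
def stableProjL : Cn n →L[ℂ] Cn n := spectralProjL A {μ | μ.re < 0}

/-- The stable eigenvalues lie in a cone: exactly what exponential decay of the stable propagator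
at rate `η` in the wedge of opening `ν` means, up to polynomial factors. -/
def IsStableCone (η ν : ℝ) : Prop :=
  ∀ μ : ℂ, Module.End.HasEigenvalue (A : Module.End ℂ (Cn n)) μ → μ.re < 0 →
    μ.re + ν * |μ.im| ≤ -η

theorem abs_im_le_of_hasEigenvalue {μ : ℂ}
    (h : Module.End.HasEigenvalue (A : Module.End ℂ (Cn n)) μ) : |μ.im| ≤ ‖A‖ :=
  (Complex.abs_im_le_norm μ).trans (norm_le_of_hasEigenvalue A h)

theorem mul_re_le {ν : ℝ} {t μ : ℂ} (h : |t.im| ≤ ν * |t.re|) :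
    (t * μ).re ≤ t.re * μ.re + |t.re| * (ν * |μ.im|) := by
  rw [Complex.mul_re]
  have h1 : -(t.im * μ.im) ≤ |t.im| * |μ.im| := by
    rw [← abs_mul]; exact neg_le_abs _
  have h2 : |t.im| * |μ.im| ≤ ν * |t.re| * |μ.im| :=
    mul_le_mul_of_nonneg_right h (abs_nonneg _)
  linarith

theorem norm_le_of_abs_im_le {ν : ℝ} {t : ℂ} (h : |t.im| ≤ ν * |t.re|) :
    ‖t‖ ≤ (1 + ν) * |t.re| := by
  linarith [Complex.norm_le_abs_re_add_abs_im t]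

/-- There are finitely many eigenvalues, so a gap `δ` remains between η and their nonzero |Re μ|.
For a thin wedge the rotation term ν|Im μ| and the polynomial factors fit into this gap, and on the
center part into θ. -/
theorem exists_wedgeBounds {η θ : ℝ} (hη : IsSpectralRate A η) (hθ : 0 < θ) :
    ∃ ν : ℝ, 0 < ν ∧ WedgeBounds A η θ ν := by
  obtain ⟨δ, hδ, hgap⟩ := exists_pos_le_of_hasEigenvalue A (fun μ => |μ.re| - η)
  have hgap' : ∀ μ : ℂ, Module.End.HasEigenvalue (A : Module.End ℂ (Cn n)) μ → μ.re ≠ 0 →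
      η + δ ≤ |μ.re| := fun μ h h0 => by
    have := hgap μ h (sub_pos.2 (hη.2 μ h h0)); linarith
  -- Half of the gap pays for rotation; the other half pays for polynomial factors, through ε = δ/4
  -- and |t| ≤ 2|Re t|, which uses ν ≤ 1.
  set m := min 1 (min (δ / 2) (θ / 2)) with hm
  have hm0 : 0 < m := by positivity
  have hA1 : 0 < ‖A‖ + 1 := by positivity
  set ν := m / (‖A‖ + 1) with hν
  have hν0 : 0 < ν := by positivity
  have hνA : ν * ‖A‖ ≤ m := by
    rw [hν, div_mul_eq_mul_div, div_le_iff₀ hA1]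
    nlinarith [norm_nonneg A]
  have hν1 : ν ≤ 1 := by
    rw [hν, div_le_one hA1]
    linarith [min_le_left 1 (min (δ / 2) (θ / 2)), norm_nonneg A]
  have hmδ : m ≤ δ / 2 := (min_le_right _ _).trans (min_le_left _ _)
  have hmθ : m ≤ θ / 2 := (min_le_right _ _).trans (min_le_right _ _)
  have him : ∀ μ : ℂ, Module.End.HasEigenvalue (A : Module.End ℂ (Cn n)) μ →
      ν * |μ.im| ≤ m := fun μ h =>
    (mul_le_mul_of_nonneg_left (abs_im_le_of_hasEigenvalue A h) hν0.le).trans hνA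
  refine ⟨ν, hν0, ?_, ?_, ?_⟩
  · obtain ⟨C, -, hC⟩ := exists_norm_exp_spectralProjL_le A {μ | μ.re < 0} (forwardWedge 0 ν)
      (fun t => -η * |t.re|) fun μ hμ hev => by
        refine ⟨δ / 4, by positivity, 0, fun t ht => ?_⟩
        have ht2 : |t.im| ≤ ν * |t.re| := by simpa using ht.2
        have h1 := mul_re_le (μ := μ) ht2
        have h2 := norm_le_of_abs_im_le ht2
        have h3 := him μ hev
        have h4 := hgap' μ hev (ne_of_lt hμ)
        rw [abs_of_neg hμ] at h4
        have h0 := abs_nonneg t.re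
        have h5 : t.re * μ.re = |t.re| * μ.re := by rw [abs_of_nonneg ht.1]
        rw [h5] at h1
        have h6 : δ / 4 * ‖t‖ ≤ δ / 4 * (2 * |t.re|) :=
          mul_le_mul_of_nonneg_left (h2.trans (by nlinarith)) (by positivity)
        have h7 := mul_le_mul_of_nonneg_left (h3.trans hmδ) h0
        have h8 := mul_le_mul_of_nonneg_left h4 h0
        linarith
    exact ⟨C, hC⟩
  · obtain ⟨C, -, hC⟩ := exists_norm_exp_spectralProjL_le A {μ | μ.re = 0}
      {t : ℂ | |t.im| ≤ ν * |t.re|} (fun t => θ * ‖t‖) fun μ hμ hev => by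
        refine ⟨θ / 2, by positivity, 0, fun t ht => ?_⟩
        have h1 := mul_re_le (μ := μ) ht
        rw [show μ.re = 0 from hμ] at h1
        have h3 := him μ hev
        have h0 := abs_nonneg t.re
        have h2 := Complex.abs_re_le_norm t
        nlinarith [mul_le_mul_of_nonneg_left h3 h0]
    exact ⟨C, fun t ht v => hC t ht v⟩
  · obtain ⟨C, -, hC⟩ := exists_norm_exp_spectralProjL_le A {μ | 0 < μ.re} (backwardWedge 0 ν)
      (fun t => -η * |t.re|) fun μ hμ hev => by
        refine ⟨δ / 4, by positivity, 0, fun t ht => ?_⟩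
        have ht2 : |t.im| ≤ ν * |t.re| := by simpa using ht.2
        have h1 := mul_re_le (μ := μ) ht2
        have h2 := norm_le_of_abs_im_le ht2
        have h3 := him μ hev
        have h4 := hgap' μ hev (ne_of_gt hμ)
        rw [abs_of_pos hμ] at h4
        have h0 := abs_nonneg t.re
        have h5 : t.re * μ.re = -(|t.re| * μ.re) := by rw [abs_of_nonpos ht.1]; ring
        rw [h5] at h1
        have h6 : δ / 4 * ‖t‖ ≤ δ / 4 * (2 * |t.re|) :=
          mul_le_mul_of_nonneg_left (h2.trans (by nlinarith)) (by positivity)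
        have h7 := mul_le_mul_of_nonneg_left (h3.trans hmδ) h0
        have h8 := mul_le_mul_of_nonneg_left h4 h0
        linarith
    exact ⟨C, hC⟩

theorem exp_smul_apply_of_eigenvector {μ : ℂ} {v : Cn n} (hv : A v = μ • v) (t : ℂ) :
    NormedSpace.exp (t • A) v = Complex.exp (t * μ) • v := by
  have hd : ∀ s : ℂ,
      HasDerivAt (fun s : ℂ => NormedSpace.exp ((-s) • A) (Complex.exp (s * μ) • v)) 0 s := by
    intro s
    have h3 : HasDerivAt (fun s : ℂ => s * μ) μ s := by
      simpa using (hasDerivAt_id s).mul_const μ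
    refine (hasDerivAt_exp_smul_apply A (hasDerivAt_id s).neg
      (h3.cexp.smul_const v)).congr_deriv ?_
    rw [map_smul A, hv, neg_one_smul, smul_smul, neg_add_cancel, map_zero]
  have hc := is_const_of_deriv_eq_zero (fun s => (hd s).differentiableAt)
    (fun s => (hd s).deriv) t 0
  simp only [neg_zero, exp_zero_smul_apply, zero_mul, Complex.exp_zero, one_smul] at hc
  have := exp_smul_apply_exp_neg A t (Complex.exp (t * μ) • v)
  rwa [hc] at this

/-- Exponential decay of an eigensolution in a wedge restricts the eigenvalue. -/
theorem re_add_le_of_exp_bound {μ : ℂ} {v : Cn n} (hv : A v = μ • v) (hv0 : v ≠ 0) {η ν C : ℝ}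
    (hν : 0 < ν)
    (h : ∀ t ∈ forwardWedge 0 ν,
      ‖NormedSpace.exp (t • A) v‖ ≤ C * Real.exp (-η * |t.re|) * ‖v‖) :
    μ.re + ν * |μ.im| ≤ -η := by
  -- The sign selects the edge of the wedge on which e^{tμ} is largest.
  obtain ⟨σ, hσ, hσμ⟩ : ∃ σ : ℝ, |σ| = 1 ∧ -(σ * μ.im) = |μ.im| := by
    rcases le_total 0 μ.im with h | h
    · exact ⟨-1, by simp, by rw [abs_of_nonneg h]; ring⟩
    · exact ⟨1, by simp, by rw [abs_of_nonpos h]; ring⟩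
  set q := μ.re + ν * |μ.im| + η with hq
  by_contra hcon
  have hq0 : 0 < q := by rw [hq]; linarith [not_le.1 hcon]
  -- On that edge the bound forces e^{xq} ≤ C; this `x` makes xq = |C| + 1, which is impossible.
  set x := (|C| + 1) / q with hx
  have hx0 : 0 < x := by positivity
  set t : ℂ := ⟨x, ν * σ * x⟩ with ht
  have htre : t.re = x := rfl
  have htim : t.im = ν * σ * x := rfl
  have hmem : t ∈ forwardWedge 0 ν := by
    refine ⟨by rw [htre]; exact hx0.le, ?_⟩
    rw [htre, htim, sub_zero, abs_mul, abs_mul, hσ, abs_of_pos hν, mul_one]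
  have h1 := h t hmem
  rw [exp_smul_apply_of_eigenvector A hv, norm_smul, Complex.norm_exp] at h1
  have h2 := le_of_mul_le_mul_right h1 (norm_pos_iff.2 hv0)
  have h3 : (t * μ).re = x * (μ.re + ν * |μ.im|) := by
    rw [Complex.mul_re, htre, htim, ← hσμ]; ring
  rw [h3, htre, abs_of_pos hx0] at h2
  have h4 : Real.exp (x * q) ≤ C := by
    have h5 : Real.exp (x * q) = Real.exp (x * (μ.re + ν * |μ.im|)) * Real.exp (η * x) := by
      rw [← Real.exp_add]; congr 1; rw [hq]; ring
    have h6 : C = C * Real.exp (-η * x) * Real.exp (η * x) := by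
      rw [mul_assoc, ← Real.exp_add]; simp
    rw [h5, h6]
    exact mul_le_mul_of_nonneg_right h2 (Real.exp_pos _).le
  have h7 : x * q = |C| + 1 := by rw [hx]; field_simp
  rw [h7] at h4
  linarith [Real.add_one_le_exp (|C| + 1), le_abs_self C]

theorem mem_spectralSubspace_of_eigenvector {S : Set ℂ} {μ : ℂ} (hμ : μ ∈ S) {v : Cn n}
    (hv : A v = μ • v) : v ∈ spectralSubspace A S := by
  refine (le_iSup₂_of_le (f := fun μ (_ : μ ∈ S) =>
    Module.End.maxGenEigenspace (A : Module.End ℂ (Cn n)) μ) μ hμ le_rfl) ?_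
  refine (Module.End.mem_maxGenEigenspace _ _ _).2 ⟨1, ?_⟩
  rw [pow_one]
  change A v - μ • v = 0
  rw [hv, sub_self]

/-- Stable eigenvectors are fixed by Π_s, so the bound applies to pure exponentials. The
construction of the manifold uses the wedge bounds only in this form. -/
theorem WedgeBounds.isStableCone {η θ ν : ℝ} (h : WedgeBounds A η θ ν) (hν : 0 < ν) :
    IsStableCone A η ν := by
  obtain ⟨C, hC⟩ := h.stable
  intro μ hμ hre
  obtain ⟨v, hv⟩ := hμ.exists_hasEigenvector
  have hAv : A v = μ • v := hv.apply_eq_smul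
  have hP : stableProj A v = v :=
    spectralProjL_of_mem A (mem_spectralSubspace_of_eigenvector A hre hAv)
  refine re_add_le_of_exp_bound A hAv hv.2 hν (C := C) fun t ht => ?_
  have := hC t ht v
  rwa [hP] at this

/-- Time reversal makes the unstable bound for `A` a stable one for -A, as needed for profiles at
-∞. -/
theorem WedgeBounds.isStableCone_neg {η θ ν : ℝ} (h : WedgeBounds A η θ ν) (hν : 0 < ν) :
    IsStableCone (-A) η ν := by
  obtain ⟨C, hC⟩ := h.unstable
  intro μ hμ hre
  obtain ⟨v, hv⟩ := hμ.exists_hasEigenvector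
  have hAv : (-A) v = μ • v := hv.apply_eq_smul
  have hAv' : A v = (-μ) • v := by
    rw [neg_smul, ← hAv, neg_apply, neg_neg]
  have hP : unstableProj A v = v :=
    spectralProjL_of_mem A (mem_spectralSubspace_of_eigenvector A
      (show 0 < (-μ).re by rw [Complex.neg_re]; linarith) hAv')
  refine re_add_le_of_exp_bound (-A) hAv hv.2 hν (C := C) fun t ht => ?_
  have := hC (-t) (by
    refine ⟨by simpa using ht.1, ?_⟩
    simpa using ht.2) v
  have hneg : (-t) • A = t • (-A) := by ext1 w; simp
  rwa [hP, Complex.neg_re, abs_neg, hneg] at this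

/-- Some cone always contains the stable eigenvalues. -/
theorem exists_isStableCone : ∃ η ν : ℝ, 0 < η ∧ 0 < ν ∧ IsStableCone A η ν := by
  obtain ⟨δ, hδ, h⟩ := exists_pos_le_of_hasEigenvalue A (fun μ => -μ.re)
  have hA1 : 0 < ‖A‖ + 1 := by positivity
  refine ⟨δ / 2, δ / 2 / (‖A‖ + 1), by positivity, by positivity, fun μ hμ hre => ?_⟩
  have h1 := h μ hμ (by linarith)
  have h2 : δ / 2 / (‖A‖ + 1) * |μ.im| ≤ δ / 2 := by
    rw [div_mul_eq_mul_div, div_le_iff₀ hA1]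
    nlinarith [abs_im_le_of_hasEigenvalue A hμ]
  linarith

theorem norm_exp_smul_add_smul_one_apply (β : ℝ) (t : ℂ) (v : Cn n) :
    ‖NormedSpace.exp (t • (A + (β : ℂ) • (1 : Cn n →L[ℂ] Cn n))) v‖ =
      Real.exp (β * t.re) * ‖NormedSpace.exp (t • A) v‖ := by
  rw [exp_smul_add_smul_one, smul_apply, norm_smul, Complex.norm_exp, Complex.re_mul_ofReal,
    mul_comm t.re]

variable {A} in
-- The shift by β < η leaves the stable eigenvalues on the left, even after rotation within the
-- wedge. The others land strictly on the right, thanks to β > 0 or, for β = 0, to hyperbolicity.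
theorem IsStableCone.exists_isDichotomy {η ν β : ℝ} (h : IsStableCone A η ν) (hν : 0 < ν)
    (hβ0 : 0 ≤ β) (hβη : β < η) (hβ : 0 < β ∨ IsHyperbolic A) :
    ∃ ν' C a : ℝ, ν ≤ ν' ∧
      IsDichotomy (A + (β : ℂ) • (1 : Cn n →L[ℂ] Cn n)) (stableProjL A) ν' C a := by
  have hA1 : 0 < ‖A‖ + 1 := by positivity
  -- Of the margin η - β = 4d, one `d` widens the opening, one absorbs polynomial factors, and two
  -- are left for the rate `a`.
  set d := (η - β) / 4 with hd
  have hd0 : 0 < d := by rw [hd]; linarith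
  set ν' := ν + d / (‖A‖ + 1) with hν'
  have hνν' : ν < ν' := by rw [hν']; linarith [div_pos hd0 hA1]
  have hν'0 : 0 < ν' := hν.trans hνν'
  obtain ⟨δ, hδ, hgap⟩ := exists_pos_le_of_hasEigenvalue A (fun μ => μ.re + β)
  set a := min (2 * d) (δ / 2) with ha
  have ha0 : 0 < a := by positivity
  obtain ⟨C₁, hC₁, hS⟩ := exists_norm_exp_spectralProjL_le A {μ | μ.re < 0} (wedgeNhd ν')
    (fun t => -(β + a) * t.re) fun μ hμ hev => by
      -- The additive constant absorbs the displacement of the vertex of the domain from 0 to -1.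
      refine ⟨d / (1 + ν'), by positivity, ‖A‖ + 2 * η + 2 * d + |β + a|, fun t ht => ?_⟩
      have hre := neg_one_lt_re_of_mem_wedgeNhd hν'0 ht
      have h1 := norm_le_of_mem_wedgeNhd hν'0 ht
      have h2 : d / (1 + ν') * ‖t‖ ≤ d * (t.re + 2) := by
        rw [div_mul_eq_mul_div, div_le_iff₀ (by positivity)]
        nlinarith
      have h3 : ν' * |μ.im| ≤ ν * |μ.im| + d := by
        rw [hν', add_mul]
        have : d / (‖A‖ + 1) * |μ.im| ≤ d := by
          rw [div_mul_eq_mul_div, div_le_iff₀ hA1]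
          nlinarith [abs_im_le_of_hasEigenvalue A hev]
        linarith
      have h4 := h μ hev hμ
      have h5 : (t * μ).re ≤ (t.re + 1) * (μ.re + ν' * |μ.im|) - μ.re := by
        rw [Complex.mul_re]
        have h6 : -(t.im * μ.im) ≤ |t.im| * |μ.im| := by
          rw [← abs_mul]; exact neg_le_abs _
        have h7 : |t.im| * |μ.im| ≤ ν' * (t.re + 1) * |μ.im| :=
          mul_le_mul_of_nonneg_right (le_of_lt ht) (abs_nonneg _)
        linarith
      have h8 : -μ.re ≤ ‖A‖ :=
        (neg_le_abs _).trans ((Complex.abs_re_le_norm μ).trans (norm_le_of_hasEigenvalue A hev))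
      have h9 : (t.re + 1) * (μ.re + ν' * |μ.im|) ≤ (t.re + 1) * (-η + d) :=
        mul_le_mul_of_nonneg_left (by linarith) (by linarith)
      have h10 : a ≤ 2 * d := min_le_left _ _
      have h11 : (t.re + 1) * (-η + 2 * d) ≤ (t.re + 1) * -(β + a) :=
        mul_le_mul_of_nonneg_left (by rw [hd] at *; linarith) (by linarith)
      have h12 : -(β + a) ≤ |β + a| := neg_le_abs _
      have hη : 0 < η := by linarith
      nlinarith
  obtain ⟨C₂, hC₂, hU⟩ := exists_norm_exp_spectralProjL_le A {μ | μ.re < 0}ᶜ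
    {t : ℂ | t.re ≤ 0 ∧ t.im = 0} (fun t => (a - β) * t.re) fun μ hμ hev => by
      refine ⟨δ / 2, by positivity, 0, fun t ht => ?_⟩
      have hre : 0 ≤ μ.re := not_lt.1 hμ
      have hpos : 0 < μ.re + β := by
        rcases hβ with hβ | hβ
        · linarith
        · have := lt_of_le_of_ne hre (hβ μ hev).symm
          linarith
      have h1 := hgap μ hev hpos
      have h2 : ‖t‖ = -t.re := by
        have : t = (t.re : ℂ) := Complex.ext rfl (by simpa using ht.2)
        rw [this, Complex.norm_real, Real.norm_eq_abs, Complex.ofReal_re, abs_of_nonpos ht.1]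
      rw [Complex.mul_re, ht.2, h2]
      have h10 : a ≤ δ / 2 := min_le_right _ _
      have h3 : t.re * (μ.re + β) ≤ t.re * δ := mul_le_mul_of_nonpos_left h1 ht.1
      have h4 : t.re * (δ / 2) ≤ t.re * a := mul_le_mul_of_nonpos_left h10 ht.1
      linarith
  refine ⟨ν', max C₁ C₂, a, hνν'.le, ⟨hν'0, ha0, hC₁.trans (le_max_left _ _), ?_, ?_, ?_, ?_⟩⟩
  · exact (commute_spectralProjL A _).add_right ((Commute.one_right _).smul_right _)
  · exact spectralProjL_idem A _
  · intro t ht v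
    rw [norm_exp_smul_add_smul_one_apply]
    calc _ ≤ Real.exp (β * t.re) * (C₁ * Real.exp (-(β + a) * t.re) * ‖v‖) :=
          mul_le_mul_of_nonneg_left (hS t ht v) (Real.exp_pos _).le
      _ = C₁ * (Real.exp (β * t.re) * Real.exp (-(β + a) * t.re)) * ‖v‖ := by ring
      _ = C₁ * Real.exp (-a * t.re) * ‖v‖ := by rw [← Real.exp_add]; ring_nf
      _ ≤ _ := by gcongr; exact le_max_left _ _
  · intro x hx v
    have hv : v - stableProjL A v = spectralProjL A {μ | μ.re < 0}ᶜ (v - stableProjL A v) :=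
      (spectralProjL_of_mem A (sub_spectralProjL_mem A _ v)).symm
    have hv' : spectralProjL A {μ | μ.re < 0}ᶜ (v - stableProjL A v) =
        spectralProjL A {μ | μ.re < 0}ᶜ v := by
      have hz : spectralProjL A {μ : ℂ | μ.re < 0}ᶜ (stableProjL A v) = 0 := by
        rw [spectralProjL_eq_zero_iff, compl_compl]
        exact spectralProjL_mem A _ v
      rw [map_sub, hz, sub_zero]
    rw [norm_exp_smul_add_smul_one_apply, hv, hv']
    have h1 := hU (-x : ℂ) ⟨by simpa using hx, by simp⟩ v
    have hre : (-x : ℂ).re = -x := by simp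
    rw [hre] at h1 ⊢
    calc _ ≤ Real.exp (β * -x) * (C₂ * Real.exp ((a - β) * -x) * ‖v‖) :=
          mul_le_mul_of_nonneg_left h1 (Real.exp_pos _).le
      _ = C₂ * (Real.exp (β * -x) * Real.exp ((a - β) * -x)) * ‖v‖ := by ring
      _ = C₂ * Real.exp (-a * x) * ‖v‖ := by rw [← Real.exp_add]; ring_nf
      _ ≤ _ := by gcongr; exact le_max_right _ _

variable {A} in
/-- Decay of the stable propagator at any rate below `η`. -/
theorem IsStableCone.exists_norm_exp_le {η ν η' : ℝ} (h : IsStableCone A η ν) (hν : 0 < ν)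
    (hη : η' < η) : ∃ C : ℝ, 0 ≤ C ∧ ∀ t ∈ forwardWedge 0 ν, ∀ v : Cn n,
      ‖NormedSpace.exp (t • A) (stableProjL A v)‖ ≤ C * Real.exp (-η' * t.re) * ‖v‖ := by
  refine exists_norm_exp_spectralProjL_le A {μ | μ.re < 0} (forwardWedge 0 ν)
    (fun t => -η' * t.re) fun μ hμ hev => ?_
  refine ⟨(η - η') / (1 + ν), div_pos (by linarith) (by linarith), 0, fun t ht => ?_⟩
  have ht2 : |t.im| ≤ ν * |t.re| := by simpa using ht.2
  have h1 := mul_re_le (μ := μ) ht2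
  have h2 := norm_le_of_abs_im_le ht2
  have h3 : (η - η') / (1 + ν) * ‖t‖ ≤ (η - η') * |t.re| := by
    rw [div_mul_eq_mul_div, div_le_iff₀ (by positivity)]
    nlinarith
  rw [abs_of_nonneg ht.1] at h1 h3
  have h4 : t.re * (μ.re + ν * |μ.im|) ≤ t.re * -η :=
    mul_le_mul_of_nonneg_left (h μ hev hμ) ht.1
  linarith

end SpectralCone

/-! ### Uniqueness on the half-line and sharp decay -/

section Families

variable {n : ℕ}

/-- `z` solves `z' = g(z)` on the half-line `x ≥ 0`. -/
def IsHalfLineSolution (g : Cn n → Cn n) (z : ℝ → Cn n) : Prop :=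
  ∀ x ∈ Ici (0 : ℝ), HasDerivWithinAt z (g (z x)) (Ici 0) x

/-- `V ξ` solves `v' = g(v)` on `wedgeNhd ν`, decays at rate `β`, and has stable component `P ξ`
at time `0`. -/
structure IsSolutionFamily (g : Cn n → Cn n) (P : Cn n →L[ℂ] Cn n) (V : Cn n → ℂ → Cn n)
    (ν β ρ K : ℝ) : Prop where
  opening_pos : 0 < ν
  rate_nonneg : 0 ≤ β
  const_nonneg : 0 ≤ K
  deriv : ∀ ξ, ‖ξ‖ < ρ → ∀ t ∈ wedgeNhd ν, HasDerivAt (V ξ) (g (V ξ t)) t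
  proj : ∀ ξ, ‖ξ‖ < ρ → P (V ξ 0) = P ξ
  decay : ∀ ξ, ‖ξ‖ < ρ → ∀ t ∈ wedgeNhd ν, ‖V ξ t‖ ≤ K * Real.exp (-β * t.re) * ‖ξ‖

/-- Solutions on the half-line which are smaller than `ε` and decay at rate `β` are determined by
their initial stable component. -/
def IsUniquenessRadius (g : Cn n → Cn n) (P : Cn n →L[ℂ] Cn n) (β ε : ℝ) : Prop :=
  ∀ (z w : ℝ → Cn n) (K : ℝ), IsHalfLineSolution g z → IsHalfLineSolution g w →
    (∀ x ∈ Ici (0 : ℝ), ‖z x‖ < ε) → (∀ x ∈ Ici (0 : ℝ), ‖w x‖ < ε) →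
    (∀ x ∈ Ici (0 : ℝ), ‖z x‖ ≤ K * Real.exp (-β * x)) →
    (∀ x ∈ Ici (0 : ℝ), ‖w x‖ ≤ K * Real.exp (-β * x)) →
    P (z 0) = P (w 0) → ∀ x ∈ Ici (0 : ℝ), z x = w x

namespace IsSolutionFamily

variable {g : Cn n → Cn n} {P : Cn n →L[ℂ] Cn n} {V : Cn n → ℂ → Cn n} {ν β ρ K : ℝ}

theorem mono (h : IsSolutionFamily g P V ν β ρ K) {ρ' : ℝ} (hρ : ρ' ≤ ρ) :
    IsSolutionFamily g P V ν β ρ' K :=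
  ⟨h.opening_pos, h.rate_nonneg, h.const_nonneg, fun ξ hξ => h.deriv ξ (hξ.trans_le hρ),
    fun ξ hξ => h.proj ξ (hξ.trans_le hρ), fun ξ hξ => h.decay ξ (hξ.trans_le hρ)⟩

theorem norm_le (h : IsSolutionFamily g P V ν β ρ K) {ξ : Cn n} (hξ : ‖ξ‖ < ρ) {t : ℂ}
    (ht : t ∈ wedgeNhd ν) : ‖V ξ t‖ ≤ K * Real.exp β * ‖ξ‖ := by
  refine (h.decay ξ hξ t ht).trans ?_
  have := h.rate_nonneg; have := h.const_nonneg
  gcongr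
  nlinarith [neg_one_lt_re_of_mem_wedgeNhd h.opening_pos ht]

theorem hasDerivWithinAt (h : IsSolutionFamily g P V ν β ρ K) {ξ : Cn n} (hξ : ‖ξ‖ < ρ) {t : ℂ}
    {x : ℝ} (ht : t + x ∈ wedgeNhd ν) (S : Set ℝ) :
    HasDerivWithinAt (fun x : ℝ => V ξ (t + x)) (g (V ξ (t + x))) S x := by
  have h2 : HasDerivAt (fun s : ℝ => t + (s : ℂ)) 1 x := by
    simpa using (hasDerivAt_id x).ofReal_comp.const_add t
  have h3 := (h.deriv ξ hξ _ ht).scomp x h2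
  rw [one_smul] at h3
  exact h3.hasDerivWithinAt

theorem isHalfLineSolution (h : IsSolutionFamily g P V ν β ρ K) {ξ : Cn n} (hξ : ‖ξ‖ < ρ) {t : ℂ}
    (ht : t ∈ wedgeNhd ν) : IsHalfLineSolution g (fun x : ℝ => V ξ (t + x)) := fun _ hx =>
  h.hasDerivWithinAt hξ (add_mem_wedgeNhd h.opening_pos ht hx) _

theorem differentiableOn (h : IsSolutionFamily g P V ν β ρ K) {ξ : Cn n} (hξ : ‖ξ‖ < ρ) :
    DifferentiableOn ℂ (V ξ) (wedgeNhd ν) := fun t ht =>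
  (h.deriv ξ hξ t ht).differentiableAt.differentiableWithinAt

/-- A small decaying solution on the half-line belongs to the family. -/
theorem eq_of_isHalfLineSolution (h : IsSolutionFamily g P V ν β ρ K) (hP : ∀ v, P (P v) = P v)
    {β₁ ε : ℝ} (hε : IsUniquenessRadius g P β₁ ε) (hββ : β₁ ≤ β) {z : ℝ → Cn n}
    (hz : IsHalfLineSolution g z) (hzε : ∀ x ∈ Ici (0 : ℝ), ‖z x‖ < ε) {K₁ : ℝ}
    (hzK : ∀ x ∈ Ici (0 : ℝ), ‖z x‖ ≤ K₁ * Real.exp (-β₁ * x))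
    (h1 : ‖P (z 0)‖ < ρ) (h2 : K * Real.exp β * ‖P (z 0)‖ < ε) :
    ∀ x ∈ Ici (0 : ℝ), z x = V (P (z 0)) x := by
  have h0 := zero_mem_wedgeNhd h.opening_pos
  have hK := h.const_nonneg
  intro x hx
  have := hε z (fun x : ℝ => V (P (z 0)) (0 + x)) (max K₁ (K * ‖P (z 0)‖)) hz
    (h.isHalfLineSolution h1 h0) hzε
    (fun x hx => (h.norm_le h1 (add_mem_wedgeNhd h.opening_pos h0 hx)).trans_lt h2)
    (fun x hx => (hzK x hx).trans
      (mul_le_mul_of_nonneg_right (le_max_left _ _) (Real.exp_pos _).le))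
    (fun x hx => by
      refine (h.decay _ h1 _ (add_mem_wedgeNhd h.opening_pos h0 hx)).trans ?_
      have hre : ((0 : ℂ) + (x : ℂ)).re = x := by simp
      rw [hre]
      calc K * Real.exp (-β * x) * ‖P (z 0)‖ = (K * ‖P (z 0)‖) * Real.exp (-β * x) := by ring
        _ ≤ max K₁ (K * ‖P (z 0)‖) * Real.exp (-β₁ * x) := by
          refine mul_le_mul (le_max_right _ _) (Real.exp_le_exp.2 ?_) (Real.exp_pos _).le
            (le_max_of_le_right (by positivity))
          have hx' : 0 ≤ x := hx
          nlinarith)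
    (by simp only [Complex.ofReal_zero, add_zero]; rw [h.proj _ h1, hP]) x hx
  simpa using this

end IsSolutionFamily

/-- An analytic map is strictly differentiable, so where its derivative vanishes it has arbitrarily
small local Lipschitz constants. -/
theorem exists_norm_sub_le_mul_of_fderiv_eq_zero {E : Type*} [NormedAddCommGroup E]
    [NormedSpace ℂ E] [CompleteSpace E] {N : E → E} (hN : AnalyticAt ℂ N 0)
    (hN1 : HasFDerivAt N (0 : E →L[ℂ] E) 0) {κ : ℝ} (hκ : 0 < κ) :
    ∃ ε > 0, ∀ x y : E, ‖x‖ < ε → ‖y‖ < ε → ‖N x - N y‖ ≤ κ * ‖x - y‖ := by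
  have hs : HasStrictFDerivAt N (0 : E →L[ℂ] E) 0 := by
    have := hN.hasStrictFDerivAt
    rwa [hN1.fderiv] at this
  obtain ⟨s, hs1, hs2⟩ := hs.exists_lipschitzOnWith_of_nnnorm_lt ⟨κ, hκ.le⟩
    (by rw [nnnorm_zero]; exact hκ)
  obtain ⟨ε, hε, hball⟩ := Metric.mem_nhds_iff.1 hs1
  refine ⟨ε, hε, fun x y hx hy => ?_⟩
  have := hs2.dist_le_mul x (hball (by simpa using hx)) y (hball (by simpa using hy))
  rwa [dist_eq_norm, dist_eq_norm] at this

theorem norm_le_mul_sq {E : Type*} [NormedAddCommGroup E] [NormedSpace ℂ E]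
    {N : E → E} (hN : AnalyticAt ℂ N 0) (hN0 : N 0 = 0)
    (hN1 : HasFDerivAt N (0 : E →L[ℂ] E) 0) :
    ∃ c ≥ 0, ∃ ε > 0, ∀ x : E, ‖x‖ < ε → ‖N x‖ ≤ c * ‖x‖ ^ 2 := by
  obtain ⟨p, hp⟩ := hN
  have h1 := hp.isBigO_sub_partialSum_pow 2
  obtain ⟨c, hc, hb⟩ := h1.exists_nonneg
  obtain ⟨ε, hε, hball⟩ := Metric.eventually_nhds_iff.1 hb.bound
  refine ⟨c, hc, ε, hε, fun x hx => ?_⟩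
  have h2 := hball (y := x) (by simpa using hx)
  have hp0 : p 0 (fun _ => x) = 0 := by rw [hp.coeff_zero, hN0]
  have hp1 : p 1 (fun _ => x) = 0 := by
    have h3 := DFunLike.congr_fun (hp.hasFDerivAt.unique hN1) x
    rw [continuousMultilinearCurryFin1_apply] at h3
    rw [zero_apply] at h3
    rw [← h3]
    congr 1
  have h4 : p.partialSum 2 x = 0 := by
    rw [FormalMultilinearSeries.partialSum, Finset.sum_range_succ, Finset.sum_range_one, hp0, hp1,
      add_zero]
  rw [h4, zero_add, sub_zero, norm_pow, norm_norm] at h2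
  exact h2

variable {A : Cn n →L[ℂ] Cn n} {g : Cn n → Cn n}

theorem hasFDerivAt_sub_linear (hg1 : HasFDerivAt g A 0) :
    HasFDerivAt (fun y => g y - A y) (0 : Cn n →L[ℂ] Cn n) 0 := by
  have := hg1.sub A.hasFDerivAt
  rwa [sub_self] at this

theorem stableProjL_idem (v : Cn n) : stableProjL A (stableProjL A v) = stableProjL A v :=
  spectralProjL_idem A _ v

/-- The difference of two small solutions solves the linear equation up to an error with small
Lipschitz factor, so `eq_zero_of_deriv` applies. Rate β = 0 is allowed for hyperbolic `A`; this
covers profiles known only to converge. -/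
theorem exists_isUniquenessRadius (hg : AnalyticAt ℂ g 0) (hg1 : HasFDerivAt g A 0) {η ν β : ℝ}
    (hA : IsStableCone A η ν) (hν : 0 < ν) (hβ0 : 0 ≤ β) (hβη : β < η)
    (hβ : 0 < β ∨ IsHyperbolic A) :
    ∃ ε > 0, IsUniquenessRadius g (stableProjL A) β ε := by
  obtain ⟨ν', C, a, -, hB⟩ := hA.exists_isDichotomy hν hβ0 hβη hβ
  have hb := hB.bound_nonneg
  -- Makes the product of `κ` with the norm of the solution operator at most 1/2.
  set κ := 1 / (2 * (IsDichotomy.bound ν' C a + 1)) with hκ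
  have hκ0 : 0 < κ := by positivity
  obtain ⟨ε, hε, hlip⟩ := exists_norm_sub_le_mul_of_fderiv_eq_zero
    (N := fun y => g y - A y) (hg.sub (A.analyticAt 0))
    (hasFDerivAt_sub_linear hg1) hκ0
  refine ⟨ε, hε, fun z w K hz hw hzε hwε hzK hwK h0 x hx => ?_⟩
  have := hB.eq_zero_of_deriv (d := fun x => z x - w x)
    (h := fun x => (g (z x) - A (z x)) - (g (w x) - A (w x))) (κ := κ) (K := 2 * K)
    (by rw [hκ, mul_one_div, div_le_div_iff₀ (by positivity) (by positivity)]; linarith)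
    (fun x hx => ((hz x hx).sub (hw x hx)).congr_deriv (by rw [map_sub]; abel))
    (fun x hx => hlip _ _ (hzε x hx) (hwε x hx))
    (fun x hx => (norm_sub_le _ _).trans (by linarith [hzK x hx, hwK x hx]))
    (by rw [map_sub, h0, sub_self]) x hx
  exact sub_eq_zero.1 this

/-- The quadratic nonlinearity improves the decay rate `β ≥ η / 2` of a solution to all rates
below `η`. -/
theorem IsSolutionFamily.exists_sharp_decay (hg : AnalyticAt ℂ g 0) (hg0 : g 0 = 0)
    (hg1 : HasFDerivAt g A 0) {η ν β : ℝ} (hA : IsStableCone A η ν) (hν : 0 < ν)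
    {V : Cn n → ℂ → Cn n} {ν' ρ K C a : ℝ} (hνν' : ν ≤ ν')
    (hB : IsDichotomy (A + (β : ℂ) • (1 : Cn n →L[ℂ] Cn n)) (stableProjL A) ν' C a)
    (hV : IsSolutionFamily g (stableProjL A) V ν' β ρ K) (hβη : η ≤ 2 * β) (hρ : 0 < ρ) :
    ∃ r > 0, ∀ η' < η, ∃ C', 0 ≤ C' ∧ ∀ ξ, ‖ξ‖ < r → ∀ t ∈ forwardWedge 0 ν,
      ‖V ξ t‖ ≤ C' * Real.exp (-η' * t.re) * ‖ξ‖ := by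
  have hK := hV.const_nonneg
  have hC := hB.const_nonneg
  have ha := hB.rate_pos
  have hβ0 := hV.rate_nonneg
  obtain ⟨c, hc, ε, hε, hquad⟩ := norm_le_mul_sq (N := fun y => g y - A y)
    (hg.sub (A.analyticAt 0)) (by simp [hg0]) (hasFDerivAt_sub_linear hg1)
  have hM : 0 < K * Real.exp β + 1 := by positivity
  -- The radius is chosen before η', so a single one serves all rates. Keeping |ξ| ≤ 1 lets |ξ|² be
  -- replaced by |ξ|.
  refine ⟨min ρ (min 1 (ε / (K * Real.exp β + 1))), by positivity, fun η' hη' => ?_⟩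
  -- The intermediate rate leaves room to absorb the length |t| of the segment of integration.
  set η₁ := (η' + η) / 2 with hη₁
  obtain ⟨C₁, hC₁, hS⟩ := hA.exists_norm_exp_le hν (show η₁ < η by rw [hη₁]; linarith)
  set D := c * K ^ 2 with hD
  have hD0 : 0 ≤ D := by positivity
  have hη₁' : 0 < η₁ - η' := by rw [hη₁]; linarith
  refine ⟨C₁ * K + (1 + ν) * C₁ * D / (η₁ - η') + C * D / (β + a), by positivity,
    fun ξ hξ t ht => ?_⟩
  have hξρ : ‖ξ‖ < ρ := hξ.trans_le (min_le_left _ _)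
  have hξ1 : ‖ξ‖ ≤ 1 := (hξ.trans_le ((min_le_right _ _).trans (min_le_left _ _))).le
  have hξε : K * Real.exp β * ‖ξ‖ < ε := by
    have h1 : ‖ξ‖ < ε / (K * Real.exp β + 1) :=
      hξ.trans_le ((min_le_right _ _).trans (min_le_right _ _))
    rw [lt_div_iff₀ hM] at h1
    nlinarith [norm_nonneg ξ]
  have hsub := forwardWedge_subset_wedgeNhd hν hνν'
  have hN : ∀ s ∈ wedgeNhd ν', ‖g (V ξ s) - A (V ξ s)‖ ≤
      D * Real.exp (-(2 * β) * s.re) * ‖ξ‖ := by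
    intro s hs
    have h1 := hquad (V ξ s) ((hV.norm_le hξρ hs).trans_lt hξε)
    have h2 := hV.decay ξ hξρ s hs
    calc _ ≤ c * (K * Real.exp (-β * s.re) * ‖ξ‖) ^ 2 :=
          h1.trans (mul_le_mul_of_nonneg_left (pow_le_pow_left₀ (norm_nonneg _) h2 2) hc)
      _ = D * (Real.exp (-β * s.re) * Real.exp (-β * s.re)) * ‖ξ‖ * ‖ξ‖ := by rw [hD]; ring
      _ = D * Real.exp (-(2 * β) * s.re) * ‖ξ‖ * ‖ξ‖ := by rw [← Real.exp_add]; ring_nf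
      _ ≤ _ := mul_le_of_le_one_right (by positivity) hξ1
  have ht0 : 0 ≤ t.re := ht.1
  have htD := hsub ht
  have h0D := zero_mem_wedgeNhd hB.opening_pos
  have hstar : ∀ s ∈ Icc (0 : ℝ) 1, (s : ℂ) * t ∈ wedgeNhd ν' := fun s hs =>
    mul_mem_wedgeNhd hB.opening_pos htD hs
  have hcomm : Commute (stableProjL A) A := commute_spectralProjL A _
  have hwedge : ∀ s ∈ Icc (0 : ℝ) 1, (s : ℂ) * t ∈ forwardWedge 0 ν := by
    intro s hs
    have h2 : |t.im| ≤ ν * |t.re| := by simpa using ht.2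
    refine ⟨by rw [Complex.re_ofReal_mul]; exact mul_nonneg hs.1 ht0, ?_⟩
    rw [Complex.re_ofReal_mul, Complex.im_ofReal_mul, sub_zero, abs_mul, abs_mul]
    nlinarith [mul_le_mul_of_nonneg_left h2 (abs_nonneg s)]
  -- At each point of the segment the propagator of rate η₁ and the forcing of rate 2β ≥ η₁ combine
  -- to at most e^{-η₁ Re t}; a constant majorant of the derivative suffices.
  set b' := ‖t‖ * (C₁ * D * Real.exp (-η₁ * t.re) * ‖ξ‖) with hb'
  have hst := norm_apply_one_le hcomm (c := t) (y := fun s : ℝ => V ξ (s * t))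
    (h := fun s : ℝ => g (V ξ (s * t)) - A (V ξ (s * t))) (b := fun s => b' * s) (b' := fun _ => b')
    (fun s hs => by
      have h2 : HasDerivAt (fun s : ℝ => (s : ℂ) * t) t s := by
        simpa using (hasDerivAt_id s).ofReal_comp.mul_const t
      refine (((hV.deriv ξ hξρ _ (hstar s hs)).scomp s h2).hasDerivWithinAt).congr_deriv ?_
      rw [add_sub_cancel])
    (fun s => by simpa using (hasDerivAt_id s).const_mul b')
    (fun s hs => by
      have hs' : 1 - s ∈ Icc (0 : ℝ) 1 := ⟨by linarith [hs.2], by linarith [hs.1]⟩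
      have h1 := hS _ (hwedge _ hs') (g (V ξ (s * t)) - A (V ξ (s * t)))
      have h2 := hN _ (hstar s hs)
      rw [Complex.re_ofReal_mul] at h1 h2
      refine mul_le_mul_of_nonneg_left (h1.trans ?_) (norm_nonneg _)
      calc _ ≤ C₁ * Real.exp (-η₁ * ((1 - s) * t.re)) *
            (D * Real.exp (-(2 * β) * (s * t.re)) * ‖ξ‖) :=
            mul_le_mul_of_nonneg_left h2 (by positivity)
        _ = C₁ * D * (Real.exp (-η₁ * ((1 - s) * t.re)) *
            Real.exp (-(2 * β) * (s * t.re))) * ‖ξ‖ := by ring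
        _ ≤ C₁ * D * Real.exp (-η₁ * t.re) * ‖ξ‖ := by
          rw [← Real.exp_add]
          gcongr
          have h3 : η₁ ≤ 2 * β := by rw [hη₁]; linarith
          have h4 : 0 ≤ s * t.re := mul_nonneg hs.1 ht0
          nlinarith)
  -- Without the weight the backward propagator may grow like e^{(β-a)x}, but the quadratic forcing
  -- contributes e^{-2βx}, so the product decays at rate β + a.
  have hun := norm_apply_zero_le (A := A) (Q := 1 - stableProjL A)
    (H := C * D * Real.exp (-(2 * β) * t.re) * ‖ξ‖) (a := β + a)
    ((Commute.one_left A).sub_left hcomm) (by positivity) (y := fun x : ℝ => V ξ (t + x))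
    (h := fun x : ℝ => g (V ξ (t + x)) - A (V ξ (t + x)))
    (fun x hx => (hV.hasDerivWithinAt hξρ (add_mem_wedgeNhd hB.opening_pos htD hx) _).congr_deriv
      (by rw [add_sub_cancel]))
    (fun x hx => by
      have hx0 : 0 ≤ x := hx
      have h1 := hB.unstable x hx (g (V ξ (t + x)) - A (V ξ (t + x)))
      rw [norm_exp_smul_add_smul_one_apply] at h1
      have hre : (-x : ℂ).re = -x := by simp
      rw [hre] at h1
      have h2 := hN _ (add_mem_wedgeNhd hB.opening_pos htD hx)
      have hre2 : (t + (x : ℂ)).re = t.re + x := by simp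
      rw [hre2] at h2
      have h3 : ‖NormedSpace.exp ((-x : ℂ) • A)
          ((1 - stableProjL A) (g (V ξ (t + x)) - A (V ξ (t + x))))‖ =
          Real.exp (β * x) * (Real.exp (β * -x) * ‖NormedSpace.exp ((-x : ℂ) • A)
          ((1 - stableProjL A) (g (V ξ (t + x)) - A (V ξ (t + x))))‖) := by
        rw [← mul_assoc, ← Real.exp_add]; simp
      rw [h3]
      calc _ ≤ Real.exp (β * x) * (C * Real.exp (-a * x) *
            (D * Real.exp (-(2 * β) * (t.re + x)) * ‖ξ‖)) :=
            mul_le_mul_of_nonneg_left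
              (h1.trans (mul_le_mul_of_nonneg_left h2 (by positivity))) (Real.exp_pos _).le
        _ = C * D * ‖ξ‖ * (Real.exp (β * x) * Real.exp (-a * x) *
            Real.exp (-(2 * β) * (t.re + x))) := by ring
        _ = C * D * ‖ξ‖ * (Real.exp (-(2 * β) * t.re) * Real.exp (-(β + a) * x)) := by
          rw [← Real.exp_add, ← Real.exp_add, ← Real.exp_add]; ring_nf
        _ = _ := by ring)
    (by
      have hexp0 : Tendsto (fun x : ℝ => Real.exp (-a * x)) atTop (𝓝 0) :=
        Real.tendsto_exp_atBot.comp ((tendsto_const_mul_atBot_of_neg (by linarith)).2 tendsto_id)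
      have hz : Tendsto (fun x : ℝ => C * K * ‖ξ‖ * Real.exp (-β * t.re) * Real.exp (-a * x))
          atTop (𝓝 0) := by simpa using hexp0.const_mul (C * K * ‖ξ‖ * Real.exp (-β * t.re))
      refine squeeze_zero_norm' (eventually_atTop.2 ⟨0, fun x hx => ?_⟩) hz
      have h1 := hB.unstable x hx (V ξ (t + x))
      rw [norm_exp_smul_add_smul_one_apply] at h1
      have hre : (-x : ℂ).re = -x := by simp
      rw [hre] at h1
      have h2 := hV.decay ξ hξρ _ (add_mem_wedgeNhd hB.opening_pos htD hx)
      have hre2 : (t + (x : ℂ)).re = t.re + x := by simp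
      rw [hre2] at h2
      have h3 : ‖NormedSpace.exp ((-x : ℂ) • A) ((1 - stableProjL A) (V ξ (t + x)))‖ =
          Real.exp (β * x) * (Real.exp (β * -x) * ‖NormedSpace.exp ((-x : ℂ) • A)
          ((1 - stableProjL A) (V ξ (t + x)))‖) := by
        rw [← mul_assoc, ← Real.exp_add]; simp
      rw [h3]
      calc _ ≤ Real.exp (β * x) * (C * Real.exp (-a * x) *
            (K * Real.exp (-β * (t.re + x)) * ‖ξ‖)) :=
            mul_le_mul_of_nonneg_left
              (h1.trans (mul_le_mul_of_nonneg_left h2 (by positivity))) (Real.exp_pos _).le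
        _ = C * K * ‖ξ‖ * (Real.exp (β * x) * Real.exp (-β * (t.re + x))) *
            Real.exp (-a * x) := by ring
        _ = C * K * ‖ξ‖ * Real.exp (-β * t.re) * Real.exp (-a * x) := by
          rw [← Real.exp_add]; ring_nf)
  simp only [Complex.ofReal_one, one_mul, Complex.ofReal_zero, zero_mul, add_zero, mul_one,
    mul_zero, sub_zero] at hst hun
  have e1 : ‖NormedSpace.exp (t • A) (stableProjL A (V ξ 0))‖ ≤
      C₁ * K * Real.exp (-η' * t.re) * ‖ξ‖ := by
    have h1 := hS t ht (V ξ 0)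
    have h2 : ‖V ξ 0‖ ≤ K * ‖ξ‖ := by simpa using hV.decay ξ hξρ 0 h0D
    calc _ ≤ C₁ * Real.exp (-η' * t.re) * (K * ‖ξ‖) := by
          refine h1.trans (mul_le_mul ?_ h2 (norm_nonneg _) (by positivity))
          gcongr
          linarith
      _ = _ := by ring
  have e2 : b' ≤ (1 + ν) * C₁ * D / (η₁ - η') * Real.exp (-η' * t.re) * ‖ξ‖ := by
    have h1 : ‖t‖ ≤ (1 + ν) * t.re := by
      have := norm_le_of_abs_im_le (t := t) (ν := ν) (by simpa using ht.2)
      rwa [abs_of_nonneg ht0] at this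
    have h2 : t.re * Real.exp (-η₁ * t.re) ≤ Real.exp (-η' * t.re) / (η₁ - η') := by
      rw [le_div_iff₀ hη₁']
      have h3 : (η₁ - η') * t.re ≤ Real.exp ((η₁ - η') * t.re) := by
        linarith [Real.add_one_le_exp ((η₁ - η') * t.re)]
      calc _ = ((η₁ - η') * t.re) * Real.exp (-η₁ * t.re) := by ring
        _ ≤ Real.exp ((η₁ - η') * t.re) * Real.exp (-η₁ * t.re) :=
          mul_le_mul_of_nonneg_right h3 (Real.exp_pos _).le
        _ = _ := by rw [← Real.exp_add]; ring_nf
    calc b' ≤ ((1 + ν) * t.re) * (C₁ * D * Real.exp (-η₁ * t.re) * ‖ξ‖) :=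
          mul_le_mul_of_nonneg_right h1 (by positivity)
      _ = (1 + ν) * C₁ * D * ‖ξ‖ * (t.re * Real.exp (-η₁ * t.re)) := by ring
      _ ≤ (1 + ν) * C₁ * D * ‖ξ‖ * (Real.exp (-η' * t.re) / (η₁ - η')) :=
          mul_le_mul_of_nonneg_left h2 (by positivity)
      _ = _ := by ring
  have e3 : C * D * Real.exp (-(2 * β) * t.re) * ‖ξ‖ / (β + a) ≤
      C * D / (β + a) * Real.exp (-η' * t.re) * ‖ξ‖ := by
    rw [mul_div_right_comm, mul_div_right_comm]
    gcongr
    linarith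
  calc ‖V ξ t‖ ≤ ‖stableProjL A (V ξ t)‖ + ‖V ξ t - stableProjL A (V ξ t)‖ :=
        norm_le_norm_add_norm_sub' _ _
    _ ≤ _ := by
      have h5 : ‖V ξ t - stableProjL A (V ξ t)‖ ≤
          C * D * Real.exp (-(2 * β) * t.re) * ‖ξ‖ / (β + a) := hun
      rw [add_mul, add_mul, add_mul, add_mul]
      linarith

/-- Existence of the analytic family of decaying solutions in a wedge. -/
theorem exists_isSolutionFamily (hg : AnalyticAt ℂ g 0) (hg0 : g 0 = 0)
    (hg1 : HasFDerivAt g A 0) {η ν : ℝ} (hA : IsStableCone A η ν) (hν : 0 < ν) (hη : 0 < η) :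
    ∃ (V : Cn n → ℂ → Cn n) (ν' ρ K : ℝ), ν ≤ ν' ∧ 0 < ρ ∧
      IsSolutionFamily g (stableProjL A) V ν' (3 * η / 4) ρ K ∧
      AnalyticOnNhd ℂ (fun ξ => V ξ 0) (Metric.ball 0 ρ) ∧
      HasFDerivAt (fun ξ => V ξ 0) (stableProjL A) 0 ∧
      ∀ η' < η, ∃ C', 0 ≤ C' ∧ ∀ ξ, ‖ξ‖ < ρ → ∀ t ∈ forwardWedge 0 ν,
        ‖V ξ t‖ ≤ C' * Real.exp (-η' * t.re) * ‖ξ‖ := by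
  -- Any rate in [η/2, η) would do: below η for the dichotomy, at least η/2 for the quadratic
  -- improvement.
  have hβ : 0 < 3 * η / 4 := by positivity
  obtain ⟨ν', C, a, hνν', hB⟩ := hA.exists_isDichotomy hν hβ.le (by linarith) (Or.inl hβ)
  obtain ⟨V, ρ, K, hρ, hK, h1, h2, h3, h4, h5⟩ := hB.exists_family hβ.le
    (N := fun y => g y - A y) (hg.sub (A.analyticAt 0)) (by simp [hg0])
    (hasFDerivAt_sub_linear hg1)
  have hV : IsSolutionFamily g (stableProjL A) V ν' (3 * η / 4) ρ K :=
    ⟨hB.opening_pos, hβ.le, hK, fun ξ hξ t ht => by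
      have := h1 ξ hξ t ht
      rwa [add_sub_cancel] at this, h2, h3⟩
  obtain ⟨r, hr, hsharp⟩ := hV.exists_sharp_decay hg hg0 hg1 hA hν hνν' hB (by linarith) hρ
  refine ⟨V, ν', min ρ r, K, hνν', lt_min hρ hr, hV.mono (min_le_left _ _),
    h4.mono (Metric.ball_subset_ball (min_le_left _ _)), h5, fun η' hη' => ?_⟩
  obtain ⟨C', hC', h6⟩ := hsharp η' hη'
  exact ⟨C', hC', fun ξ hξ => h6 ξ (hξ.trans_le (min_le_right _ _))⟩

end Families

/-! ### The local manifold: invariance, uniqueness and extension to wedges -/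

section Manifold

variable {n : ℕ}

/-- A set invariant under the equation, given as the graph of the family `V` over `|P y| < R`,
in a ball of radius `ε` where the equation is Lipschitz. -/
structure IsLocalManifold (g : Cn n → Cn n) (P : Cn n →L[ℂ] Cn n) (V : Cn n → ℂ → Cn n)
    (ν β ρ K R ε : ℝ) : Prop where
  family : IsSolutionFamily g P V ν β ρ K
  idem : ∀ v, P (P v) = P v
  pos : 0 < R
  le : R ≤ ρ
  eps_pos : 0 < ε
  small : ∀ ξ, ‖ξ‖ < R → ∀ t ∈ wedgeNhd ν, ‖V ξ t‖ < ε
  lipschitz : ∃ L, LipschitzOnWith L g (Metric.ball 0 ε)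
  restart : ∀ ξ, ‖ξ‖ < R → ∀ t ∈ wedgeNhd ν, V ξ t = V (P (V ξ t)) 0

/-- Membership in the graph of the family `V` over `|P y| < R`. -/
def OnGraph (P : Cn n →L[ℂ] Cn n) (V : Cn n → ℂ → Cn n) (R : ℝ) (y : Cn n) : Prop :=
  ‖P y‖ < R ∧ y = V (P y) 0

variable {g : Cn n → Cn n} {P : Cn n →L[ℂ] Cn n} {V : Cn n → ℂ → Cn n} {ν β ρ K R ε : ℝ}

theorem exists_mul_norm_lt {M s : ℝ} (hM : 0 ≤ M) (hs : 0 < s) :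
    ∃ r > 0, ∀ x : Cn n, ‖x‖ < r → M * ‖x‖ < s := by
  refine ⟨s / (M + 1), by positivity, fun x hx => ?_⟩
  rw [lt_div_iff₀ (by positivity)] at hx
  nlinarith [norm_nonneg x]

namespace IsLocalManifold

/-- `y` and the orbit of the family through y(0) solve the same Lipschitz equation on the segment,
hence agree, and `restart` puts the endpoint back on the graph. -/
theorem onGraph_of_segment (h : IsLocalManifold g P V ν β ρ K R ε) {c : ℂ} (hc : c ∈ wedgeNhd ν)
    {y : ℝ → Cn n} (hy : ∀ s ∈ Icc (0 : ℝ) 1, HasDerivWithinAt y (c • g (y s)) (Icc 0 1) s)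
    (hyε : ∀ s ∈ Icc (0 : ℝ) 1, ‖y s‖ < ε) (h0 : OnGraph P V R (y 0)) (h1 : ‖P (y 1)‖ < R) :
    OnGraph P V R (y 1) := by
  obtain ⟨L, hL⟩ := h.lipschitz
  have hstar : ∀ s ∈ Icc (0 : ℝ) 1, (s : ℂ) * c ∈ wedgeNhd ν := fun s hs =>
    mul_mem_wedgeNhd h.family.opening_pos hc hs
  have hL' : LipschitzOnWith (‖c‖₊ * L) (fun y => c • g y) (Metric.ball 0 ε) := by
    refine LipschitzOnWith.of_dist_le_mul fun x hx z hz => ?_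
    rw [dist_smul₀, NNReal.coe_mul, mul_assoc]
    exact mul_le_mul_of_nonneg_left (hL.dist_le_mul x hx z hz) (norm_nonneg _)
  set ξ := P (y 0) with hξ
  have hξρ : ‖ξ‖ < ρ := h0.1.trans_le h.le
  have hV : ∀ s ∈ Icc (0 : ℝ) 1, HasDerivWithinAt (fun s : ℝ => V ξ (s * c))
      (c • g (V ξ (s * c))) (Icc 0 1) s := fun s hs => by
    have h2 : HasDerivAt (fun s : ℝ => (s : ℂ) * c) c s := by
      simpa using (hasDerivAt_id s).ofReal_comp.mul_const c
    exact ((h.family.deriv ξ hξρ _ (hstar s hs)).scomp s h2).hasDerivWithinAt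
  have hIci : ∀ s ∈ Ico (0 : ℝ) 1, Icc (0 : ℝ) 1 ∈ 𝓝[Ici s] s := fun s hs =>
    Icc_mem_nhdsGE_of_mem hs
  have key := ODE_solution_unique_of_mem_Icc_right (v := fun _ y => c • g y)
    (s := fun _ => Metric.ball 0 ε) (fun _ _ => hL')
    (fun s hs => (hy s hs).continuousWithinAt)
    (fun s hs => (hy s ⟨hs.1, hs.2.le⟩).mono_of_mem_nhdsWithin (hIci s hs))
    (fun s hs => by simpa using hyε s ⟨hs.1, hs.2.le⟩)
    (fun s hs => (hV s hs).continuousWithinAt)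
    (fun s hs => (hV s ⟨hs.1, hs.2.le⟩).mono_of_mem_nhdsWithin (hIci s hs))
    (fun s hs => by simpa using h.small ξ h0.1 _ (hstar s ⟨hs.1, hs.2.le⟩))
    (by simpa using h0.2) (right_mem_Icc.2 zero_le_one)
  simp only [Complex.ofReal_one, one_mul] at key
  refine ⟨h1, ?_⟩
  rw [key]
  exact h.restart ξ h0.1 c hc

/-- Backward invariance along real solutions. -/
theorem onGraph_zero (h : IsLocalManifold g P V ν β ρ K R ε) {z : ℝ → Cn n}
    (hz : IsHalfLineSolution g z) (hzε : ∀ x ∈ Ici (0 : ℝ), ‖z x‖ < ε)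
    (hzR : ∀ x ∈ Ici (0 : ℝ), ‖P (z x)‖ < R) (k : ℕ) (hk : OnGraph P V R (z (k / 2))) :
    OnGraph P V R (z 0) := by
  induction k with
  | zero => simpa using hk
  | succ k ih =>
    refine ih ?_
    have hk0 : (0 : ℝ) ≤ k / 2 := by positivity
    have hmaps : MapsTo (fun s : ℝ => ((k : ℝ) + 1) / 2 - s / 2) (Icc 0 1) (Ici 0) := by
      intro s hs
      simp only [mem_Ici]
      have := hs.2
      linarith
    -- A step backward in time: -1/2 is in the domain of the family, whose vertex is -1.
    have := h.onGraph_of_segment (c := ((-1 / 2 : ℝ) : ℂ))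
      (ofReal_mem_wedgeNhd h.family.opening_pos (by norm_num))
      (y := fun s => z (((k : ℝ) + 1) / 2 - s / 2))
      (fun s hs => by
        have h2 : HasDerivWithinAt (fun s : ℝ => ((k : ℝ) + 1) / 2 - s / 2) (-1 / 2) (Icc 0 1) s :=
          ((((hasDerivAt_id s).div_const 2).const_sub _).congr_deriv (by ring)).hasDerivWithinAt
        have := (hz _ (hmaps hs)).scomp s h2 hmaps
        exact this.congr_deriv (Complex.coe_smul _ _).symm)
      (fun s hs => hzε _ (hmaps hs)) (by simpa using hk)
      (hzR _ (hmaps (right_mem_Icc.2 zero_le_one)))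
    have e : ((k : ℝ) + 1) / 2 - 1 / 2 = k / 2 := by ring
    rwa [e] at this

/-- Local invariance under the complex-time flow. -/
theorem invariant (h : IsLocalManifold g P V ν β ρ K R ε)
    (hV0 : ContinuousOn (fun ξ => V ξ 0) (Metric.ball 0 ρ)) {D : Set ℂ} {u : ℂ → Cn n}
    (hD : IsOpen D) (hD' : IsPreconnected D) (hu : ∀ t ∈ D, HasDerivAt u (g (u t)) t)
    (huR : ∀ t ∈ D, ‖P (u t)‖ < R) (hex : ∃ t ∈ D, OnGraph P V R (u t)) :
    ∀ t ∈ D, OnGraph P V R (u t) := by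
  obtain ⟨t₁, ht₁, ht₁'⟩ := hex
  set W : Set ℂ := {t | t ∈ D ∧ OnGraph P V R (u t)} with hW
  -- Near a graph point `u` stays in the ball where the equation is Lipschitz, and nearby times are
  -- reached along segments.
  have hWo : IsOpen W := by
    rw [isOpen_iff_mem_nhds]
    rintro t₀ ⟨ht₀, hg₀⟩
    have hε₀ : ‖u t₀‖ < ε := by
      rw [hg₀.2]; exact h.small _ hg₀.1 0 (zero_mem_wedgeNhd h.family.opening_pos)
    have hev : ∀ᶠ t in 𝓝 t₀, t ∈ D ∧ ‖u t‖ < ε :=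
      (show ∀ᶠ t in 𝓝 t₀, t ∈ D from hD.mem_nhds ht₀).and ((hu t₀ ht₀).continuousAt.norm.eventually_lt_const hε₀)
    have hev2 : ∀ᶠ t in 𝓝 t₀, t - t₀ ∈ wedgeNhd ν := by
      have : Tendsto (fun t => t - t₀) (𝓝 t₀) (𝓝 0) := by
        have := (continuous_sub_right t₀).tendsto t₀
        rwa [sub_self] at this
      exact this.eventually ((isOpen_wedgeNhd ν).mem_nhds (zero_mem_wedgeNhd h.family.opening_pos))
    obtain ⟨r, hr, hball⟩ := Metric.eventually_nhds_iff_ball.1 hev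
    filter_upwards [hev2, Metric.ball_mem_nhds t₀ hr] with t ht2 htr
    have hseg : ∀ s ∈ Icc (0 : ℝ) 1, t₀ + s * (t - t₀) ∈ Metric.ball t₀ r := by
      intro s hs
      rw [mem_ball_iff_norm, add_sub_cancel_left, norm_mul, Complex.norm_real, Real.norm_eq_abs,
        abs_of_nonneg hs.1]
      rw [mem_ball_iff_norm] at htr
      exact (mul_le_of_le_one_left (norm_nonneg _) hs.2).trans_lt htr
    refine ⟨(hball t htr).1, ?_⟩
    have := h.onGraph_of_segment ht2 (y := fun s : ℝ => u (t₀ + s * (t - t₀)))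
      (fun s hs => by
        have h2 : HasDerivAt (fun s : ℝ => t₀ + (s : ℂ) * (t - t₀)) (t - t₀) s := by
          simpa using ((hasDerivAt_id s).ofReal_comp.mul_const (t - t₀)).const_add t₀
        exact ((hu _ (hball _ (hseg s hs)).1).scomp s h2).hasDerivWithinAt)
      (fun s hs => (hball _ (hseg s hs)).2) (by simpa using hg₀)
      (by simpa using huR t (hball t htr).1)
    simpa using this
  -- The set is also relatively closed: the graph equation passes to limits by continuity, and |P u|
  -- < R is assumed on all of `D`.
  have hsub := hD'.subset_of_closure_inter_subset hWo ⟨t₁, ht₁, ht₁, ht₁'⟩ (by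
    rintro t ⟨htc, htD⟩
    refine ⟨htD, huR t htD, ?_⟩
    have hc := (hu t htD).continuousAt
    have hmem : P (u t) ∈ Metric.ball (0 : Cn n) ρ := by
      simpa using (huR t htD).trans_le h.le
    have hc2 : ContinuousAt (fun t => V (P (u t)) 0) t :=
      ContinuousAt.comp (g := fun ξ => V ξ 0) (f := fun t => P (u t))
        (hV0.continuousAt (Metric.isOpen_ball.mem_nhds hmem)) (P.continuous.continuousAt.comp hc)
    exact tendsto_nhds_unique_of_frequently_eq hc.tendsto hc2.tendsto
      ((mem_closure_iff_frequently.1 htc).mono fun s hs => hs.2.2))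
  exact fun t ht => (hsub ht).2

end IsLocalManifold

/-- A solution on the half-line tending to `0` at a rate for which uniqueness holds eventually
belongs to the family. -/
theorem IsSolutionFamily.eventually_eq (h : IsSolutionFamily g P V ν β ρ K)
    (hP : ∀ v, P (P v) = P v) (hρ : 0 < ρ) {β₁ ε₁ : ℝ} (hε₁ : 0 < ε₁)
    (hε : IsUniquenessRadius g P β₁ ε₁) (hββ : β₁ ≤ β) {z : ℝ → Cn n}
    (hz : IsHalfLineSolution g z) (hz0 : Tendsto z atTop (𝓝 0)) {K₁ : ℝ}
    (hzK : ∀ᶠ x in atTop, ‖z x‖ ≤ K₁ * Real.exp (-β₁ * x)) {r : ℝ} (hr : 0 < r) :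
    ∀ᶠ T in atTop, ‖P (z T)‖ < ρ ∧ ‖P (z T)‖ < r ∧
      ∀ x ∈ Ici (0 : ℝ), z (T + x) = V (P (z T)) x := by
  have hPz : Tendsto (fun x => ‖P (z x)‖) atTop (𝓝 0) := by
    have := ((P.continuous.tendsto 0).comp hz0).norm
    simpa using this
  have hKz : Tendsto (fun x => K * Real.exp β * ‖P (z x)‖) atTop (𝓝 0) := by
    simpa using hPz.const_mul (K * Real.exp β)
  have hzn : ∀ᶠ x in atTop, ‖z x‖ < ε₁ := by
    have := hz0.norm
    rw [norm_zero] at this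
    exact this.eventually_lt_const hε₁
  filter_upwards [hPz.eventually_lt_const hρ, hPz.eventually_lt_const hr,
    hKz.eventually_lt_const hε₁, eventually_forall_ge_atTop.2 hzn,
    eventually_forall_ge_atTop.2 hzK, eventually_ge_atTop 0] with T h1 h2 h3 h4 h5 h6
  refine ⟨h1, h2, fun x hx => ?_⟩
  have hmaps : MapsTo (fun s : ℝ => T + s) (Ici 0) (Ici 0) :=
    fun s hs => add_nonneg h6 (mem_Ici.1 hs)
  have := h.eq_of_isHalfLineSolution hP hε hββ (z := fun x => z (T + x))
    (K₁ := K₁ * Real.exp (-β₁ * T))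
    (fun x hx => by
      have h2 : HasDerivWithinAt (fun s : ℝ => T + s) 1 (Ici 0) x :=
        ((hasDerivAt_id x).const_add T).hasDerivWithinAt
      exact ((hz _ (hmaps hx)).scomp x h2 hmaps).congr_deriv (one_smul _ _))
    (fun x hx => h4 _ (le_add_of_nonneg_right hx))
    (fun x hx => (h5 _ (le_add_of_nonneg_right hx)).trans (by
      rw [mul_add, Real.exp_add, mul_assoc]))
    (by simpa using h1) (by simpa using h3) x hx
  simpa using this

theorem tendsto_zero_of_exp_bound {z : ℝ → Cn n} {K₁ β' : ℝ} (hβ' : 0 < β')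
    (hzK : ∀ᶠ x in atTop, ‖z x‖ ≤ K₁ * Real.exp (-β' * x)) : Tendsto z atTop (𝓝 0) := by
  have h1 : Tendsto (fun x : ℝ => K₁ * Real.exp (-β' * x)) atTop (𝓝 0) := by
    have h2 : Tendsto (fun x : ℝ => Real.exp (-β' * x)) atTop (𝓝 0) :=
      Real.tendsto_exp_atBot.comp ((tendsto_const_mul_atBot_of_neg (by linarith)).2 tendsto_id)
    simpa using h2.const_mul K₁
  exact squeeze_zero_norm' hzK h1

theorem eventually_exp_bound_mono {z : ℝ → Cn n} {K₁ β' β₁ : ℝ} (hβ : β₁ ≤ β')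
    (hzK : ∀ᶠ x in atTop, ‖z x‖ ≤ K₁ * Real.exp (-β' * x)) :
    ∀ᶠ x in atTop, ‖z x‖ ≤ |K₁| * Real.exp (-β₁ * x) := by
  filter_upwards [hzK, eventually_ge_atTop 0] with x hx hx0
  refine hx.trans (mul_le_mul (le_abs_self _) (Real.exp_le_exp.2 ?_) (Real.exp_pos _).le
    (abs_nonneg _))
  nlinarith

/-- A small solution on the half-line decaying exponentially starts on the manifold. -/
theorem IsLocalManifold.onGraph_of_decay (h : IsLocalManifold g P V ν β ρ K R ε)
    (hβ : 0 < β)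
    (huniq : ∀ β₁, 0 < β₁ → β₁ ≤ β → ∃ ε₁ > 0, IsUniquenessRadius g P β₁ ε₁)
    {z : ℝ → Cn n} (hz : IsHalfLineSolution g z) (hzε : ∀ x ∈ Ici (0 : ℝ), ‖z x‖ < ε)
    (hzR : ∀ x ∈ Ici (0 : ℝ), ‖P (z x)‖ < R) {K₁ β' : ℝ} (hβ' : 0 < β')
    (hzK : ∀ x ∈ Ici (0 : ℝ), ‖z x‖ ≤ K₁ * Real.exp (-β' * x)) : OnGraph P V R (z 0) := by
  have hzK' : ∀ᶠ x in atTop, ‖z x‖ ≤ K₁ * Real.exp (-β' * x) :=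
    eventually_atTop.2 ⟨0, hzK⟩
  -- Uniqueness is used at the slower of the two rates, which both the given solution and the family
  -- satisfy.
  obtain ⟨ε₁, hε₁, hU⟩ := huniq (min β β') (lt_min hβ hβ') (min_le_left _ _)
  have hev := h.family.eventually_eq h.idem (h.pos.trans_le h.le) hε₁ hU (min_le_left _ _) hz
    (tendsto_zero_of_exp_bound hβ' hzK')
    (eventually_exp_bound_mono (min_le_right _ _) hzK') one_pos
  have hk : Tendsto (fun k : ℕ => (k : ℝ) / 2) atTop atTop :=
    tendsto_natCast_atTop_atTop.atTop_div_const two_pos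
  -- The time of arrival on the graph is taken in ℕ/2, so backward steps of length 1/2 end exactly
  -- at 0.
  obtain ⟨k, hk⟩ := (hk.eventually hev).exists
  refine h.onGraph_zero hz hzε hzR k ⟨hzR _ (by simp only [mem_Ici]; positivity), ?_⟩
  have := hk.2.2 0 self_mem_Ici
  simpa using this

variable {A : Cn n →L[ℂ] Cn n}

theorem IsStableCone.exists_uniqueness (hg : AnalyticAt ℂ g 0) (hg1 : HasFDerivAt g A 0)
    {η ν : ℝ} (hA : IsStableCone A η ν) (hν : 0 < ν) :
    ∀ β₁, 0 < β₁ → β₁ < η → ∃ ε₁ > 0, IsUniquenessRadius g (stableProjL A) β₁ ε₁ :=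
  fun _ h1 h2 => exists_isUniquenessRadius hg hg1 hA hν h1.le h2 (Or.inl h1)

/-- Existence of the local stable manifold, for an equation with equilibrium `0`. -/
theorem exists_isLocalManifold (hg : AnalyticAt ℂ g 0) (hg0 : g 0 = 0)
    (hg1 : HasFDerivAt g A 0) {W : Set (Cn n)} (hW : W ∈ 𝓝 0) :
    ∃ (V : Cn n → ℂ → Cn n) (ν β ρ K R ε : ℝ), 0 < β ∧ Metric.ball 0 ε ⊆ W ∧
      IsLocalManifold g (stableProjL A) V ν β ρ K R ε ∧
      AnalyticOnNhd ℂ (fun ξ => V ξ 0) (Metric.ball 0 ρ) ∧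
      HasFDerivAt (fun ξ => V ξ 0) (stableProjL A) 0 ∧
      ∀ β₁, 0 < β₁ → β₁ ≤ β → ∃ ε₁ > 0, IsUniquenessRadius g (stableProjL A) β₁ ε₁ := by
  obtain ⟨η, ν, hη, hν, hA⟩ := exists_isStableCone A
  obtain ⟨V, ν', ρ, K, -, hρ, hV, han, htan, -⟩ := exists_isSolutionFamily hg hg0 hg1 hA hν hη
  set P := stableProjL A with hP
  have hβ : 0 < 3 * η / 4 := by positivity
  have huniq := hA.exists_uniqueness hg hg1 hν
  obtain ⟨ε₀, hε₀, hU⟩ := huniq (3 * η / 4) hβ (by linarith)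
  obtain ⟨L, s, hs, hL⟩ := hg.hasStrictFDerivAt.exists_lipschitzOnWith
  obtain ⟨ε₂, hε₂, hball⟩ := Metric.mem_nhds_iff.1 (inter_mem hs hW)
  set ε := min ε₀ ε₂ with hε
  have hε0 : 0 < ε := lt_min hε₀ hε₂
  have hK := hV.const_nonneg
  obtain ⟨r₁, hr₁, h1⟩ := exists_mul_norm_lt (n := n) (M := K * Real.exp (3 * η / 4))
    (by positivity) hε0
  obtain ⟨r₂, hr₂, h2⟩ := exists_mul_norm_lt (n := n)
    (M := ‖P‖ * (K * Real.exp (3 * η / 4))) (by positivity) (lt_min hρ hr₁)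
  -- `r₁` keeps the orbits small; `r₂` keeps their stable components within `ρ` and `r₁`, so the
  -- family can be restarted from any of their points.
  set R := min ρ (min r₁ r₂) with hR
  have hR0 : 0 < R := by positivity
  have hsmall : ∀ ξ, ‖ξ‖ < R → ∀ t ∈ wedgeNhd ν', ‖V ξ t‖ < ε := fun ξ hξ t ht =>
    (hV.norm_le (hξ.trans_le (min_le_left _ _)) ht).trans_lt
      (h1 ξ (hξ.trans_le ((min_le_right _ _).trans (min_le_left _ _))))
  refine ⟨V, ν', 3 * η / 4, ρ, K, R, ε, hβ, ?_, ⟨hV, stableProjL_idem, hR0, min_le_left _ _, hε0,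
    hsmall, ?_, ?_⟩, han, htan, fun β₁ hb1 hb2 => huniq β₁ hb1 (by linarith)⟩
  · exact fun y hy => (hball (Metric.ball_subset_ball (min_le_right _ _) hy)).2
  · exact ⟨L, hL.mono fun y hy =>
      (hball (Metric.ball_subset_ball (min_le_right _ _) hy)).1⟩
  · intro ξ hξ t ht
    have hξρ : ‖ξ‖ < ρ := hξ.trans_le (min_le_left _ _)
    have h3 : ‖P (V ξ t)‖ < min ρ r₁ :=
      ((P.le_opNorm _).trans (mul_le_mul_of_nonneg_left (hV.norm_le hξρ ht)
        (norm_nonneg _))).trans_lt (by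
          rw [← mul_assoc]
          exact h2 ξ (hξ.trans_le ((min_le_right _ _).trans (min_le_right _ _))))
    -- The orbit translated to start at time `t` is again a small decaying solution, so it is the
    -- member of the family with its own stable component.
    have := hV.eq_of_isHalfLineSolution stableProjL_idem hU le_rfl
      (hV.isHalfLineSolution hξρ ht) (K₁ := K * Real.exp (-(3 * η / 4) * t.re) * ‖ξ‖)
      (fun x hx => (hsmall ξ hξ _ (add_mem_wedgeNhd hV.opening_pos ht hx)).trans_le
        (min_le_left _ _))
      (fun x hx => by
        refine (hV.decay ξ hξρ _ (add_mem_wedgeNhd hV.opening_pos ht hx)).trans (le_of_eq ?_)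
        have hre : (t + (x : ℂ)).re = t.re + x := by simp
        rw [hre, mul_add, Real.exp_add]
        ring)
      (by simpa using h3.trans_le (min_le_left _ _))
      (by simpa using (h1 _ (h3.trans_le (min_le_right _ _))).trans_le (min_le_left _ _))
      0 self_mem_Ici
    simpa using this

/-- The solutions through points of the manifold extend to every wedge allowed by the stable
eigenvalues. -/
theorem IsLocalManifold.exists_wedge_solution (hM : IsLocalManifold g (stableProjL A) V ν β ρ K R ε)
    (hβ : 0 < β)
    (huniq : ∀ β₁, 0 < β₁ → β₁ ≤ β → ∃ ε₁ > 0, IsUniquenessRadius g (stableProjL A) β₁ ε₁)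
    (hg : AnalyticAt ℂ g 0) (hg0 : g 0 = 0) (hg1 : HasFDerivAt g A 0)
    {η ν₁ : ℝ} (hA : IsStableCone A η ν₁) (hν₁ : 0 < ν₁) (hη : 0 < η) :
    ∃ (r : ℝ) (C : ℝ → ℝ), 0 < r ∧ r ≤ R ∧ (∀ β', 0 ≤ C β') ∧
      ∀ ξ, stableProjL A ξ = ξ → ‖ξ‖ < r → ∃ v : ℂ → Cn n, v 0 = V ξ 0 ∧
        AnalyticOnNhd ℂ v (forwardWedge 0 ν₁) ∧
        ∀ t ∈ forwardWedge 0 ν₁, HasDerivAt v (g (v t)) t ∧ OnGraph (stableProjL A) V R (v t) ∧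
          ‖v t‖ < ε ∧ ∀ β' < η, ‖v t‖ ≤ C β' * Real.exp (-β' * t.re) * ‖ξ‖ := by
  obtain ⟨Y, ν', ρ', K', hνν', hρ', hY, -, -, hsharp⟩ :=
    exists_isSolutionFamily hg hg0 hg1 hA hν₁ hη
  set P := stableProjL A with hP
  have hV := hM.family
  have hK := hV.const_nonneg
  have hK' := hY.const_nonneg
  -- The family `V` of the manifold and the family `Y` adapted to the given wedge both decay at this
  -- rate, so uniqueness identifies them.
  have hβ₁ : 0 < min β (3 * η / 4) := lt_min hβ (by positivity)
  obtain ⟨ε₁, hε₁, hU⟩ := huniq _ hβ₁ (min_le_left _ _)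
  obtain ⟨r₁, hr₁, h1⟩ := exists_mul_norm_lt (n := n) (M := K * Real.exp β)
    (by positivity) (lt_min hM.eps_pos hε₁)
  obtain ⟨r₂, hr₂, h2⟩ := exists_mul_norm_lt (n := n)
    (M := ‖P‖ * (K' * Real.exp (3 * η / 4))) (by positivity) (lt_min hM.pos hr₁)
  obtain ⟨r₃, hr₃, h3⟩ := exists_mul_norm_lt (n := n)
    (M := K' * Real.exp (3 * η / 4)) (by positivity) (lt_min hM.eps_pos hε₁)
  have hex : ∀ β', ∃ C, 0 ≤ C ∧ (β' < η → ∀ ξ, ‖ξ‖ < ρ' → ∀ t ∈ forwardWedge 0 ν₁,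
      ‖Y ξ t‖ ≤ C * Real.exp (-β' * t.re) * ‖ξ‖) := by
    intro β'
    by_cases hb : β' < η
    · obtain ⟨C, hC, h⟩ := hsharp β' hb
      exact ⟨C, hC, fun _ => h⟩
    -- A default value: no estimate is claimed for β' ≥ η.
    · exact ⟨0, le_rfl, fun h => absurd h hb⟩
  choose C hC0 hC using hex
  have hpos : 0 < min (min R ρ') (min r₂ r₃) :=
    lt_min (lt_min hM.pos hρ') (lt_min hr₂ hr₃)
  refine ⟨min (min R ρ') (min r₂ r₃), C, hpos, (min_le_left _ _).trans (min_le_left _ _), hC0,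
    fun ξ hPξ hξ => ?_⟩
  have hξρ : ‖ξ‖ < ρ' := hξ.trans_le ((min_le_left _ _).trans (min_le_right _ _))
  have hξ₂ := h2 ξ (hξ.trans_le ((min_le_right _ _).trans (min_le_left _ _)))
  have hξ₃ := h3 ξ (hξ.trans_le ((min_le_right _ _).trans (min_le_right _ _)))
  have hgraph : ∀ t ∈ wedgeNhd ν', OnGraph P V R (Y ξ t) := by
    intro t ht
    have h4 : ‖P (Y ξ t)‖ < min R r₁ :=
      ((P.le_opNorm _).trans (mul_le_mul_of_nonneg_left (hY.norm_le hξρ ht)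
        (norm_nonneg _))).trans_lt (by rw [← mul_assoc]; exact hξ₂)
    refine ⟨h4.trans_le (min_le_left _ _), ?_⟩
    have := hV.eq_of_isHalfLineSolution stableProjL_idem hU (min_le_left _ _)
      (hY.isHalfLineSolution hξρ ht) (K₁ := K' * Real.exp (-(3 * η / 4) * t.re) * ‖ξ‖)
      (fun x hx => ((hY.norm_le hξρ (add_mem_wedgeNhd hY.opening_pos ht hx)).trans_lt
        hξ₃).trans_le (min_le_right _ _))
      (fun x hx => by
        refine (hY.decay ξ hξρ _ (add_mem_wedgeNhd hY.opening_pos ht hx)).trans ?_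
        have hre : (t + (x : ℂ)).re = t.re + x := by simp
        have hx0 : 0 ≤ x := hx
        rw [hre, mul_add, Real.exp_add]
        calc _ = K' * Real.exp (-(3 * η / 4) * t.re) * ‖ξ‖ * Real.exp (-(3 * η / 4) * x) := by
              ring
          _ ≤ _ := by
            refine mul_le_mul_of_nonneg_left (Real.exp_le_exp.2 ?_) (by positivity)
            nlinarith [min_le_right β (3 * η / 4)])
      (by simpa using (h4.trans_le (min_le_left _ _)).trans_le hM.le)
      (by simpa using (h1 _ (h4.trans_le (min_le_right _ _))).trans_le (min_le_right _ _))
      0 self_mem_Ici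
    simpa using this
  have hsub := forwardWedge_subset_wedgeNhd hν₁ hνν'
  refine ⟨Y ξ, ?_, fun t ht => ((hY.differentiableOn hξρ).analyticAt
    ((isOpen_wedgeNhd ν').mem_nhds (hsub ht))), fun t ht => ⟨hY.deriv ξ hξρ t (hsub ht),
      hgraph t (hsub ht), ?_, fun β' hb => hC β' hb ξ hξρ t ht⟩⟩
  · have := (hgraph 0 (zero_mem_wedgeNhd hY.opening_pos)).2
    rwa [hY.proj ξ hξρ, hPξ] at this
  · exact ((hY.norm_le hξρ (hsub ht)).trans_lt hξ₃).trans_le (min_le_left _ _)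

/-- Real profiles tending to the equilibrium extend to wedges. -/
theorem exists_profile_extension (hg : AnalyticAt ℂ g 0) (hg0 : g 0 = 0)
    (hg1 : HasFDerivAt g A 0) {W : Set (Cn n)} (hW : W ∈ 𝓝 0)
    {η ν₁ : ℝ} (hA : IsStableCone A η ν₁) (hν₁ : 0 < ν₁) (hη : 0 < η) {z : ℝ → Cn n}
    (hz : IsHalfLineSolution g z)
    (hlim : (IsHyperbolic A ∧ Tendsto z atTop (𝓝 0)) ∨
      ∃ K β : ℝ, 0 < β ∧ ∀ x : ℝ, 0 ≤ x → ‖z x‖ ≤ K * Real.exp (-β * x)) :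
    ∃ (T : ℝ) (v : ℂ → Cn n), 0 ≤ T ∧ AnalyticOnNhd ℂ v (forwardWedge 0 ν₁) ∧
      (∀ t ∈ forwardWedge 0 ν₁, HasDerivAt v (g (v t)) t ∧ v t ∈ W) ∧
      (∀ x : ℝ, 0 ≤ x → v x = z (T + x)) ∧
      ∀ β < η, ∃ C, 0 ≤ C ∧ ∀ t ∈ forwardWedge 0 ν₁, ‖v t‖ ≤ C * Real.exp (-β * t.re) := by
  obtain ⟨Y, ν', ρ', K', hνν', hρ', hY, -, -, hsharp⟩ :=
    exists_isSolutionFamily hg hg0 hg1 hA hν₁ hη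
  have hK' := hY.const_nonneg
  obtain ⟨r, hr, hball⟩ := Metric.mem_nhds_iff.1 hW
  obtain ⟨r₁, hr₁, h1⟩ := exists_mul_norm_lt (n := n) (M := K' * Real.exp (3 * η / 4))
    (by positivity) hr
  have hev : ∀ᶠ T in atTop, ‖stableProjL A (z T)‖ < ρ' ∧ ‖stableProjL A (z T)‖ < r₁ ∧
      ∀ x ∈ Ici (0 : ℝ), z (T + x) = Y (stableProjL A (z T)) x := by
    rcases hlim with ⟨hhyp, hz0⟩ | ⟨K₁, β', hβ', hzK⟩
    -- Uniqueness at rate 0 asks only for boundedness, which convergence to 0 supplies with constant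
    -- 1.
    · obtain ⟨ε₁, hε₁, hU⟩ := exists_isUniquenessRadius hg hg1 hA hν₁ le_rfl hη (Or.inr hhyp)
      refine hY.eventually_eq stableProjL_idem hρ' hε₁ hU (by positivity) hz hz0 (K₁ := 1) ?_ hr₁
      have := hz0.norm
      rw [norm_zero] at this
      filter_upwards [this.eventually_lt_const one_pos] with x hx
      simpa using hx.le
    · have hzK' : ∀ᶠ x in atTop, ‖z x‖ ≤ K₁ * Real.exp (-β' * x) :=
        eventually_atTop.2 ⟨0, hzK⟩
      obtain ⟨ε₁, hε₁, hU⟩ := hA.exists_uniqueness hg hg1 hν₁ (min (3 * η / 4) β')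
        (lt_min (by positivity) hβ') ((min_le_left _ _).trans_lt (by linarith))
      exact hY.eventually_eq stableProjL_idem hρ' hε₁ hU (min_le_left _ _) hz
        (tendsto_zero_of_exp_bound hβ' hzK')
        (eventually_exp_bound_mono (min_le_right _ _) hzK') hr₁
  obtain ⟨T, ⟨hT1, hT2, hT3⟩, hT0⟩ := (hev.and (eventually_ge_atTop 0)).exists
  have hsub := forwardWedge_subset_wedgeNhd hν₁ hνν'
  refine ⟨T, Y (stableProjL A (z T)), hT0, fun t ht => ((hY.differentiableOn hT1).analyticAt
    ((isOpen_wedgeNhd ν').mem_nhds (hsub ht))), fun t ht => ⟨hY.deriv _ hT1 t (hsub ht), hball ?_⟩,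
    fun x hx => (hT3 x hx).symm, fun β hβ => ?_⟩
  · rw [mem_ball_zero_iff]
    exact (hY.norm_le hT1 (hsub ht)).trans_lt (h1 _ hT2)
  · obtain ⟨C, hC, h⟩ := hsharp β hβ
    refine ⟨C * ‖stableProjL A (z T)‖, by positivity, fun t ht => (h _ hT1 t ht).trans ?_⟩
    rw [mul_right_comm]

end Manifold

/-! ### The graph map and the passage to the original equation -/

section Main

variable {n : ℕ}

theorem spectralSubspace_compl_le (A : Cn n →L[ℂ] Cn n) :
    spectralSubspace A {μ | μ.re < 0}ᶜ ≤ centerUnstableSubspace A := by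
  refine iSup₂_le fun μ hμ => ?_
  rcases (not_lt.1 hμ : 0 ≤ μ.re).eq_or_lt with h | h
  · exact le_sup_of_le_left (le_iSup₂_of_le (f := fun μ (_ : μ ∈ {μ : ℂ | μ.re = 0}) =>
      Module.End.maxGenEigenspace (A : Module.End ℂ (Cn n)) μ) μ h.symm le_rfl)
  · exact le_sup_of_le_right (le_iSup₂_of_le (f := fun μ (_ : μ ∈ {μ : ℂ | 0 < μ.re}) =>
      Module.End.maxGenEigenspace (A : Module.End ℂ (Cn n)) μ) μ h le_rfl)

/-- The complementary projection `1 - Π_s`, with values in `Σ_c ⊕ Σ_u`. -/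
def centerUnstableProjL (A : Cn n →L[ℂ] Cn n) : Cn n →L[ℂ] centerUnstableSubspace A :=
  (1 - stableProjL A).codRestrict (centerUnstableSubspace A)
    fun v => spectralSubspace_compl_le A (sub_spectralProjL_mem A _ v)

theorem coe_centerUnstableProjL (A : Cn n →L[ℂ] Cn n) (v : Cn n) :
    (centerUnstableProjL A v : Cn n) = v - stableProjL A v := rfl

/-- The map whose graph is the stable manifold, from the family of decaying solutions. -/
def graphMap (A : Cn n →L[ℂ] Cn n) (V : Cn n → ℂ → Cn n) :
    stableSubspace A → centerUnstableSubspace A := fun ξ => centerUnstableProjL A (V ξ 0)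

theorem stableProjL_mem (A : Cn n →L[ℂ] Cn n) (v : Cn n) : stableProjL A v ∈ stableSubspace A :=
  spectralProjL_mem A _ v

theorem stableProjL_coe {A : Cn n →L[ℂ] Cn n} (ξ : stableSubspace A) :
    stableProjL A (ξ : Cn n) = ξ := spectralProjL_of_mem A ξ.2

variable {A : Cn n →L[ℂ] Cn n} {g : Cn n → Cn n} {V : Cn n → ℂ → Cn n} {ν β ρ K R ε : ℝ}

theorem IsSolutionFamily.coe_add_graphMap (hV : IsSolutionFamily g (stableProjL A) V ν β ρ K)
    {ξ : stableSubspace A} (hξ : ‖ξ‖ < ρ) : (ξ : Cn n) + (graphMap A V ξ : Cn n) = V ξ 0 := by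
  rw [graphMap, coe_centerUnstableProjL, hV.proj ξ hξ, stableProjL_coe, add_sub_cancel]

/-- ξ + Φ(ξ) = V ξ(0), because V ξ(0) has stable component ξ. -/
theorem IsSolutionFamily.mem_localGraph_iff (hV : IsSolutionFamily g (stableProjL A) V ν β ρ K)
    {r : ℝ} (hr : r ≤ ρ) {p q : Cn n} :
    q ∈ localGraph p (graphMap A V) r ↔ OnGraph (stableProjL A) V r (q - p) := by
  constructor
  · rintro ⟨ξ, hξ, rfl⟩
    have hξρ := hξ.trans_le hr
    rw [add_assoc, hV.coe_add_graphMap hξρ, add_sub_cancel_left, OnGraph, hV.proj ξ hξρ,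
      stableProjL_coe]
    exact ⟨hξ, rfl⟩
  · rintro ⟨h1, h2⟩
    have e := hV.coe_add_graphMap (ξ := ⟨stableProjL A (q - p), stableProjL_mem A _⟩)
      (h1.trans_le hr)
    refine ⟨⟨stableProjL A (q - p), stableProjL_mem A _⟩, h1, ?_⟩
    rw [add_assoc, e]
    exact (add_eq_of_eq_sub' h2.symm).symm

theorem isAnalyticInvariantGraph {f : Cn n → Cn n} {U : Set (Cn n)} {p : Cn n}
    (hM : IsLocalManifold (fun y => f (p + y)) (stableProjL A) V ν β ρ K R ε)
    (hW : Metric.ball 0 ε ⊆ {y | p + y ∈ U})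
    (han : AnalyticOnNhd ℂ (fun ξ => V ξ 0) (Metric.ball 0 ρ))
    (htan : HasFDerivAt (fun ξ => V ξ 0) (stableProjL A) 0) :
    IsAnalyticInvariantGraph f U p A (graphMap A V) R where
  pos := hM.pos
  analytic := fun ξ hξ => by
    have hξ' : (stableSubspace A).subtypeL ξ ∈ Metric.ball (0 : Cn n) ρ := by
      rw [mem_ball_zero_iff] at hξ ⊢
      exact hξ.trans_le hM.le
    exact ((centerUnstableProjL A).analyticAt _).comp
      (AnalyticAt.comp (g := fun ξ => V ξ 0) (han _ hξ') ((stableSubspace A).subtypeL.analyticAt ξ))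
  map_zero := by
    have h0 := hM.family.decay 0 (by simpa using hM.pos.trans_le hM.le) 0
      (zero_mem_wedgeNhd hM.family.opening_pos)
    rw [norm_zero, mul_zero, norm_le_zero_iff] at h0
    rw [graphMap, Submodule.coe_zero, h0, _root_.map_zero]
  -- The derivative of ξ ↦ V ξ(0) at 0 is Π_s, which 1 - Π_s annihilates.
  tangent := by
    have h1 : HasFDerivAt (fun ξ => V ξ 0) (stableProjL A)
        ((stableSubspace A).subtypeL (0 : stableSubspace A)) := by simpa using htan
    refine ((centerUnstableProjL A).hasFDerivAt.comp 0
      (h1.comp 0 (stableSubspace A).subtypeL.hasFDerivAt)).congr_fderiv ?_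
    ext1 ξ
    refine Subtype.ext ?_
    change stableProjL A ξ - stableProjL A (stableProjL A ξ) = 0
    rw [stableProjL_idem, sub_self]
  subset_domain := fun q hq => by
    obtain ⟨h1, h2⟩ := (hM.family.mem_localGraph_iff hM.le).1 hq
    have h3 := hM.small _ h1 0 (zero_mem_wedgeNhd hM.family.opening_pos)
    rw [← h2] at h3
    have h4 := hW (show q - p ∈ Metric.ball 0 ε by simpa using h3)
    simpa using h4
  invariant := fun D u hD hD' hu hN hex t ht => by
    obtain ⟨t₁, ht₁, h1⟩ := hex
    rw [hM.family.mem_localGraph_iff hM.le] at h1 ⊢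
    refine hM.invariant han.continuousOn hD hD' (u := fun t => u t - p) (fun t ht => ?_) hN
      ⟨t₁, ht₁, h1⟩ t ht
    rw [add_sub_cancel]
    exact ((hu t ht).2.hasDerivAt (hD.mem_nhds ht)).sub_const p

theorem isHalfLineSolution_of_wedge {f : Cn n → Cn n} {U : Set (Cn n)} {p : Cn n} {ν : ℝ}
    (hν : 0 < ν) {u : ℂ → Cn n} (hu : IsSolutionOn f U (forwardWedge 0 ν) u) :
    IsHalfLineSolution (fun y => f (p + y)) (fun x : ℝ => u x - p) := by
  intro x hx
  have hmaps : MapsTo (fun x : ℝ => (x : ℂ)) (Ici 0) (forwardWedge 0 ν) := fun y hy =>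
    ⟨by simpa using hy, by simpa using mul_nonneg hν.le (abs_nonneg y)⟩
  have h1 : HasDerivWithinAt (fun x : ℝ => (x : ℂ)) 1 (Ici 0) x := by
    have h2 : HasDerivAt (fun x : ℝ => (x : ℂ)) 1 x := by
      simpa using (hasDerivAt_id x).ofReal_comp
    exact h2.hasDerivWithinAt
  have h3 := ((hu x (hmaps hx)).2.scomp x h1 hmaps).sub_const p
  rw [one_smul] at h3
  simpa using h3

/-- Uniqueness needs only the restriction of the solution to the real axis. It also gives the
converse in the local characterization: for q close to p the bound K|q - p| is below the threshold
δ. -/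
theorem isCharacterizedByDecay {f : Cn n → Cn n} {U : Set (Cn n)} {p : Cn n}
    (hM : IsLocalManifold (fun y => f (p + y)) (stableProjL A) V ν β ρ K R ε) (hβ : 0 < β)
    (hW : Metric.ball 0 ε ⊆ {y | p + y ∈ U})
    (huniq : ∀ β₁, 0 < β₁ → β₁ ≤ β →
      ∃ ε₁ > 0, IsUniquenessRadius (fun y => f (p + y)) (stableProjL A) β₁ ε₁)
    (hg : AnalyticAt ℂ (fun y => f (p + y)) 0) (hg0 : f (p + 0) = 0)
    (hg1 : HasFDerivAt (fun y => f (p + y)) A 0)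
    {η ν₁ : ℝ} (hA : IsStableCone A η ν₁) (hν₁ : 0 < ν₁) (hη : 0 < η) :
    IsCharacterizedByDecay f U p A (graphMap A V) R η ν₁ := by
  have huniqueness : ∃ δ : ℝ, 0 < δ ∧ ∀ u : ℂ → Cn n, IsSolutionOn f U (forwardWedge 0 ν₁) u →
      (∀ t ∈ forwardWedge 0 ν₁, ‖u t - p‖ < δ) →
      (∃ K β : ℝ, 0 < β ∧ ∀ t ∈ forwardWedge 0 ν₁, ‖u t - p‖ ≤ K * Real.exp (-β * |t.re|)) →
      u 0 ∈ localGraph p (graphMap A V) R := by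
    obtain ⟨r₁, hr₁, h1⟩ := exists_mul_norm_lt (n := n) (M := ‖stableProjL A‖)
      (norm_nonneg _) hM.pos
    refine ⟨min ε r₁, lt_min hM.eps_pos hr₁, fun u hu hδ hex => ?_⟩
    obtain ⟨K₁, β', hβ', hK₁⟩ := hex
    have hmem : ∀ x ∈ Ici (0 : ℝ), (x : ℂ) ∈ forwardWedge 0 ν₁ := fun y hy =>
      ⟨by simpa using hy, by simpa using mul_nonneg hν₁.le (abs_nonneg y)⟩
    have := hM.onGraph_of_decay hβ huniq (isHalfLineSolution_of_wedge hν₁ hu)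
      (fun x hx => (hδ x (hmem x hx)).trans_le (min_le_left _ _))
      (fun x hx => ((stableProjL A).le_opNorm _).trans_lt
        (h1 _ ((hδ x (hmem x hx)).trans_le (min_le_right _ _)))) hβ' (K₁ := K₁)
      (fun x hx => by
        have h2 := hK₁ x (hmem x hx)
        rwa [Complex.ofReal_re, abs_of_nonneg (mem_Ici.1 hx)] at h2)
    rw [hM.family.mem_localGraph_iff hM.le]
    simpa using this
  refine ⟨?_, huniqueness⟩
  obtain ⟨r, C, hr, hrR, hC0, hsol⟩ := hM.exists_wedge_solution hβ huniq hg hg0 hg1 hA hν₁ hη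
  have hP := (stableProjL A).le_opNorm
  have hdecay : ∀ q ∈ localGraph p (graphMap A V) r, ∃ u : ℂ → Cn n, u 0 = q ∧
      AnalyticOnNhd ℂ u (forwardWedge 0 ν₁) ∧
      (∀ t ∈ forwardWedge 0 ν₁, u t ∈ localGraph p (graphMap A V) R) ∧
      ∀ β : ℝ, 0 < β → β < η →
        -- The family is estimated by the stable component of q - p, whence the factor ‖Π_s‖.
        DecaysOnWedge f U p ν₁ β (C β * ‖stableProjL A‖) u := by
    intro q hq
    obtain ⟨h1, h2⟩ := (hM.family.mem_localGraph_iff (hrR.trans hM.le)).1 hq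
    obtain ⟨v, hv0, hva, hv⟩ := hsol _ (stableProjL_idem _) h1
    have hu0 : p + v 0 = q := by rw [hv0, ← h2, add_sub_cancel]
    refine ⟨fun t => p + v t, hu0, fun t ht => analyticAt_const.add (hva t ht), fun t ht => ?_,
      fun β' hβ'0 hβ'η => ⟨fun t ht => ⟨?_, ?_⟩, fun t ht => ?_⟩⟩
    · rw [hM.family.mem_localGraph_iff hM.le, add_sub_cancel_left]
      exact (hv t ht).2.1
    · exact hW (by simpa using (hv t ht).2.2.1)
    · exact ((hv t ht).1.const_add p).hasDerivWithinAt
    · have h3 := (hv t ht).2.2.2 β' hβ'η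
      rw [add_sub_cancel_left, abs_of_nonneg ht.1]
      simp only [hu0]
      calc _ ≤ C β' * Real.exp (-β' * t.re) * (‖stableProjL A‖ * ‖q - p‖) :=
            h3.trans (mul_le_mul_of_nonneg_left (hP _)
              (mul_nonneg (hC0 β') (Real.exp_pos _).le))
        _ = _ := by ring
  refine ⟨r, fun β' => C β' * ‖stableProjL A‖, hr, hrR, hdecay,
    fun β' hβ'0 hβ'η K₁ hK₁ => ?_⟩
  obtain ⟨δ, hδ, hun⟩ := huniqueness
  have hK₁0 : 0 ≤ K₁ := (mul_nonneg (hC0 β') (norm_nonneg _)).trans hK₁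
  obtain ⟨r₁, hr₁, hs₁⟩ := exists_mul_norm_lt (n := n) (M := ‖stableProjL A‖) (norm_nonneg _) hr
  obtain ⟨r₂, hr₂, hs₂⟩ := exists_mul_norm_lt (n := n) (M := K₁) hK₁0 hδ
  filter_upwards [Metric.ball_mem_nhds p (lt_min hr₁ hr₂)] with q hq
  rw [mem_ball_iff_norm] at hq
  constructor
  · intro hqR
    have h1 := (hM.family.mem_localGraph_iff hM.le).1 hqR
    have hqr : q ∈ localGraph p (graphMap A V) r :=
      (hM.family.mem_localGraph_iff (hrR.trans hM.le)).2
        ⟨(hP _).trans_lt (hs₁ _ (hq.trans_le (min_le_left _ _))), h1.2⟩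
    obtain ⟨u, hu0, -, -, hu⟩ := hdecay q hqr
    obtain ⟨h2, h3⟩ := hu β' hβ'0 hβ'η
    exact ⟨u, hu0, h2, fun t ht => (h3 t ht).trans (by gcongr)⟩
  · rintro ⟨u, hu0, h2, h3⟩
    rw [← hu0]
    rw [hu0] at h3
    refine hun u h2 (fun t ht => (h3 t ht).trans_lt ?_) ⟨K₁ * ‖q - p‖, β', hβ'0, fun t ht =>
      (h3 t ht).trans (le_of_eq (by ring))⟩
    refine lt_of_le_of_lt ?_ (hs₂ _ (hq.trans_le (min_le_right _ _)))
    have h4 : Real.exp (-β' * |t.re|) ≤ 1 :=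
      Real.exp_le_one_iff.2 (by nlinarith [abs_nonneg t.re])
    calc K₁ * Real.exp (-β' * |t.re|) * ‖q - p‖ ≤ K₁ * 1 * ‖q - p‖ := by gcongr
      _ = _ := by ring

/-- Converts decay measured from the vertex of a wedge into decay in |Re z|. -/
theorem exp_neg_mul_sub_le {β a x : ℝ} (hβ : 0 < β) :
    Real.exp (-β * |x - a|) ≤ Real.exp (β * |a|) * Real.exp (-β * |x|) := by
  rw [← Real.exp_add]
  refine Real.exp_le_exp.2 ?_
  have : |x| ≤ |x - a| + |a| := by
    calc |x| = |(x - a) + a| := by rw [sub_add_cancel]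
      _ ≤ _ := abs_add_le _ _
  nlinarith

theorem ofReal_neg_one_smul (A : Cn n →L[ℂ] Cn n) : ((-1 : ℝ) : ℂ) • A = -A := by
  ext1 w
  rw [smul_apply, Complex.ofReal_neg, Complex.ofReal_one, neg_smul, one_smul, neg_apply]

theorem IsHyperbolic.neg (hA : IsHyperbolic A) : IsHyperbolic (-A) := by
  intro μ hμ hre
  obtain ⟨v, hv⟩ := hμ.exists_hasEigenvector
  have hAv : (-A) v = μ • v := hv.apply_eq_smul
  have hAv' : A v = (-μ) • v := by rw [neg_smul, ← hAv, neg_apply, neg_neg]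
  refine hA (-μ) (Module.End.hasEigenvalue_of_hasEigenvector (x := v)
    ⟨Module.End.mem_eigenspace_iff.2 hAv', hv.2⟩) ?_
  rw [Complex.neg_re, hre, neg_zero]

/-- Extension of a profile to a wedge, for a half-line in the direction `σ = ±1`. -/
theorem exists_profile_extension_direction {f : Cn n → Cn n} {U : Set (Cn n)} {p : Cn n}
    (hW : {y | p + y ∈ U} ∈ 𝓝 0) {σ : ℝ} (hσ : σ = 1 ∨ σ = -1)
    (hg : AnalyticAt ℂ (fun y => f (p + y)) 0) (hg0 : f (p + 0) = 0)
    (hg1 : HasFDerivAt (fun y => f (p + y)) A 0)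
    {η ν : ℝ} (hA : IsStableCone ((σ : ℂ) • A) η ν) (hν : 0 < ν) (hη : 0 < η) {x₀ : ℝ}
    {u : ℝ → Cn n} {I : Set ℝ} (hI : ∀ x, 0 ≤ x → x₀ + σ * x ∈ I)
    (hu : IsRealSolutionOn f U I u)
    (hlim : (IsHyperbolic A ∧ Tendsto (fun x => u (x₀ + σ * x)) atTop (𝓝 p)) ∨
      ∃ K β : ℝ, 0 < β ∧ ∀ x : ℝ, 0 ≤ x → ‖u (x₀ + σ * x) - p‖ ≤ K * Real.exp (-β * x)) :
    ∃ (T : ℝ) (v : ℂ → Cn n), 0 ≤ T ∧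
      ∀ D : Set ℂ, (∀ z ∈ D, (σ : ℂ) * (z - (x₀ + σ * T : ℝ)) ∈ forwardWedge 0 ν) →
        AnalyticOnNhd ℂ v D ∧ IsSolutionOn f U D v ∧
        (∀ x : ℝ, 0 ≤ σ * (x - (x₀ + σ * T)) → v x = u x) ∧
        ∀ β : ℝ, 0 < β → β < η → ∃ K : ℝ, ∀ z ∈ D, ‖v z - p‖ ≤ K * Real.exp (-β * |z.re|) := by
  have hσσ : σ * σ = 1 := by rcases hσ with rfl | rfl <;> norm_num
  have hσσ' : (σ : ℂ) * σ = 1 := by rw [← Complex.ofReal_mul, hσσ, Complex.ofReal_one]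
  have hσabs : |σ| = 1 := by rcases hσ with rfl | rfl <;> norm_num
  set z : ℝ → Cn n := fun x => u (x₀ + σ * x) - p with hz
  have hmaps : MapsTo (fun x => x₀ + σ * x) (Ici 0) I := fun x hx => hI x hx
  have hsol : IsHalfLineSolution (fun y => (σ : ℂ) • f (p + y)) z := by
    intro x hx
    have h1 : HasDerivWithinAt (fun x => x₀ + σ * x) σ (Ici 0) x := by
      have h2 : HasDerivAt (fun x => x₀ + σ * x) σ x := by
        simpa using ((hasDerivAt_id x).const_mul σ).const_add x₀
      exact h2.hasDerivWithinAt
    have h3 := ((hu _ (hmaps hx)).2.scomp x h1 hmaps).sub_const p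
    refine h3.congr_deriv ?_
    simp only [hz, add_sub_cancel]
    exact (Complex.coe_smul σ _).symm
  have hhyp : IsHyperbolic A → IsHyperbolic ((σ : ℂ) • A) := fun h => by
    rcases hσ with rfl | rfl
    · simpa using h
    · rw [ofReal_neg_one_smul]
      exact h.neg
  obtain ⟨T, v, hT, hva, hv, hvz, hdec⟩ := exists_profile_extension
    (g := fun y => (σ : ℂ) • f (p + y)) (A := (σ : ℂ) • A) (hg.const_smul (c := (σ : ℂ)) :)
    (by rw [hg0, smul_zero])
    (hg1.const_smul (σ : ℂ)) hW hA hν hη hsol (by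
      rcases hlim with ⟨h1, h2⟩ | h
      · refine Or.inl ⟨hhyp h1, ?_⟩
        have := h2.sub_const p
        rwa [sub_self] at this
      · exact Or.inr h)
  set a : ℝ := x₀ + σ * T with ha
  -- The affine time change sends the vertex `a` to 0; its derivative σ cancels the σ in front of
  -- the vector field, as σ² = 1.
  set L : ℂ → ℂ := fun z => (σ : ℂ) * (z - (a : ℂ)) with hL
  have hLd : ∀ z, HasDerivAt L σ z := fun z => by
    simpa using ((hasDerivAt_id z).sub_const (a : ℂ)).const_mul (σ : ℂ)
  have hLa : ∀ z, AnalyticAt ℂ L z := fun z => analyticAt_const.mul (analyticAt_id.sub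
    analyticAt_const)
  refine ⟨T, fun z => p + v (L z), hT, fun D hD => ⟨fun z hz => ?_, fun z hz => ⟨?_, ?_⟩,
    fun x hx => ?_, fun β' hβ'0 hβ'η => ?_⟩⟩
  · exact analyticAt_const.add (AnalyticAt.comp (f := L) (hva _ (hD z hz)) (hLa z))
  · exact (hv _ (hD z hz)).2
  · have h1 := (((hv _ (hD z hz)).1.scomp z (hLd z)).const_add p).hasDerivWithinAt (s := D)
    refine h1.congr_deriv ?_
    rw [smul_smul, hσσ', one_smul]
  · have h1 : v ((σ * (x - a) : ℝ) : ℂ) = z (T + σ * (x - a)) := hvz _ hx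
    have h2 : L x = ((σ * (x - a) : ℝ) : ℂ) := by rw [hL]; push_cast; rfl
    simp only [h2, h1, hz]
    have h3 : x₀ + σ * (T + σ * (x - a)) = x := by
      linear_combination (x - a) * hσσ - ha
    rw [h3, add_sub_cancel]
  · obtain ⟨C, hC, h1⟩ := hdec β' hβ'η
    refine ⟨C * Real.exp (β' * |a|), fun z hz => ?_⟩
    have h2 := h1 _ (hD z hz)
    have h3 : (L z).re = |z.re - a| := by
      have h4 : 0 ≤ (L z).re := (hD z hz).1
      have h5 : (L z).re = σ * (z.re - a) := by
        rw [hL]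
        simp
      rw [← abs_of_nonneg h4, h5, abs_mul, hσabs, one_mul]
    rw [show (σ : ℂ) * (z - (a : ℂ)) = L z from rfl, h3] at h2
    rw [add_sub_cancel_left, mul_assoc]
    exact h2.trans (mul_le_mul_of_nonneg_left (exp_neg_mul_sub_le hβ'0) hC)

end Main

end AnalyticStable

end

/-! ### The theorem -/

theorem theoremA1 (n : ℕ) (U : Set (AnalyticStable.Cn n)) (hU : IsOpen U)
    (f : AnalyticStable.Cn n → AnalyticStable.Cn n) (hf : AnalyticOnNhd ℂ f U)
    (p : AnalyticStable.Cn n) (hp : p ∈ U) (hfp : f p = 0)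
    (A : AnalyticStable.Cn n →L[ℂ] AnalyticStable.Cn n) (hA : A = fderiv ℂ f p) :
    -- the linearized bounds hold on some wedge
    (∀ η θ : ℝ, AnalyticStable.IsSpectralRate A η → 0 < θ →
      ∃ ν : ℝ, 0 < ν ∧ AnalyticStable.WedgeBounds A η θ ν) ∧
    -- the stable manifold and its characterization
    (∃ (Φ : AnalyticStable.stableSubspace A → AnalyticStable.centerUnstableSubspace A) (R : ℝ),
      AnalyticStable.IsAnalyticInvariantGraph f U p A Φ R ∧
      ∀ η θ ν : ℝ, AnalyticStable.IsSpectralRate A η → 0 < θ → 0 < ν →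
        AnalyticStable.WedgeBounds A η θ ν →
        AnalyticStable.IsCharacterizedByDecay f U p A Φ R η ν) ∧
    -- profiles converging to the equilibrium as `x → +∞`
    (∀ (x₀ : ℝ) (u : ℝ → AnalyticStable.Cn n),
      AnalyticStable.IsRealSolutionOn f U (Set.Ici x₀) u →
      ((AnalyticStable.IsHyperbolic A ∧ Filter.Tendsto u Filter.atTop (nhds p)) ∨
        (∃ K β : ℝ, 0 < β ∧ ∀ x : ℝ, x₀ ≤ x → ‖u x - p‖ ≤ K * Real.exp (-β * x))) →
      ∀ η θ ν : ℝ, AnalyticStable.IsSpectralRate A η → 0 < θ → 0 < ν →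
        AnalyticStable.WedgeBounds A η θ ν →
        ∃ (a : ℝ) (v : ℂ → AnalyticStable.Cn n), x₀ ≤ a ∧
          AnalyticOnNhd ℂ v (AnalyticStable.forwardWedge a ν) ∧
          AnalyticStable.IsSolutionOn f U (AnalyticStable.forwardWedge a ν) v ∧
          (∀ x : ℝ, a ≤ x → v (x : ℂ) = u x) ∧
          ∀ β : ℝ, 0 < β → β < η → ∃ K : ℝ, ∀ z ∈ AnalyticStable.forwardWedge a ν,
            ‖v z - p‖ ≤ K * Real.exp (-β * |z.re|)) ∧
    -- profiles converging to the equilibrium as `x → -∞`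
    (∀ (x₀ : ℝ) (u : ℝ → AnalyticStable.Cn n),
      AnalyticStable.IsRealSolutionOn f U (Set.Iic x₀) u →
      ((AnalyticStable.IsHyperbolic A ∧ Filter.Tendsto u Filter.atBot (nhds p)) ∨
        (∃ K β : ℝ, 0 < β ∧ ∀ x : ℝ, x ≤ x₀ → ‖u x - p‖ ≤ K * Real.exp (β * x))) →
      ∀ η θ ν : ℝ, AnalyticStable.IsSpectralRate A η → 0 < θ → 0 < ν →
        AnalyticStable.WedgeBounds A η θ ν →
        ∃ (a : ℝ) (v : ℂ → AnalyticStable.Cn n), a ≤ x₀ ∧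
          AnalyticOnNhd ℂ v (AnalyticStable.backwardWedge a ν) ∧
          AnalyticStable.IsSolutionOn f U (AnalyticStable.backwardWedge a ν) v ∧
          (∀ x : ℝ, x ≤ a → v (x : ℂ) = u x) ∧
          ∀ β : ℝ, 0 < β → β < η → ∃ K : ℝ, ∀ z ∈ AnalyticStable.backwardWedge a ν,
            ‖v z - p‖ ≤ K * Real.exp (-β * |z.re|)) := by
  have hg : AnalyticAt ℂ (fun y => f (p + y)) 0 :=
    AnalyticAt.comp_of_eq (g := f) (hf p hp) (analyticAt_const.add analyticAt_id) (add_zero p)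
  have hg0 : f (p + 0) = 0 := by rw [add_zero, hfp]
  have hg1 : HasFDerivAt (fun y => f (p + y)) A 0 := by
    rw [hasFDerivAt_comp_add_left, add_zero, hA]
    exact (hf p hp).differentiableAt.hasFDerivAt
  have hW : {y | p + y ∈ U} ∈ nhds (0 : AnalyticStable.Cn n) :=
    (hU.preimage (continuous_const_add p)).mem_nhds (by simpa using hp)
  refine ⟨fun η θ hη hθ => AnalyticStable.exists_wedgeBounds A hη hθ, ?_, ?_, ?_⟩
  -- The manifold is built from a cone intrinsic to `A`, so Φ and R are fixed before η, θ and ν.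
  · obtain ⟨V, ν', β, ρ, K, R, ε, hβ, hball, hM, han, htan, huniq⟩ :=
      AnalyticStable.exists_isLocalManifold hg hg0 hg1 hW
    exact ⟨AnalyticStable.graphMap A V, R,
      AnalyticStable.isAnalyticInvariantGraph hM hball han htan, fun η θ ν hη _ hν hWB =>
      AnalyticStable.isCharacterizedByDecay hM hβ hball huniq hg hg0 hg1
        (hWB.isStableCone A hν) hν hη.1⟩
  · intro x₀ u hu hlim η θ ν hη _ hν hWB
    obtain ⟨T, v, hT, hv⟩ := AnalyticStable.exists_profile_extension_direction hW
      (Or.inl rfl : (1 : ℝ) = 1 ∨ (1 : ℝ) = -1) hg hg0 hg1 (η := η) (ν := ν) (x₀ := x₀)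
      (by simpa using hWB.isStableCone A hν) hν hη.1 (fun x hx => by simpa using hx) hu (by
        rcases hlim with ⟨h1, h2⟩ | ⟨K, β, hβ, h⟩
        · refine Or.inl ⟨h1, h2.comp ?_⟩
          simpa using Filter.tendsto_atTop_add_const_left Filter.atTop x₀ Filter.tendsto_id
        -- Moving the origin of time to x₀ changes the constant by e^{-βx₀}.
        · refine Or.inr ⟨K * Real.exp (-β * x₀), β, hβ, fun x hx => ?_⟩
          rw [mul_assoc, ← Real.exp_add, ← mul_add, one_mul]
          exact h _ (by linarith))
    obtain ⟨h1, h2, h3, h4⟩ := hv (AnalyticStable.forwardWedge (x₀ + T) ν) fun z hz => by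
      simpa [AnalyticStable.forwardWedge] using hz
    exact ⟨x₀ + T, v, by linarith, h1, h2, fun x hx => h3 x (by linarith), h4⟩
  · intro x₀ u hu hlim η θ ν hη _ hν hWB
    obtain ⟨T, v, hT, hv⟩ := AnalyticStable.exists_profile_extension_direction hW
      (Or.inr rfl : (-1 : ℝ) = 1 ∨ (-1 : ℝ) = -1) hg hg0 hg1 (η := η) (ν := ν) (x₀ := x₀)
      (by rw [AnalyticStable.ofReal_neg_one_smul]; exact hWB.isStableCone_neg A hν) hν hη.1
      (fun x hx => by simpa using hx) hu (by
        rcases hlim with ⟨h1, h2⟩ | ⟨K, β, hβ, h⟩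
        · refine Or.inl ⟨h1, h2.comp ?_⟩
          simpa using Filter.tendsto_atBot_add_const_left Filter.atTop x₀
            Filter.tendsto_neg_atTop_atBot
        · refine Or.inr ⟨K * Real.exp (β * x₀), β, hβ, fun x hx => ?_⟩
          rw [mul_assoc, ← Real.exp_add]
          refine (h _ (by linarith)).trans_eq ?_
          ring_nf)
    obtain ⟨h1, h2, h3, h4⟩ := hv (AnalyticStable.backwardWedge (x₀ - T) ν) fun z hz => by
      obtain ⟨h5, h6⟩ := hz
      constructor
      · simp
        linarith
      · simp
        rwa [abs_sub_comm, ← sub_eq_add_neg]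
    exact ⟨x₀ - T, v, by linarith, h1, h2, fun x hx => h3 x (by linarith), h4⟩
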